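/- **Setting.** Let $\mathcal A_0=\bigoplus_{\alpha\in I}M_{n_\alpha}(\mathbb C)$ (algebraic direct sum, $n_\alpha\ge1$) with comultiplication $\Delta$ be a discrete quantum group: $\Delta$ is a $*$-homomorphism into the multipliers of $\mathcal A_0\otimes_{\rm alg}\mathcal A_0$, the maps $a\otimes b\mapsto\Delta(a)(1\otimes b)$ and $a\otimes b\mapsto(a\otimes1)\Delta(b)$ are bijections of $\mathcal A_0\otimes_{\rm alg}\mathcal A_0$, and $\Delta$ is coassociative. Let $S$ be its antipode, $\phi$ a left Haar measure (a nonzero positive left invariant functional), $\delta$ the modular element, characterized by $\phi(S(a))=\phi(a\delta)$, $\theta=\delta^{1/2}$ (a family of positive invertible matrices) and $\psi(a)=\phi(a\theta^2)$ the right Haar measure. Let $\hat{\mathcal A}_0$ be $\mathcal A_0$ with the product $a*b=(\mathrm{id}\otimes\psi)\big((1\otimes b)(\mathrm{id}\otimes S^{-1})(\Delta(a))\big)$ and the involution $a^\sharp=\theta^{-2}S^{-1}(a^*)$. Let $\mathcal A$ be the $C^*$-completion of $\mathcal A_0$, that is, the $c_0$-direct sum of the $M_{n_\alpha}$. Let $\hat{\mathcal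 A}$ be the full $C^*$-algebra (the completion of $\hat{\mathcal A}_0$ in its largest $C^*$-norm) and $\hat{\mathcal A}_r$ the reduced one (the completion in the operator norm on $L^2(\phi)$ of the regular representation, in which $a$ acts by $b\mapsto(\psi_a\circ S^{-1}\otimes\mathrm{id})(\Delta(b))$, $b\in\mathcal A_0$, where $\psi_a(y)=\psi(ay)$). Let $\mathcal C$ be a $C^*$-algebra with a coassociative $*$-homomorphism $\Delta_{\mathcal C}:\mathcal C\to\mathcal M(\mathcal C\otimes\mathcal A)$, $\mathcal C_0\subseteq\mathcal C$ a dense $*$-subalgebra and $h\in\mathcal C_0$ positive, such that for all $c,c'\in\mathcal C_0$, $a\in\mathcal A_0$: $\Delta_{\mathcal C}(c)(c'\otimes1)$ and $\Delta_{\mathcal C}(c)(1\otimes a)$ lie in $\mathcal C_0\otimes_{\rm alg}\mathcal A_0$, and $(\mathrm{id}\otimes\phi)(\Delta_{\mathcal C}(h^2)(c\otimes1))=c$. Let $U\in\mathcal M(\mathcal B_0(\mathcal H)\otimes\mathcal A)$ be a unitary representation on a Hilbert space $\mathcal H$, i.e. $U$ is unitary, $(\mathrm{id}\otimes\Delta)(U)=U_{12}U_{13}$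 and $(\mathrm{id}\otimes S)(U)=U^*$, and let $\pi:\mathcal C\to\mathcal B(\mathcal H)$ be a nondegenerate $*$-homomorphism with $(\pi\otimes\mathrm{id})(\Delta_{\mathcal C}(c))=U(\pi(c)\otimes1)U^*$ for all $c\in\mathcal C$. Put $\mathcal H_0=\operatorname{span}\pi(\mathcal C_0)\mathcal H$ and, for $\xi,\eta\in\mathcal H_0$, $a\in\mathcal A_0$, $$\xi.a=(\mathrm{id}\otimes\psi_{\theta^{-1}S(a)\theta^{-2}})(U)\,\xi,\qquad \langle\xi,\eta\rangle_{\hat{\mathcal A}_0}=\theta^{-1}T_{\xi\eta}(U),\qquad \Sigma(\xi)=\big((\pi(h)\otimes\theta^{-1})U\big)\xi ,$$ where $T_{\xi\eta}(A\otimes B)=\langle\xi,A\eta\rangle B$. The free module $\mathcal H\otimes_{\rm alg}\hat{\mathcal A}_0$ carries the action $(\xi\otimes a)b=\xi\otimes(a*b)$ and the inner product $\langle\xi\otimes a,\eta\otimes b\rangle=\langle\xi,\eta\rangle\,a^\sharp*b$. **Statement.** 1. For $\xi,\eta\in\mathcal H_0$ and $a,b\in\mathcal A_0$: $\xi.a\in\mathcal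 H_0$, $\langle\xi,\eta\rangle_{\hat{\mathcal A}_0}\in\mathcal A_0$, $\Sigma(\xi)\in\mathcal H\otimes_{\rm alg}\hat{\mathcal A}_0$, $\xi.a$ is bilinear, $\Sigma$ is linear, $\langle\cdot,\cdot\rangle_{\hat{\mathcal A}_0}$ is conjugate-linear in the first and linear in the second variable, and $(\xi.a).b=\xi.(a*b)$. 2. $\Sigma(\xi.a)=\Sigma(\xi)a$ and $\langle\Sigma(\xi),\Sigma(\eta)\rangle=\langle\xi,\eta\rangle_{\hat{\mathcal A}_0}=\theta^{-1}T_{\xi\eta}(U)$. 3. Consequently $\langle\cdot,\cdot\rangle_{\hat{\mathcal A}_0}$ is a positive $\hat{\mathcal A}_0$-valued inner product: $\langle\xi,\eta.a\rangle=\langle\xi,\eta\rangle*a$, $\langle\xi,\eta\rangle^\sharp=\langle\eta,\xi\rangle$, $\langle\xi,\xi\rangle$ is a finite sum of elements $y^\sharp*y$, and $\langle\xi,\xi\rangle=0$ only for $\xi=0$. 4. For every $C^*$-algebra $B$ containing $\hat{\mathcal A}_0$ as a dense $*$-subalgebra, $\mathcal H_0$ and $\mathcal H\otimes_{\rm alg}\hat{\mathcal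 A}_0$ complete to Hilbert $B$-modules, and $\Sigma$ extends to an inner product preserving $B$-module map identifying the first with a closed submodule of the second. In particular, $\hat{\mathcal A}$ and $\hat{\mathcal A}_r$ exist as such $C^*$-algebras, and $\mathcal H_0$ completes to Hilbert modules $\mathcal E\subset\mathcal F$ over $\hat{\mathcal A}$ and $\mathcal E_r\subset\mathcal F_r$ over $\hat{\mathcal A}_r$, where $\mathcal F$, $\mathcal F_r$ are the completions of $\mathcal H\otimes_{\rm alg}\hat{\mathcal A}_0$. -/

import Mathlib

open scoped TensorProduct ComplexOrder Kronecker

universe u v w x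

noncomputable section

namespace QGrp

/-- The algebraic multipliers of `⨁ α, M_{n α}(ℂ)`: all families `(a_α)` with `a_α ∈ M_{n α}(ℂ)`. -/
abbrev Mult {I : Type u} (n : I → ℕ) : Type u :=
  ∀ α, Matrix (Fin (n α)) (Fin (n α)) ℂ

/-- The algebraic multipliers of the tensor square: all families `(m_{αβ})` with
`m_{αβ} ∈ M_{n α}(ℂ) ⊗ M_{n β}(ℂ)`, the latter realized as matrices indexed by pairs. -/
abbrev Mult2 {I : Type u} (n : I → ℕ) : Type u :=
  ∀ α β, Matrix (Fin (n α) × Fin (n β)) (Fin (n α) × Fin (n β)) ℂ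

/-- Elements of `V ⊗ ∏ α, M_{n α}`: families of matrices with entries in `V`. The matrix
`(x_{ij})` stands for `∑ x_{ij} ⊗ e_{ij}`. -/
abbrev MultV {I : Type u} (n : I → ℕ) (V : Type v) : Type (max u v) :=
  ∀ α, Matrix (Fin (n α)) (Fin (n α)) V

/-- The algebraic direct sum `A₀ = ⨁ α, M_{n α}(ℂ)`, as a star-subalgebra of the multipliers. -/
def finSupp {I : Type u} (n : I → ℕ) : NonUnitalStarSubalgebra ℂ (Mult n) where
  carrier := {a | {α | a α ≠ 0}.Finite}
  zero_mem' := by simp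
  add_mem' {a b} ha hb := by
    refine (Set.Finite.union ha hb).subset fun α h => ?_
    by_contra hc
    simp only [Set.mem_union, Set.mem_ofPred_eq, not_or, not_not] at hc
    exact h (by simp [hc.1, hc.2])
  mul_mem' {a b} ha _ := by
    refine Set.Finite.subset ha fun α h hc => h ?_
    simp [hc]
  smul_mem' c a ha := by
    refine Set.Finite.subset ha fun α h hc => h ?_
    simp [hc]
  star_mem' {a} ha := by
    refine Set.Finite.subset ha fun α h hc => h ?_
    simp [hc]

/-- `A₀` as a type. -/
abbrev Alg {I : Type u} (n : I → ℕ) : Type u := ↥(finSupp n)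

section basic

variable {I : Type u} {n : I → ℕ}

open Classical in
/-- The matrix unit `e^α_{ij}` of `A₀`. -/
def unit (n : I → ℕ) (α : I) (i j : Fin (n α)) : Alg n :=
  ⟨Pi.single α (Matrix.single i j 1), by
    refine (Set.finite_singleton α).subset fun β h => ?_
    by_contra hc
    exact h (Pi.single_eq_of_ne hc _)⟩

/-- Left multiplication of elements of `A₀` by an algebraic multiplier. -/
def lmul (m : Mult n) : Alg n →ₗ[ℂ] Alg n where
  toFun a := ⟨m * (a : Mult n), by
    refine Set.Finite.subset a.2 fun α h hc => h ?_
    simp [hc]⟩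
  map_add' a b := by ext1; simp [mul_add]
  map_smul' c a := by ext1; simp

/-- Right multiplication of elements of `A₀` by an algebraic multiplier. -/
def rmul (m : Mult n) : Alg n →ₗ[ℂ] Alg n where
  toFun a := ⟨(a : Mult n) * m, by
    refine Set.Finite.subset a.2 fun α h hc => h ?_
    simp [hc]⟩
  map_add' a b := by ext1; simp [add_mul]
  map_smul' c a := by ext1; simp

/-- The canonical embedding of `A₀ ⊗_alg A₀` into the multipliers of the tensor square. -/
def toMult2 : Alg n ⊗[ℂ] Alg n →ₗ[ℂ] Mult2 n :=
  TensorProduct.lift (LinearMap.mk₂ ℂ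
    (fun a b α β => (a : Mult n) α ⊗ₖ (b : Mult n) β)
    (fun a a' b => by funext α β; exact Matrix.add_kronecker _ _ _)
    (fun c a b => by funext α β; ext; simp [mul_assoc])
    (fun a b b' => by funext α β; exact Matrix.kronecker_add _ _ _)
    (fun c a b => by funext α β; ext; simp [mul_left_comm]))

/-- `a ⊗ 1`. -/
def leg1 (a : Alg n) : Mult2 n := fun α _ => (a : Mult n) α ⊗ₖ 1

/-- `1 ⊗ b`. -/
def leg2 (b : Alg n) : Mult2 n := fun _ β => 1 ⊗ₖ (b : Mult n) β

/-- `(id ⊗ f)(X) = ∑_{γ,p,q} f(e^γ_{pq}) X^γ_{pq}` for `X = ∑ X^γ_{pq} ⊗ e^γ_{pq}`. In all uses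
only finitely many `γ` contribute. -/
def slice {V : Type v} [AddCommGroup V] [Module ℂ V] (f : Alg n → ℂ) (X : MultV n V) : V :=
  ∑ᶠ γ, ∑ p, ∑ q, f (unit n γ p q) • X γ p q

/-- `(f ⊗ id)(X)` for a multiplier `X` of the tensor square. -/
def sliceLeft (f : Alg n → ℂ) (X : Mult2 n) : Mult n :=
  fun β => Matrix.of fun k l =>
    slice f (fun α => Matrix.of fun i j => X α β (i, k) (j, l))

/-- The canonical embedding of `V ⊗_alg A₀`, with `v ⊗ a` going to the family of matrices
`(a^α_{ij} v)`. -/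
def toMultV {V : Type v} [AddCommGroup V] [Module ℂ V] : V ⊗[ℂ] Alg n →ₗ[ℂ] MultV n V :=
  TensorProduct.lift (LinearMap.mk₂ ℂ
    (fun v a α => Matrix.of fun i j => (a : Mult n) α i j • v)
    (fun v v' a => by funext α; ext i j; simp)
    (fun c v a => by funext α; ext i j; simp [smul_comm c])
    (fun v a a' => by funext α; ext i j; simp [add_smul])
    (fun c v a => by funext α; ext i j; simp [mul_smul]))

end basic

/-- A discrete quantum group: a family of matrix sizes `n α ≥ 1` with `A₀ = ⨁ α, M_{n α}(ℂ)`, and a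
comultiplication `Δ`, such that `T₁(a ⊗ b) = Δ(a)(1 ⊗ b)` and `T₂(a ⊗ b) = (a ⊗ 1)Δ(b)` are
bijections of `A₀ ⊗_alg A₀`, and
`(a ⊗ 1 ⊗ 1)(Δ ⊗ id)(Δ(b)(1 ⊗ c)) = (id ⊗ Δ)((a ⊗ 1)Δ(b))(1 ⊗ 1 ⊗ c)`.

By the bijectivity of `T₁` a unital star-homomorphism from the bounded multipliers of `A₀` to those
of `A₀ ⊗ A₀` with these properties is determined by its restriction to `A₀`, and every `Δ` as below
is such a restriction; so `Δ` is recorded on `A₀`. -/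
structure DiscreteQuantumGroup (I : Type u) where
  n : I → ℕ
  n_pos : ∀ α, 0 < n α
  Δ : Alg n →⋆ₙₐ[ℂ] Mult2 n
  T₁ : Alg n ⊗[ℂ] Alg n →ₗ[ℂ] Alg n ⊗[ℂ] Alg n
  T₁_spec : ∀ a b, toMult2 (T₁ (a ⊗ₜ b)) = Δ a * leg2 b
  T₁_bijective : Function.Bijective T₁
  T₂ : Alg n ⊗[ℂ] Alg n →ₗ[ℂ] Alg n ⊗[ℂ] Alg n
  T₂_spec : ∀ a b, toMult2 (T₂ (a ⊗ₜ b)) = leg1 a * Δ b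
  T₂_bijective : Function.Bijective T₂
  coassoc :
    T₂.rTensor (Alg n) ∘ₗ (TensorProduct.assoc ℂ (Alg n) (Alg n) (Alg n)).symm.toLinearMap ∘ₗ
        T₁.lTensor (Alg n) =
      (TensorProduct.assoc ℂ (Alg n) (Alg n) (Alg n)).symm.toLinearMap ∘ₗ T₁.lTensor (Alg n) ∘ₗ
        (TensorProduct.assoc ℂ (Alg n) (Alg n) (Alg n)).toLinearMap ∘ₗ T₂.rTensor (Alg n) ∘ₗ
          (TensorProduct.assoc ℂ (Alg n) (Alg n) (Alg n)).symm.toLinearMap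

namespace DiscreteQuantumGroup

variable {I : Type u} (G : DiscreteQuantumGroup I)

/-- `(ε ⊗ id)(Δ(a)(1 ⊗ b)) = ab` and `(id ⊗ ε)((a ⊗ 1)Δ(b)) = ab`. -/
def IsCounit (ε : Alg G.n →ₗ[ℂ] ℂ) : Prop :=
  ∀ a b : Alg G.n,
    TensorProduct.lid ℂ (Alg G.n) (ε.rTensor (Alg G.n) (G.T₁ (a ⊗ₜ b))) = a * b ∧
    TensorProduct.rid ℂ (Alg G.n) (ε.lTensor (Alg G.n) (G.T₂ (a ⊗ₜ b))) = a * b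

/-- The counit (uniquely determined by `IsCounit`). -/
def counit : Alg G.n →ₗ[ℂ] ℂ := Classical.epsilon fun ε => G.IsCounit ε

/-- With `m` the multiplication, `m(S ⊗ id)(Δ(a)(1 ⊗ b)) = ε(a)b` and
`m(id ⊗ S)((a ⊗ 1)Δ(b)) = ε(b)a`. -/
def IsAntipode (S : Alg G.n ≃ₗ[ℂ] Alg G.n) : Prop :=
  ∀ a b : Alg G.n,
    LinearMap.mul' ℂ (Alg G.n) (S.toLinearMap.rTensor (Alg G.n) (G.T₁ (a ⊗ₜ b))) =
      G.counit a • b ∧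
    LinearMap.mul' ℂ (Alg G.n) (S.toLinearMap.lTensor (Alg G.n) (G.T₂ (a ⊗ₜ b))) =
      G.counit b • a

/-- The antipode (uniquely determined by `IsAntipode`). -/
def S : Alg G.n ≃ₗ[ℂ] Alg G.n :=
  haveI : Nonempty (Alg G.n ≃ₗ[ℂ] Alg G.n) := ⟨LinearEquiv.refl ℂ _⟩
  Classical.epsilon fun S => G.IsAntipode S

/-- A left Haar measure: a nonzero positive functional `φ` on `A₀` with
`(id ⊗ φ)((b ⊗ 1)Δ(a)) = φ(a)b`. -/
structure IsLeftHaar (φ : Alg G.n →ₗ[ℂ] ℂ) : Prop where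
  ne_zero : φ ≠ 0
  nonneg : ∀ a : Alg G.n, 0 ≤ φ (star a * a)
  left_inv : ∀ a b : Alg G.n,
    TensorProduct.rid ℂ (Alg G.n) (φ.lTensor (Alg G.n) (G.T₂ (b ⊗ₜ a))) = φ a • b

/-- `θ` is the positive square root of the modular element `δ`, which is the algebraic multiplier
with `φ(S(a)) = φ(aδ)`. -/
def IsModularRoot (φ : Alg G.n →ₗ[ℂ] ℂ) (θ : Mult G.n) : Prop :=
  (∀ α, (θ α).PosDef) ∧ ∀ a, φ (G.S a) = φ (rmul (θ * θ) a)

variable (φ : Alg G.n →ₗ[ℂ] ℂ)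

/-- The square root `θ` of the modular element (uniquely determined by `IsModularRoot` when `φ` is a
left Haar measure). -/
def theta : Mult G.n := Classical.epsilon fun θ => G.IsModularRoot φ θ

/-- `θ⁻¹`. -/
def thetaInv : Mult G.n := fun α => (G.theta φ α)⁻¹

/-- The right Haar measure `ψ(a) = φ(aθ²)`. -/
def psi : Alg G.n →ₗ[ℂ] ℂ := φ ∘ₗ rmul (G.theta φ * G.theta φ)

/-- The product of `Â₀`: `a ∗ b = (id ⊗ ψ)((1 ⊗ b)(id ⊗ S⁻¹)(Δ(a)))`, where
`(1 ⊗ b)(id ⊗ S⁻¹)(Δ(a)) = (id ⊗ S⁻¹)(Δ(a)(1 ⊗ S(b)))`. -/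
def conv : Alg G.n →ₗ[ℂ] Alg G.n →ₗ[ℂ] Alg G.n :=
  ((TensorProduct.mk ℂ (Alg G.n) (Alg G.n)).compl₂ G.S.toLinearMap).compr₂
    ((TensorProduct.rid ℂ (Alg G.n)).toLinearMap ∘ₗ
      (G.psi φ ∘ₗ G.S.symm.toLinearMap).lTensor (Alg G.n) ∘ₗ G.T₁)

/-- The involution of `Â₀`: `a^♯ = θ⁻² S⁻¹(a^*)`. -/
def sharp : Alg G.n →ₗ⋆[ℂ] Alg G.n where
  toFun a := lmul (G.thetaInv φ * G.thetaInv φ) (G.S.symm (star a))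
  map_add' a b := by simp
  map_smul' c a := by simp

/-- A linear map `j` from `Â₀` to a C*-algebra that is a star-homomorphism for `∗` and `♯`. -/
structure IsStarHom {B : Type w} [NonUnitalCStarAlgebra B] (j : Alg G.n →ₗ[ℂ] B) : Prop where
  map_conv : ∀ a b, j (G.conv φ a b) = j a * j b
  map_sharp : ∀ a, j (G.sharp φ a) = star (j a)

/-- `B` is a C*-algebra containing `Â₀` (through `j`) as a dense star-subalgebra. -/
structure IsCStarCompletion {B : Type w} [NonUnitalCStarAlgebra B]
    (j : Alg G.n →ₗ[ℂ] B) : Prop extends G.IsStarHom φ j where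
  injective : Function.Injective j
  dense : DenseRange j

/-- `B` is the full C*-algebra `Â`: the completion of `Â₀` in the largest C*-seminorm. -/
structure IsFull {B : Type w} [NonUnitalCStarAlgebra B]
    (j : Alg G.n →ₗ[ℂ] B) : Prop extends G.IsCStarCompletion φ j where
  universal : ∀ (D : Type u) [NonUnitalCStarAlgebra D] (f : Alg G.n →ₗ[ℂ] D),
    G.IsStarHom φ f → ∀ a, ‖f a‖ ≤ ‖j a‖

/-- `B` is the reduced C*-algebra `Â_r`: the completion of `Â₀` in the operator norm of the regular
representation on the GNS space `L²(φ)`, in which `a` acts by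
`b ↦ (ψ_a ∘ S⁻¹ ⊗ id)(Δ(b))` for `b ∈ A₀`, where `ψ_a(y) = ψ(ay)`. -/
structure IsReduced {B : Type w} [NonUnitalCStarAlgebra B]
    (j : Alg G.n →ₗ[ℂ] B) : Prop extends G.IsCStarCompletion φ j where
  norm_eq : ∀ a, IsLUB
    {r : ℝ | ∃ b y : Alg G.n,
      (y : Mult G.n) = sliceLeft (fun z => G.psi φ (a * G.S.symm z)) (G.Δ b) ∧
      (φ (star b * b)).re ≤ 1 ∧ r = √(φ (star y * y)).re} ‖j a‖

/-- A coassociative star-homomorphism `Δ_C` from `C` to the multipliers of `C ⊗ A`, recorded through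
its components in `M_{n α}(C)`. -/
def IsAction {C : Type w} [NonUnitalCStarAlgebra C] (ΔC : C →⋆ₙₐ[ℂ] MultV G.n C) : Prop :=
  ∀ (c : C) (α β : I) (i j : Fin (G.n α)) (k l : Fin (G.n β)),
    ΔC (ΔC c β k l) α i j = slice (fun a => G.Δ a α β (i, k) (j, l)) (ΔC c)

/-- `X` lies in `C₀ ⊗_alg A₀`. -/
def InAlgTensor {n : I → ℕ} {C : Type w} [NonUnitalCStarAlgebra C]
    (C₀ : NonUnitalStarSubalgebra ℂ C) (X : MultV n C) : Prop :=
  {α | X α ≠ 0}.Finite ∧ ∀ α i j, X α i j ∈ C₀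

/-- The regularity assumptions on an action with respect to a dense star-subalgebra `C₀` and an
element `h`. Note that by `A2` (with `a` the unit of `M_{n α}`) and density of `C₀`, the blocks of
`Δ_C(c)`, which a priori lie in `M_{n α}` over the multiplier algebra of `C`, have entries in `C`,
which is why `Δ_C` is recorded with values in families of matrices over `C`. -/
structure IsProper {C : Type w} [NonUnitalCStarAlgebra C] [PartialOrder C]
    (ΔC : C →⋆ₙₐ[ℂ] MultV G.n C) (C₀ : NonUnitalStarSubalgebra ℂ C) (h : C) : Prop where
  dense : Dense (C₀ : Set C)
  /-- `Δ_C(c)(c' ⊗ 1) ∈ C₀ ⊗_alg A₀`. -/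
  A1 : ∀ c ∈ C₀, ∀ c' ∈ C₀, InAlgTensor C₀
    (fun α => Matrix.of fun i j => ΔC c α i j * c' : MultV G.n C)
  /-- `Δ_C(c)(1 ⊗ a) ∈ C₀ ⊗_alg A₀`. -/
  A2 : ∀ c ∈ C₀, ∀ a : Alg G.n, InAlgTensor C₀
    (fun α => Matrix.of fun i j => ∑ k, (a : Mult G.n) α k j • ΔC c α i k : MultV G.n C)
  h_mem : h ∈ C₀
  h_nonneg : 0 ≤ h
  /-- `(id ⊗ φ)(Δ_C(h²)(c ⊗ 1)) = c`. -/
  A3 : ∀ c ∈ C₀,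
    slice φ (fun α => Matrix.of fun i j => ΔC (h * h) α i j * c : MultV G.n C) = c

variable {H : Type v} [NormedAddCommGroup H] [InnerProductSpace ℂ H] [CompleteSpace H]

/-- A unitary representation of the quantum group on `H`. The multiplier algebra of `B₀(H) ⊗ A` is
the algebra of bounded families of elements of `B(H) ⊗ M_{n α}`, and unitarity is blockwise.
The other conditions are `(id ⊗ Δ)(U) = U₁₂U₁₃` and `(id ⊗ S)(U) = U^*`, in components. -/
structure IsUnitaryRep (U : MultV G.n (H →L[ℂ] H)) : Prop where
  unitary : ∀ α, star (U α) * U α = 1 ∧ U α * star (U α) = 1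
  comult : ∀ (α β : I) (i j : Fin (G.n α)) (k l : Fin (G.n β)),
    slice (fun a => G.Δ a α β (i, k) (j, l)) U = U α i j * U β k l
  antipode : ∀ (α : I) (i j : Fin (G.n α)),
    slice (fun a => (G.S a : Mult G.n) α i j) U = star (U α) i j

/-- A nondegenerate representation `π` of `C` on `H` with `(π ⊗ id)(Δ_C(c)) = U(π(c) ⊗ 1)U^*`. -/
structure IsCovariant {C : Type w} [NonUnitalCStarAlgebra C] (ΔC : C →⋆ₙₐ[ℂ] MultV G.n C)
    (U : MultV G.n (H →L[ℂ] H)) (π : C →⋆ₙₐ[ℂ] (H →L[ℂ] H)) : Prop where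
  nondegenerate : Dense (Submodule.span ℂ {y : H | ∃ (c : C) (η : H), y = π c η} : Set H)
  covariant : ∀ (c : C) (α : I),
    (ΔC c α).map π = U α * Matrix.diagonal (fun _ => π c) * star (U α)

/-- `T_{ξη}(U)`, where `T_{ξη}(A ⊗ B) = ⟨ξ, Aη⟩ B`. -/
def coeff (U : MultV G.n (H →L[ℂ] H)) (ξ η : H) : Mult G.n :=
  fun α => Matrix.of fun i j => inner ℂ ξ (U α i j η)

/-- `ξ.a = (id ⊗ ψ_{θ⁻¹S(a)θ⁻²})(U) ξ`. -/
def actVec (U : MultV G.n (H →L[ℂ] H)) (ξ : H) (a : Alg G.n) : H :=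
  slice (fun y => G.psi φ
    (lmul (G.thetaInv φ) (rmul (G.thetaInv φ * G.thetaInv φ) (G.S a)) * y)) U ξ

/-- `((T ⊗ θ⁻¹)U)ξ`, as a family of matrices with entries in `H`. -/
def sigmaVec (U : MultV G.n (H →L[ℂ] H)) (T : H →L[ℂ] H) (ξ : H) : MultV G.n H :=
  fun α => Matrix.of fun i j => ∑ k, G.thetaInv φ α i k • T (U α k j ξ)

/-- The right action `(ξ ⊗ a)b = ξ ⊗ (a ∗ b)` on the free module `H ⊗_alg Â₀`. -/
def freeAct (y : H ⊗[ℂ] Alg G.n) (b : Alg G.n) : H ⊗[ℂ] Alg G.n :=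
  ((G.conv φ).flip b).lTensor H y

/-- The inner product `⟨ξ ⊗ a, η ⊗ b⟩ = ⟨ξ, η⟩ a^♯ ∗ b` on the free module `H ⊗_alg Â₀`. -/
def freeInner : (H ⊗[ℂ] Alg G.n) →ₗ⋆[ℂ] (H ⊗[ℂ] Alg G.n) →ₗ[ℂ] Alg G.n :=
  TensorProduct.lift (LinearMap.mk₂'ₛₗ (starRingEnd ℂ) (starRingEnd ℂ)
    (fun (ξ : H) (a : Alg G.n) => (TensorProduct.lid ℂ (Alg G.n)).toLinearMap ∘ₗ
      TensorProduct.map (innerₛₗ ℂ ξ) (G.conv φ (G.sharp φ a)))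
    (fun ξ ξ' a => by ext; simp [add_smul])
    (fun c ξ a => by ext; simp [mul_smul])
    (fun ξ a a' => by ext; simp [smul_add])
    (fun c ξ a => by ext; simp [smul_smul, mul_comm]))

end DiscreteQuantumGroup

/-- The subspace `π(C₀)H` (linear span). -/
def H₀ {C : Type w} [NonUnitalCStarAlgebra C] {H : Type v} [NormedAddCommGroup H]
    [InnerProductSpace ℂ H] [CompleteSpace H] (C₀ : NonUnitalStarSubalgebra ℂ C)
    (π : C →⋆ₙₐ[ℂ] (H →L[ℂ] H)) : Submodule ℂ H :=
  Submodule.span ℂ {y : H | ∃ c ∈ C₀, ∃ η : H, y = π c η}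

/-- A (right) Hilbert C*-module structure over `B` on the Banach space `E`. -/
structure HilbertModule (B : Type w) [NonUnitalCStarAlgebra B] (E : Type v)
    [NormedAddCommGroup E] [NormedSpace ℂ E] [CompleteSpace E] where
  act : E →ₗ[ℂ] B →ₗ[ℂ] E
  act_mul : ∀ y b c, act y (b * c) = act (act y b) c
  inner : E →ₗ⋆[ℂ] E →ₗ[ℂ] B
  inner_act : ∀ y z b, inner y (act z b) = inner y z * b
  star_inner : ∀ y z, star (inner y z) = inner z y
  inner_self_nonneg : ∀ y, ∃ b, inner y y = star b * b
  norm_sq : ∀ y, ‖y‖ ^ 2 = ‖inner y y‖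

/-- The Hilbert `B`-module `E` is, through `ι`, the completion of `M₀` with its right action `act` by
`A` and its `A`-valued inner product `ip`, the algebra `A` being mapped to `B` by `j`. -/
structure IsHilbertCompletion {A : Type u} {B : Type w} [NonUnitalCStarAlgebra B] (j : A → B)
    {M₀ : Type x} [AddCommGroup M₀] [Module ℂ M₀] (act : M₀ → A → M₀) (ip : M₀ → M₀ → A)
    {E : Type v} [NormedAddCommGroup E] [NormedSpace ℂ E] [CompleteSpace E]
    (𝓔 : HilbertModule B E) (ι : M₀ →ₗ[ℂ] E) : Prop where
  dense : DenseRange ι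
  map_act : ∀ y a, ι (act y a) = 𝓔.act (ι y) (j a)
  map_inner : ∀ y z, 𝓔.inner (ι y) (ι z) = j (ip y z)

/-- With `Â₀` mapped to the C*-algebra `B` by `j`, the modules `M₀` and `H ⊗_alg Â₀` complete to
Hilbert `B`-modules `E` and `F`, and `Σ : M₀ → H ⊗_alg Â₀` extends to an inner product preserving
`B`-module map that identifies `E` with a closed submodule of `F`. -/
def HasCompletions {I : Type u} (G : DiscreteQuantumGroup I) (φ : Alg G.n →ₗ[ℂ] ℂ)
    {H : Type v} [NormedAddCommGroup H] [InnerProductSpace ℂ H] [CompleteSpace H]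
    {B : Type w} [NonUnitalCStarAlgebra B] (j : Alg G.n →ₗ[ℂ] B)
    {M₀ : Type v} [AddCommGroup M₀] [Module ℂ M₀] (act : M₀ → Alg G.n → M₀)
    (ip : M₀ → M₀ → Alg G.n) (Sg : M₀ → H ⊗[ℂ] Alg G.n) : Prop :=
  ∃ (E F : Type (max u v))
    (_ : NormedAddCommGroup E) (_ : NormedSpace ℂ E) (_ : CompleteSpace E)
    (_ : NormedAddCommGroup F) (_ : NormedSpace ℂ F) (_ : CompleteSpace F)
    (𝓔 : HilbertModule B E) (𝓕 : HilbertModule B F)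
    (ιE : M₀ →ₗ[ℂ] E) (ιF : H ⊗[ℂ] Alg G.n →ₗ[ℂ] F) (SgHat : E →ₗ[ℂ] F),
    IsHilbertCompletion j act ip 𝓔 ιE ∧
    IsHilbertCompletion j (G.freeAct φ) (fun y z => G.freeInner φ y z) 𝓕 ιF ∧
    (∀ ξ, SgHat (ιE ξ) = ιF (Sg ξ)) ∧
    (∀ y b, SgHat (𝓔.act y b) = 𝓕.act (SgHat y) b) ∧
    (∀ y z, 𝓕.inner (SgHat y) (SgHat z) = 𝓔.inner y z) ∧
    Topology.IsClosedEmbedding SgHat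

end QGrp

end

/-!
Write `R` for the space of functionals on `A₀` of finite support, spanned by the matrix coefficients
`x ↦ x^α_{ij}`. Dualizing `Δ` makes `R` an algebra (`cmul`), over which `A₀` is a bimodule (`ract`,
`lact`), and most computations take place in `R`, where elements of `A₀` are tested.

*The quantum group.* Bijectivity of `T₁` and `T₂` with coassociativity gives the counit
(`exists_isCounit`). It is a character, so it lives on a block of size one, whose unit is the
cointegral `e`. The identity `Δ(e)(a ⊗ 1) = Δ(e)(1 ⊗ S(a))` defines a map `S`, and comparing it with
its counterpart on the other side, as left and right inverses of matrices over `R`, shows that it is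
the antipode (`S_spec`). The elements `(f ⊗ id)(Δ(e))` exhaust `A₀`, whence a left invariant
functional is faithful, unique up to a scalar, and satisfies `φ(ax) = φ(x S²(a))`. The functional
`χ(f) φ(x) = φ((id ⊗ f)(Δ(x)))` is a character of `R`; it is the modular element `δ`. On each block
`δ` is a positive multiple of `ρ⁻²`, where `φ = Tr(· ρ)`, so `θ = δ^{1/2}` exists and
`S²(a) = θ⁻¹aθ` (`exists_isModularRoot`). Since `Δ(θ)` and `θ ⊗ θ` are positive with equal squares,
`θ` is group-like (`Δext_theta`).

*The dual algebra.* The Fourier transform `F(a) = φ(· S(a))` is a bijection onto `R` that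
reverses products and carries `♯` to `f ↦ (f ∘ S)^*` (`four_conv`, `four_sharp`). All properties of
`Â₀` follow from those of `R`. The preimages of the matrix coefficients satisfy unitarity relations,
so star-homomorphisms of `Â₀` into C*-algebras are uniformly bounded on each element
(`exists_norm_le`). The same relations make the regular representation on `L²(φ)` bounded, and
it is faithful. This gives the full and the reduced C*-algebra.

*The module.* A unitary representation `U` is a unital representation of `R` (`ev_cmul`), and
`ξ.a = U(F(a) ∘ θ⁻¹)ξ`, where `f ∘ θ⁻¹` is `x ↦ f(θ⁻¹x)`, so that `ξ.(a ∗ b) = (ξ.a).b`.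
For `Λ(w ⊗ b) = U(F(b) ∘ θ⁻¹)π(h)w` one computes
`g(⟨Σ(ξ), y⟩) = ⟨ξ, U(g ∘ θ⁻¹)Λ(y)⟩` for `g ∈ R` (`apply_freeInner_modSigma`), and the
normalization of `h` says that `Λ` is a left inverse of `Σ` (`synth_modSigma`). Hence `Σ` preserves
inner products, and the positivity on `H₀` is inherited from the free module, where it follows by
orthonormalizing the legs in `H`. A right module over a dense subspace of a C*-algebra `B` with a
positive `B`-valued inner product satisfies the Cauchy–Schwarz inequality, so it
completes to a Hilbert `B`-module (`exists_hilbertModule_completion`), and `Σ` extends to an isometry.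
-/

noncomputable section

/-! ### Multipliers, slices and functionals of finite support -/

namespace QGrp

section units

variable {I : Type u} {n : I → ℕ} {V : Type v} [AddCommGroup V] [Module ℂ V]

@[simp] lemma unit_same (α : I) (i j : Fin (n α)) :
    (unit n α i j : Mult n) α = Matrix.single i j 1 := by
  simp [unit]

lemma unit_of_ne {α β : I} (h : β ≠ α) (i j : Fin (n α)) : (unit n α i j : Mult n) β = 0 := by
  simp [unit, h]

lemma sum_smul_unit_apply [DecidableEq I] (γ β : I) (M : Matrix (Fin (n γ)) (Fin (n γ)) ℂ) :
    ((∑ p, ∑ q, M p q • unit n γ p q : Alg n) : Mult n) β =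
      (Pi.single γ M : Mult n) β := by
  rcases eq_or_ne β γ with rfl | h
  · have : ((∑ p, ∑ q, M p q • unit n β p q : Alg n) : Mult n) β =
        ∑ p, ∑ q, M p q • Matrix.single p q (1 : ℂ) := by
      simp
    rw [this, Pi.single_eq_same]
    conv_rhs => rw [Matrix.matrix_eq_sum_single M]
    simp [Matrix.smul_single]
  · have : ((∑ p, ∑ q, M p q • unit n γ p q : Alg n) : Mult n) β =
        ∑ p, ∑ q, M p q • (unit n γ p q : Mult n) β := by
      simp
    rw [this, Pi.single_eq_of_ne h]
    simp [unit_of_ne h]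

lemma eq_sum_unit (a : Alg n) {F : Finset I} (hF : ∀ γ ∉ F, (a : Mult n) γ = 0) :
    a = ∑ γ ∈ F, ∑ p, ∑ q, (a : Mult n) γ p q • unit n γ p q := by
  classical
  ext1
  funext β
  have : ((∑ γ ∈ F, ∑ p, ∑ q, (a : Mult n) γ p q • unit n γ p q : Alg n) : Mult n) β =
      ∑ γ ∈ F, ((∑ p, ∑ q, (a : Mult n) γ p q • unit n γ p q : Alg n) : Mult n) β := by
    simp
  rw [this]
  simp_rw [sum_smul_unit_apply]
  by_cases hβ : β ∈ F
  · rw [Finset.sum_eq_single_of_mem β hβ]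
    · simp
    · intro γ _ h
      exact Pi.single_eq_of_ne h.symm _
  · rw [hF β hβ]
    refine (Finset.sum_eq_zero fun γ hγ => ?_).symm
    exact Pi.single_eq_of_ne (by rintro rfl; exact hβ hγ) _

lemma exists_supp (a : Alg n) : ∃ F : Finset I, ∀ γ ∉ F, (a : Mult n) γ = 0 :=
  ⟨a.2.toFinset, fun _ hγ => not_not.mp fun hc => hγ (a.2.mem_toFinset.mpr hc)⟩

/-- Two linear maps on `A₀` that agree on the matrix units are equal. -/
lemma alg_hom_ext {f g : Alg n →ₗ[ℂ] V} (h : ∀ γ p q, f (unit n γ p q) = g (unit n γ p q)) :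
    f = g := by
  ext a
  obtain ⟨F, hF⟩ := exists_supp a
  rw [eq_sum_unit a hF]
  simp [h]

open Classical in
/-- The unit of `⨁ γ ∈ F, M_{n γ}(ℂ)`. -/
def proj (n : I → ℕ) (F : Finset I) : Alg n :=
  ⟨fun γ => if γ ∈ F then 1 else 0, (F.finite_toSet).subset fun γ h => by
    by_contra hc
    exact h (if_neg hc)⟩

lemma proj_of_mem {F : Finset I} {γ : I} (h : γ ∈ F) : (proj n F : Mult n) γ = 1 := if_pos h

lemma proj_of_notMem {F : Finset I} {γ : I} (h : γ ∉ F) : (proj n F : Mult n) γ = 0 := if_neg h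

lemma proj_mul {F : Finset I} {a : Alg n} (hF : ∀ γ ∉ F, (a : Mult n) γ = 0) :
    proj n F * a = a := by
  ext1
  funext γ
  by_cases h : γ ∈ F
  · simp [proj_of_mem h]
  · simp [hF γ h]

lemma mul_proj {F : Finset I} {a : Alg n} (hF : ∀ γ ∉ F, (a : Mult n) γ = 0) :
    a * proj n F = a := by
  ext1
  funext γ
  by_cases h : γ ∈ F
  · simp [proj_of_mem h]
  · simp [hF γ h]

@[simp] lemma star_proj (F : Finset I) : star (proj n F) = proj n F := by
  ext1
  funext γ
  by_cases h : γ ∈ F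
  · simp [proj_of_mem h]
  · simp [proj_of_notMem h]

@[simp] lemma lmul_coe (m : Mult n) (a : Alg n) : (lmul m a : Mult n) = m * a := rfl

@[simp] lemma rmul_coe (m : Mult n) (a : Alg n) : (rmul m a : Mult n) = a * m := rfl

lemma lmul_alg (a b : Alg n) : lmul (a : Mult n) b = a * b := rfl

lemma rmul_alg (a b : Alg n) : rmul (a : Mult n) b = b * a := rfl

lemma lmul_lmul (m m' : Mult n) (a : Alg n) : lmul m (lmul m' a) = lmul (m * m') a := by
  ext1; simp [mul_assoc]

lemma rmul_rmul (m m' : Mult n) (a : Alg n) : rmul m (rmul m' a) = rmul (m' * m) a := by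
  ext1; simp [mul_assoc]

lemma lmul_rmul (m m' : Mult n) (a : Alg n) : lmul m (rmul m' a) = rmul m' (lmul m a) := by
  ext1; simp [mul_assoc]

@[simp] lemma lmul_one (a : Alg n) : lmul 1 a = a := by ext1; simp

@[simp] lemma rmul_one (a : Alg n) : rmul 1 a = a := by ext1; simp

lemma mul_lmul (m : Mult n) (a b : Alg n) : a * lmul m b = rmul m a * b := by
  ext1; simp [mul_assoc]

lemma lmul_mul (m : Mult n) (a b : Alg n) : lmul m a * b = lmul m (a * b) := by
  ext1; simp [mul_assoc]

lemma mul_rmul (m : Mult n) (a b : Alg n) : a * rmul m b = rmul m (a * b) := by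
  ext1; simp [mul_assoc]

lemma star_lmul (m : Mult n) (a : Alg n) : star (lmul m a) = rmul (star m) (star a) := by
  ext1; simp

lemma star_rmul (m : Mult n) (a : Alg n) : star (rmul m a) = lmul (star m) (star a) := by
  ext1; simp

end units

section tensors

variable {I : Type u} {n : I → ℕ} {V : Type v} [AddCommGroup V] [Module ℂ V]

@[simp] lemma toMultV_tmul (x : V) (a : Alg n) (γ : I) (p q : Fin (n γ)) :
    toMultV (x ⊗ₜ[ℂ] a) γ p q = (a : Mult n) γ p q • x := rfl

@[simp] lemma toMult2_tmul (a b : Alg n) (α β : I) :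
    toMult2 (a ⊗ₜ[ℂ] b) α β = (a : Mult n) α ⊗ₖ (b : Mult n) β := rfl

lemma exists_eq_sum_tmul (y : V ⊗[ℂ] Alg n) : ∃ F : Finset I, ∀ F', F ⊆ F' →
    y = ∑ γ ∈ F', ∑ p, ∑ q, toMultV y γ p q ⊗ₜ[ℂ] unit n γ p q := by
  induction y with
  | zero => exact ⟨∅, fun F' _ => by simp⟩
  | tmul x a =>
    obtain ⟨F, hF⟩ := exists_supp a
    refine ⟨F, fun F' h => ?_⟩
    conv_lhs => rw [eq_sum_unit a (F := F') fun γ hγ => hF γ fun hc => hγ (h hc)]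
    simp [TensorProduct.tmul_sum, TensorProduct.smul_tmul']
  | add y z hy hz =>
    classical
    obtain ⟨F, hF⟩ := hy
    obtain ⟨F', hF'⟩ := hz
    refine ⟨F ∪ F', fun F'' h => ?_⟩
    conv_lhs => rw [hF F'' (Finset.union_subset_left h), hF' F'' (Finset.union_subset_right h)]
    simp [TensorProduct.add_tmul, Finset.sum_add_distrib]

lemma eq_sum_tmul (y : V ⊗[ℂ] Alg n) {F : Finset I} (hF : ∀ γ ∉ F, toMultV y γ = 0) :
    y = ∑ γ ∈ F, ∑ p, ∑ q, toMultV y γ p q ⊗ₜ[ℂ] unit n γ p q := by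
  classical
  obtain ⟨F', h⟩ := exists_eq_sum_tmul y
  refine (h (F ∪ F') Finset.subset_union_right).trans
    (Finset.sum_subset Finset.subset_union_left fun γ _ hγ => ?_).symm
  simp [hF γ hγ]

lemma toMultV_injective : Function.Injective (toMultV : V ⊗[ℂ] Alg n →ₗ[ℂ] MultV n V) := by
  rw [injective_iff_map_eq_zero]
  intro y hy
  have := eq_sum_tmul y (F := ∅) (fun γ _ => by rw [hy]; rfl)
  simpa using this

/-- A family of matrices over `V` with finite support comes from `V ⊗ A₀`. -/
lemma exists_toMultV_eq {X : MultV n V} (hX : {γ | X γ ≠ 0}.Finite) :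
    ∃ y : V ⊗[ℂ] Alg n, toMultV y = X := by
  classical
  refine ⟨∑ γ ∈ hX.toFinset, ∑ p, ∑ q, X γ p q ⊗ₜ[ℂ] unit n γ p q, ?_⟩
  funext β
  ext i j
  have h1 : ∀ γ, (∑ p, ∑ q, toMultV (X γ p q ⊗ₜ[ℂ] unit n γ p q)) β i j =
      if h : γ = β then X β i j else 0 := by
    intro γ
    split_ifs with h
    · subst h
      simp only [Finset.sum_apply, Matrix.sum_apply, toMultV_tmul, unit_same, Matrix.single_apply]
      rw [Finset.sum_eq_single i, Finset.sum_eq_single j]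
      · simp
      · intro b _ hb; simp [hb]
      · simp
      · intro b _ hb; simp [hb]
      · simp
    · simp only [Finset.sum_apply, Matrix.sum_apply, toMultV_tmul, unit_of_ne (Ne.symm h)]
      simp
  have h2 : toMultV (∑ γ ∈ hX.toFinset, ∑ p, ∑ q, X γ p q ⊗ₜ[ℂ] unit n γ p q) β i j =
      ∑ γ ∈ hX.toFinset, (∑ p, ∑ q, toMultV (X γ p q ⊗ₜ[ℂ] unit n γ p q)) β i j := by
    simp only [map_sum, Finset.sum_apply, Matrix.sum_apply]
  rw [h2]
  simp_rw [h1]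
  by_cases hβ : X β = 0
  · simp [hβ]
  · rw [Finset.sum_eq_single β]
    · simp
    · intro b _ hb; simp [hb]
    · simp [hβ]

lemma toMultV_alg_apply (t : Alg n ⊗[ℂ] Alg n) (α β : I) (i j : Fin (n α)) (k l : Fin (n β)) :
    (toMultV t β k l : Mult n) α i j = toMult2 t α β (i, k) (j, l) := by
  induction t with
  | zero => simp
  | tmul a b => simp [mul_comm]
  | add y z hy hz => simp [hy, hz]

lemma toMult2_injective : Function.Injective (toMult2 : Alg n ⊗[ℂ] Alg n →ₗ[ℂ] Mult2 n) := by
  rw [injective_iff_map_eq_zero]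
  intro t ht
  apply toMultV_injective
  refine funext fun β => Matrix.ext fun k l => Subtype.ext (funext fun α => Matrix.ext fun i j => ?_)
  rw [toMultV_alg_apply, ht]
  simp

@[simp] lemma leg1_apply (a : Alg n) (α β : I) : leg1 a α β = (a : Mult n) α ⊗ₖ 1 := rfl

@[simp] lemma leg2_apply (a : Alg n) (α β : I) : leg2 a α β = 1 ⊗ₖ (a : Mult n) β := rfl

lemma leg1_mul_leg2 (a b : Alg n) : leg1 a * leg2 b = toMult2 (a ⊗ₜ b) := by
  funext α β
  simp [← Matrix.mul_kronecker_mul]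

lemma leg2_mul_leg1 (a b : Alg n) : leg2 b * leg1 a = toMult2 (a ⊗ₜ b) := by
  funext α β
  simp [← Matrix.mul_kronecker_mul]

lemma leg1_mul (a b : Alg n) : leg1 (a * b) = leg1 a * leg1 b := by
  funext α β
  simp [← Matrix.mul_kronecker_mul]

lemma leg2_mul (a b : Alg n) : leg2 (a * b) = leg2 a * leg2 b := by
  funext α β
  simp [← Matrix.mul_kronecker_mul]

lemma star_leg1 (a : Alg n) : star (leg1 a) = leg1 (star a) := by
  funext α β
  simp [Matrix.star_eq_conjTranspose, Matrix.conjTranspose_kronecker]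

lemma star_leg2 (a : Alg n) : star (leg2 a) = leg2 (star a) := by
  funext α β
  simp [Matrix.star_eq_conjTranspose, Matrix.conjTranspose_kronecker]

lemma exists_star_toMult2 (t : Alg n ⊗[ℂ] Alg n) : ∃ s, toMult2 s = star (toMult2 t) := by
  induction t with
  | zero => exact ⟨0, by simp⟩
  | add t t' ht ht' =>
    obtain ⟨s, hs⟩ := ht
    obtain ⟨s', hs'⟩ := ht'
    exact ⟨s + s', by simp [hs, hs']⟩
  | tmul a b =>
    refine ⟨star a ⊗ₜ star b, ?_⟩
    funext α β
    simp [Matrix.star_eq_conjTranspose, Matrix.conjTranspose_kronecker]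

end tensors

/-- The space `R` of functionals on `A₀` that vanish on all but finitely many blocks. -/
def coefSub {I : Type u} (n : I → ℕ) : Submodule ℂ (Alg n →ₗ[ℂ] ℂ) where
  carrier := {f | ∃ F : Finset I, ∀ γ ∉ F, ∀ p q, f (unit n γ p q) = 0}
  zero_mem' := ⟨∅, by simp⟩
  add_mem' := by
    classical
    rintro f g ⟨F, hF⟩ ⟨F', hF'⟩
    refine ⟨F ∪ F', fun γ hγ p q => ?_⟩
    simp only [Finset.mem_union, not_or] at hγ
    simp [hF γ hγ.1, hF' γ hγ.2]
  smul_mem' := by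
    rintro c f ⟨F, hF⟩
    exact ⟨F, fun γ hγ p q => by simp [hF γ hγ]⟩

section coef

variable {I : Type u} {n : I → ℕ} {V : Type v} [AddCommGroup V] [Module ℂ V]

lemma slice_eq_sum_of_support (f : Alg n → ℂ) (X : MultV n V) {F : Finset I}
    (hF : ∀ γ ∉ F, ∑ p, ∑ q, f (unit n γ p q) • X γ p q = 0) :
    slice f X = ∑ γ ∈ F, ∑ p, ∑ q, f (unit n γ p q) • X γ p q := by
  refine finsum_eq_sum_of_support_subset _ fun γ hγ => ?_
  by_contra hc
  exact hγ (hF γ hc)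

lemma slice_eq_sum {f : Alg n → ℂ} {F : Finset I} (hF : ∀ γ ∉ F, ∀ p q, f (unit n γ p q) = 0)
    (X : MultV n V) : slice f X = ∑ γ ∈ F, ∑ p, ∑ q, f (unit n γ p q) • X γ p q :=
  slice_eq_sum_of_support f X fun γ hγ => by simp [hF γ hγ]

lemma slice_eq_sum' (f : Alg n → ℂ) {X : MultV n V} {F : Finset I} (hF : ∀ γ ∉ F, X γ = 0) :
    slice f X = ∑ γ ∈ F, ∑ p, ∑ q, f (unit n γ p q) • X γ p q :=
  slice_eq_sum_of_support f X fun γ hγ => by simp [hF γ hγ]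

/-- `(id ⊗ f)(X)` as a bilinear map in `X` and in the functional `f` of finite support. -/
def ev : MultV n V →ₗ[ℂ] coefSub n →ₗ[ℂ] V :=
  LinearMap.mk₂ ℂ (fun X f => slice (f : Alg n →ₗ[ℂ] ℂ) X)
    (fun X Y f => by
      obtain ⟨F, hF⟩ := f.2
      simp [slice_eq_sum hF, Finset.sum_add_distrib])
    (fun c X f => by
      obtain ⟨F, hF⟩ := f.2
      simp [slice_eq_sum hF, Finset.smul_sum, smul_comm c])
    (fun X f g => by
      classical
      obtain ⟨F, hF⟩ := f.2
      obtain ⟨F', hF'⟩ := g.2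
      have h1 : ∀ γ ∉ F ∪ F', ∀ p q, (f : Alg n →ₗ[ℂ] ℂ) (unit n γ p q) = 0 :=
        fun γ hγ => hF γ fun hc => hγ (Finset.mem_union_left _ hc)
      have h2 : ∀ γ ∉ F ∪ F', ∀ p q, (g : Alg n →ₗ[ℂ] ℂ) (unit n γ p q) = 0 :=
        fun γ hγ => hF' γ fun hc => hγ (Finset.mem_union_right _ hc)
      have h3 : ∀ γ ∉ F ∪ F', ∀ p q, ((f + g : coefSub n) : Alg n →ₗ[ℂ] ℂ) (unit n γ p q) = 0 :=
        fun γ hγ p q => by simp [h1 γ hγ, h2 γ hγ]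
      rw [slice_eq_sum h1, slice_eq_sum h2, slice_eq_sum h3]
      simp [add_smul, Finset.sum_add_distrib])
    (fun c X f => by
      obtain ⟨F, hF⟩ := f.2
      have h3 : ∀ γ ∉ F, ∀ p q, ((c • f : coefSub n) : Alg n →ₗ[ℂ] ℂ) (unit n γ p q) = 0 :=
        fun γ hγ p q => by simp [hF γ hγ]
      rw [slice_eq_sum hF, slice_eq_sum h3]
      simp [Finset.smul_sum, mul_smul])

lemma ev_apply (X : MultV n V) (f : coefSub n) : ev X f = slice (f : Alg n →ₗ[ℂ] ℂ) X := rfl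

/-- The matrix coefficient `x ↦ x^α_{ij}`. -/
def mcoef (n : I → ℕ) (α : I) (i j : Fin (n α)) : coefSub n :=
  ⟨{ toFun := fun x => (x : Mult n) α i j
     map_add' := fun x y => by simp
     map_smul' := fun c x => by simp }, {α}, fun γ hγ p q => by
      have : α ≠ γ := by simpa [eq_comm] using hγ
      change (unit n γ p q : Mult n) α i j = 0
      simp [unit_of_ne this]⟩

@[simp] lemma mcoef_apply (α : I) (i j : Fin (n α)) (x : Alg n) :
    (mcoef n α i j : Alg n →ₗ[ℂ] ℂ) x = (x : Mult n) α i j := rfl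

lemma coef_ext {f g : coefSub n}
    (h : ∀ x, (f : Alg n →ₗ[ℂ] ℂ) x = (g : Alg n →ₗ[ℂ] ℂ) x) : f = g :=
  Subtype.ext (LinearMap.ext h)

lemma alg_ext {x y : Alg n} (h : ∀ f : coefSub n, (f : Alg n →ₗ[ℂ] ℂ) x = (f : Alg n →ₗ[ℂ] ℂ) y) :
    x = y := by
  apply Subtype.ext
  funext α
  ext i j
  exact h (mcoef n α i j)

lemma coef_eq_sum (f : coefSub n) {F : Finset I}
    (hF : ∀ γ ∉ F, ∀ p q, (f : Alg n →ₗ[ℂ] ℂ) (unit n γ p q) = 0) :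
    f = ∑ γ ∈ F, ∑ p, ∑ q, (f : Alg n →ₗ[ℂ] ℂ) (unit n γ p q) • mcoef n γ p q := by
  classical
  apply Subtype.ext
  apply alg_hom_ext
  intro β k l
  have : ((∑ γ ∈ F, ∑ p, ∑ q, (f : Alg n →ₗ[ℂ] ℂ) (unit n γ p q) • mcoef n γ p q : coefSub n) :
      Alg n →ₗ[ℂ] ℂ) (unit n β k l) =
      ∑ γ ∈ F, ∑ p, ∑ q, (f : Alg n →ₗ[ℂ] ℂ) (unit n γ p q) * (unit n β k l : Mult n) γ p q := by
    simp
  rw [this]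
  by_cases hβ : β ∈ F
  · rw [Finset.sum_eq_single_of_mem β hβ, Finset.sum_eq_single k, Finset.sum_eq_single l]
    · simp
    · intro b _ hb; simp [hb.symm]
    · simp
    · intro b _ hb; simp [hb.symm]
    · simp
    · intro b _ hb; simp [unit_of_ne hb]
  · rw [hF β hβ]
    refine (Finset.sum_eq_zero fun γ hγ => ?_).symm
    have : γ ≠ β := by rintro rfl; exact hβ hγ
    simp [unit_of_ne this]

/-- Two linear maps on `R` that agree on the matrix coefficients are equal. -/
lemma coef_hom_ext {S T : coefSub n →ₗ[ℂ] V} (h : ∀ α i j, S (mcoef n α i j) = T (mcoef n α i j)) :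
    S = T := by
  ext f
  obtain ⟨F, hF⟩ := f.2
  rw [coef_eq_sum f hF]
  simp [h]

@[simp] lemma ev_mcoef (X : MultV n V) (α : I) (i j : Fin (n α)) : ev X (mcoef n α i j) = X α i j := by
  rw [ev_apply, slice_eq_sum (F := {α})]
  · rw [Finset.sum_singleton, Finset.sum_eq_single i, Finset.sum_eq_single j]
    · simp
    · intro b _ hb; simp [hb]
    · simp
    · intro b _ hb; simp [hb]
    · simp
  · intro γ hγ p q
    have : α ≠ γ := by simpa [eq_comm] using hγ
    simp [unit_of_ne this]

/-- A functional applied to an element of `A₀` is the pairing with the corresponding multiplier. -/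
lemma ev_coe (x : Alg n) (f : coefSub n) :
    ev (V := ℂ) (x : Mult n) f = (f : Alg n →ₗ[ℂ] ℂ) x := by
  have : (ev (V := ℂ) (x : Mult n)) =
      (LinearMap.applyₗ x).comp (coefSub n).subtype := by
    apply coef_hom_ext
    intro α i j
    simp
  rw [this]
  rfl

/-- The functional `x ↦ f(m x)`. -/
def compL (m : Mult n) : coefSub n →ₗ[ℂ] coefSub n where
  toFun f := ⟨(f : Alg n →ₗ[ℂ] ℂ) ∘ₗ lmul m, by
    obtain ⟨F, hF⟩ := f.2
    refine ⟨F, fun γ hγ p q => ?_⟩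
    classical
    rw [LinearMap.comp_apply, eq_sum_unit (lmul m (unit n γ p q)) (F := {γ})]
    · simp [hF γ hγ]
    · intro β hβ
      have : β ≠ γ := by simpa using hβ
      simp [unit_of_ne this]⟩
  map_add' f g := by apply coef_ext; simp
  map_smul' c f := by apply coef_ext; simp

/-- The functional `x ↦ f(x m)`. -/
def compR (m : Mult n) : coefSub n →ₗ[ℂ] coefSub n where
  toFun f := ⟨(f : Alg n →ₗ[ℂ] ℂ) ∘ₗ rmul m, by
    obtain ⟨F, hF⟩ := f.2
    refine ⟨F, fun γ hγ p q => ?_⟩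
    classical
    rw [LinearMap.comp_apply, eq_sum_unit (rmul m (unit n γ p q)) (F := {γ})]
    · simp [hF γ hγ]
    · intro β hβ
      have : β ≠ γ := by simpa using hβ
      simp [unit_of_ne this]⟩
  map_add' f g := by apply coef_ext; simp
  map_smul' c f := by apply coef_ext; simp

@[simp] lemma compL_apply (m : Mult n) (f : coefSub n) (x : Alg n) :
    (compL m f : Alg n →ₗ[ℂ] ℂ) x = (f : Alg n →ₗ[ℂ] ℂ) (lmul m x) := rfl

@[simp] lemma compR_apply (m : Mult n) (f : coefSub n) (x : Alg n) :
    (compR m f : Alg n →ₗ[ℂ] ℂ) x = (f : Alg n →ₗ[ℂ] ℂ) (rmul m x) := rfl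

lemma compL_mcoef (m : Mult n) (α : I) (i j : Fin (n α)) :
    compL m (mcoef n α i j) = ∑ k, m α i k • mcoef n α k j := by
  apply coef_ext
  intro x
  simp [Matrix.mul_apply]

lemma compR_mcoef (m : Mult n) (α : I) (i j : Fin (n α)) :
    compR m (mcoef n α i j) = ∑ k, m α k j • mcoef n α i k := by
  apply coef_ext
  intro x
  simp [Matrix.mul_apply, mul_comm]

/-- Functionals of finite support have a local unit on either side. -/
lemma exists_local_unit (f : coefSub n) : ∃ F : Finset I, ∀ F', F ⊆ F' →
    compL (proj n F' : Mult n) f = f ∧ compR (proj n F' : Mult n) f = f := by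
  obtain ⟨F, hF⟩ := f.2
  refine ⟨F, fun F' h => ⟨?_, ?_⟩⟩ <;>
  · apply Subtype.ext
    apply alg_hom_ext
    intro γ p q
    by_cases hγ : γ ∈ F'
    · have h0 : ∀ β ∉ F', (unit n γ p q : Mult n) β = 0 := fun β hβ =>
        unit_of_ne (by rintro rfl; exact hβ hγ) _ _
      first
      | rw [compL_apply, lmul_alg, proj_mul h0]
      | rw [compR_apply, rmul_alg, mul_proj h0]
    · have h1 : lmul (proj n F' : Mult n) (unit n γ p q) = 0 := by
        apply Subtype.ext
        funext β
        by_cases hβ : β = γ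
        · subst hβ; simp [proj_of_notMem hγ]
        · simp [unit_of_ne hβ]
      have h2 : rmul (proj n F' : Mult n) (unit n γ p q) = 0 := by
        apply Subtype.ext
        funext β
        by_cases hβ : β = γ
        · subst hβ; simp [proj_of_notMem hγ]
        · simp [unit_of_ne hβ]
      first
      | rw [compL_apply, h1, map_zero, hF γ fun hc => hγ (h hc)]
      | rw [compR_apply, h2, map_zero, hF γ fun hc => hγ (h hc)]

/-- The pairing `(f ⊗ g)(X)` of `R ⊗ R` with the multipliers of the tensor square. -/
def pair2 (X : Mult2 n) : coefSub n →ₗ[ℂ] coefSub n →ₗ[ℂ] ℂ :=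
  ev (V := coefSub n →ₗ[ℂ] ℂ) fun α => Matrix.of fun i j =>
    ev (V := ℂ) fun β => Matrix.of fun k l => X α β (i, k) (j, l)

@[simp] lemma pair2_mcoef (X : Mult2 n) (α β : I) (i j : Fin (n α)) (k l : Fin (n β)) :
    pair2 X (mcoef n α i j) (mcoef n β k l) = X α β (i, k) (j, l) := by
  simp [pair2]

lemma coef_hom_ext₂ {S T : coefSub n →ₗ[ℂ] coefSub n →ₗ[ℂ] V}
    (h : ∀ α i j β k l, S (mcoef n α i j) (mcoef n β k l) = T (mcoef n α i j) (mcoef n β k l)) :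
    S = T :=
  coef_hom_ext fun α i j => coef_hom_ext fun β k l => h α i j β k l

lemma pair2_add (X Y : Mult2 n) : pair2 (X + Y) = pair2 X + pair2 Y :=
  coef_hom_ext₂ fun α i j β k l => by simp

lemma pair2_zero : pair2 (0 : Mult2 n) = 0 :=
  coef_hom_ext₂ fun α i j β k l => by simp

lemma pair2_smul (c : ℂ) (X : Mult2 n) : pair2 (c • X) = c • pair2 X :=
  coef_hom_ext₂ fun α i j β k l => by simp

lemma pair2_ext {X Y : Mult2 n} (h : ∀ f g, pair2 X f g = pair2 Y f g) : X = Y := by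
  funext α β
  ext ⟨i, k⟩ ⟨j, l⟩
  simpa using h (mcoef n α i j) (mcoef n β k l)

lemma pair2_leg1_mul (a : Alg n) (X : Mult2 n) (f g : coefSub n) :
    pair2 (leg1 a * X) f g = pair2 X (compL a f) g := by
  have : pair2 (leg1 a * X) = (pair2 X).comp (compL (a : Mult n)) := by
    apply coef_hom_ext₂
    intro α i j β k l
    simp [compL_mcoef, Matrix.mul_apply, Fintype.sum_prod_type, Matrix.one_apply]
  rw [this]
  rfl

lemma pair2_mul_leg1 (a : Alg n) (X : Mult2 n) (f g : coefSub n) :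
    pair2 (X * leg1 a) f g = pair2 X (compR a f) g := by
  have : pair2 (X * leg1 a) = (pair2 X).comp (compR (a : Mult n)) := by
    apply coef_hom_ext₂
    intro α i j β k l
    simp [compR_mcoef, Matrix.mul_apply, Fintype.sum_prod_type, Matrix.one_apply, mul_comm]
  rw [this]
  rfl

lemma pair2_leg2_mul (a : Alg n) (X : Mult2 n) (f g : coefSub n) :
    pair2 (leg2 a * X) f g = pair2 X f (compL a g) := by
  have : pair2 (leg2 a * X) = (pair2 X).compl₂ (compL (a : Mult n)) := by
    apply coef_hom_ext₂
    intro α i j β k l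
    simp [compL_mcoef, Matrix.mul_apply, Fintype.sum_prod_type, Matrix.one_apply]
  rw [this]
  rfl

lemma pair2_mul_leg2 (a : Alg n) (X : Mult2 n) (f g : coefSub n) :
    pair2 (X * leg2 a) f g = pair2 X f (compR a g) := by
  have : pair2 (X * leg2 a) = (pair2 X).compl₂ (compR (a : Mult n)) := by
    apply coef_hom_ext₂
    intro α i j β k l
    simp [compR_mcoef, Matrix.mul_apply, Fintype.sum_prod_type, Matrix.one_apply, mul_comm]
  rw [this]
  rfl

/-- `(f ⊗ id)(t)` for `t ∈ A₀ ⊗ A₀`. -/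
def slice1 (f : Alg n →ₗ[ℂ] ℂ) : Alg n ⊗[ℂ] Alg n →ₗ[ℂ] Alg n :=
  (TensorProduct.lid ℂ (Alg n)).toLinearMap ∘ₗ f.rTensor (Alg n)

/-- `(id ⊗ f)(t)` for `t ∈ A₀ ⊗ A₀`. -/
def slice2 (f : Alg n →ₗ[ℂ] ℂ) : Alg n ⊗[ℂ] Alg n →ₗ[ℂ] Alg n :=
  (TensorProduct.rid ℂ (Alg n)).toLinearMap ∘ₗ f.lTensor (Alg n)

@[simp] lemma slice1_tmul (f : Alg n →ₗ[ℂ] ℂ) (a b : Alg n) :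
    slice1 f (a ⊗ₜ b) = f a • b := by simp [slice1]

@[simp] lemma slice2_tmul (f : Alg n →ₗ[ℂ] ℂ) (a b : Alg n) :
    slice2 f (a ⊗ₜ b) = f b • a := by simp [slice2]

lemma slice1_slice2 (f g : Alg n →ₗ[ℂ] ℂ) (t : Alg n ⊗[ℂ] Alg n) :
    g (slice1 f t) = f (slice2 g t) := by
  induction t with
  | zero => simp
  | add t t' ht ht' => simp [ht, ht']
  | tmul a b => simp [mul_comm]

lemma pair2_tmul (a b : Alg n) (f g : coefSub n) : pair2 (toMult2 (a ⊗ₜ b)) f g =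
    (f : Alg n →ₗ[ℂ] ℂ) a * (g : Alg n →ₗ[ℂ] ℂ) b := by
  have : pair2 (toMult2 (a ⊗ₜ b)) =
      (LinearMap.mul ℂ ℂ).compl₁₂ ((LinearMap.applyₗ a).comp (coefSub n).subtype)
        ((LinearMap.applyₗ b).comp (coefSub n).subtype) := by
    apply coef_hom_ext₂
    intro α i j β k l
    simp
  rw [this]
  rfl

lemma pair2_toMult2 (t : Alg n ⊗[ℂ] Alg n) (f g : coefSub n) :
    pair2 (toMult2 t) f g = (g : Alg n →ₗ[ℂ] ℂ) (slice1 f t) := by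
  induction t with
  | zero => simp [pair2_zero]
  | add t t' ht ht' => simp [pair2_add, ht, ht']
  | tmul a b => simp [pair2_tmul]

end coef

end QGrp

/-! ### Counit and cointegral -/

namespace QGrp

namespace DiscreteQuantumGroup

variable {I : Type u} (G : DiscreteQuantumGroup I)

section transforms

/-- `T₁` as a linear equivalence. -/
def T₁e : Alg G.n ⊗[ℂ] Alg G.n ≃ₗ[ℂ] Alg G.n ⊗[ℂ] Alg G.n :=
  LinearEquiv.ofBijective G.T₁ G.T₁_bijective

/-- `T₂` as a linear equivalence. -/
def T₂e : Alg G.n ⊗[ℂ] Alg G.n ≃ₗ[ℂ] Alg G.n ⊗[ℂ] Alg G.n :=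
  LinearEquiv.ofBijective G.T₂ G.T₂_bijective

@[simp] lemma T₁e_symm_T₁ (t : Alg G.n ⊗[ℂ] Alg G.n) : G.T₁e.symm (G.T₁ t) = t :=
  G.T₁e.symm_apply_apply t

@[simp] lemma T₂e_symm_T₂ (t : Alg G.n ⊗[ℂ] Alg G.n) : G.T₂e.symm (G.T₂ t) = t :=
  G.T₂e.symm_apply_apply t

@[simp] lemma T₁_T₁e_symm (t : Alg G.n ⊗[ℂ] Alg G.n) : G.T₁ (G.T₁e.symm t) = t :=
  G.T₁e.apply_symm_apply t

@[simp] lemma T₂_T₂e_symm (t : Alg G.n ⊗[ℂ] Alg G.n) : G.T₂ (G.T₂e.symm t) = t :=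
  G.T₂e.apply_symm_apply t

lemma toMult2_rTensor_mulLeft {n : I → ℕ} (a : Alg n) (t : Alg n ⊗[ℂ] Alg n) :
    toMult2 ((LinearMap.mulLeft ℂ a).rTensor (Alg n) t) = leg1 a * toMult2 t := by
  induction t with
  | zero => simp
  | add t t' ht ht' => simp [mul_add, ht, ht']
  | tmul b c =>
    rw [LinearMap.rTensor_tmul, ← leg1_mul_leg2, ← leg1_mul_leg2, LinearMap.mulLeft_apply, leg1_mul,
      mul_assoc]

lemma toMult2_lTensor_mulLeft {n : I → ℕ} (a : Alg n) (t : Alg n ⊗[ℂ] Alg n) :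
    toMult2 ((LinearMap.mulLeft ℂ a).lTensor (Alg n) t) = leg2 a * toMult2 t := by
  induction t with
  | zero => simp
  | add t t' ht ht' => simp [mul_add, ht, ht']
  | tmul b c =>
    rw [LinearMap.lTensor_tmul, ← leg2_mul_leg1, ← leg2_mul_leg1, LinearMap.mulLeft_apply, leg2_mul,
      mul_assoc]

lemma toMult2_T₁_mulLeft (a : Alg G.n) (t : Alg G.n ⊗[ℂ] Alg G.n) :
    toMult2 (G.T₁ ((LinearMap.mulLeft ℂ a).rTensor (Alg G.n) t)) = G.Δ a * toMult2 (G.T₁ t) := by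
  induction t with
  | zero => simp
  | add t t' ht ht' => simp [mul_add, ht, ht']
  | tmul b c => simp [T₁_spec, mul_assoc]

lemma toMult2_T₂_mulRight (a : Alg G.n) (t : Alg G.n ⊗[ℂ] Alg G.n) :
    toMult2 (G.T₂ ((LinearMap.mulRight ℂ a).lTensor (Alg G.n) t)) = toMult2 (G.T₂ t) * G.Δ a := by
  induction t with
  | zero => simp
  | add t t' ht ht' => simp [add_mul, ht, ht']
  | tmul b c => simp [T₂_spec, mul_assoc]

end transforms

section counit

lemma coassoc_tmul (a b c : Alg G.n) :
    G.T₂.rTensor (Alg G.n) ((TensorProduct.assoc ℂ _ _ _).symm (a ⊗ₜ[ℂ] G.T₁ (b ⊗ₜ c))) =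
      (TensorProduct.assoc ℂ _ _ _).symm (G.T₁.lTensor (Alg G.n)
        (TensorProduct.assoc ℂ _ _ _ (G.T₂ (a ⊗ₜ b) ⊗ₜ[ℂ] c))) :=
  LinearMap.congr_fun G.coassoc (a ⊗ₜ (b ⊗ₜ c))

/-- `t ↦ (id ⊗ f)(t ⊗ c)`. -/
def tripleR {n : I → ℕ} (f : Alg n ⊗[ℂ] Alg n →ₗ[ℂ] Alg n) (c : Alg n) :
    Alg n ⊗[ℂ] Alg n →ₗ[ℂ] Alg n ⊗[ℂ] Alg n :=
  f.lTensor (Alg n) ∘ₗ (TensorProduct.assoc ℂ _ _ _).toLinearMap ∘ₗ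
    (TensorProduct.mk ℂ (Alg n ⊗[ℂ] Alg n) (Alg n)).flip c

lemma tripleR_tmul {n : I → ℕ} (f : Alg n ⊗[ℂ] Alg n →ₗ[ℂ] Alg n) (a b c : Alg n) :
    tripleR f c (a ⊗ₜ b) = a ⊗ₜ f (b ⊗ₜ c) := rfl

lemma toMult2_tripleR_mul' {n : I → ℕ} (c : Alg n) (t : Alg n ⊗[ℂ] Alg n) :
    toMult2 (tripleR (LinearMap.mul' ℂ (Alg n)) c t) = toMult2 t * leg2 c := by
  induction t with
  | zero => simp
  | add t t' ht ht' => simp [add_mul, ht, ht']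
  | tmul a b => rw [tripleR_tmul, ← leg1_mul_leg2, ← leg1_mul_leg2, LinearMap.mul'_apply, leg2_mul,
      mul_assoc]

lemma tripleR_T₂ (a y c : Alg G.n) :
    tripleR (LinearMap.mul' ℂ (Alg G.n) ∘ₗ G.T₁e.symm.toLinearMap) c (G.T₂ (a ⊗ₜ y)) =
      (a * y) ⊗ₜ c := by
  let L : Alg G.n ⊗[ℂ] Alg G.n →ₗ[ℂ] Alg G.n ⊗[ℂ] Alg G.n :=
    (LinearMap.mul' ℂ (Alg G.n) ∘ₗ G.T₁e.symm.toLinearMap).lTensor (Alg G.n) ∘ₗ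
      (TensorProduct.assoc ℂ _ _ _).toLinearMap ∘ₗ G.T₂.rTensor (Alg G.n) ∘ₗ
        (TensorProduct.assoc ℂ _ _ _).symm.toLinearMap ∘ₗ TensorProduct.mk ℂ _ _ a
  have h0 : (LinearMap.mul' ℂ (Alg G.n) ∘ₗ G.T₁e.symm.toLinearMap) ∘ₗ G.T₁ =
      LinearMap.mul' ℂ (Alg G.n) :=
    LinearMap.ext fun t => congrArg (LinearMap.mul' ℂ (Alg G.n)) (G.T₁e_symm_T₁ t)
  have hL : L ∘ₗ G.T₁ = (LinearMap.mulLeft ℂ a).rTensor (Alg G.n) ∘ₗ G.T₁ := by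
    refine TensorProduct.ext' fun b c => ?_
    have h1 : L (G.T₁ (b ⊗ₜ c)) = tripleR (LinearMap.mul' ℂ (Alg G.n)) c (G.T₂ (a ⊗ₜ b)) := by
      change (LinearMap.mul' ℂ (Alg G.n) ∘ₗ G.T₁e.symm.toLinearMap).lTensor (Alg G.n)
        (TensorProduct.assoc ℂ _ _ _ (G.T₂.rTensor (Alg G.n)
          ((TensorProduct.assoc ℂ _ _ _).symm (a ⊗ₜ[ℂ] G.T₁ (b ⊗ₜ c))))) = _
      rw [coassoc_tmul, LinearEquiv.apply_symm_apply, ← LinearMap.comp_apply,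
        ← LinearMap.lTensor_comp, h0]
      rfl
    apply toMult2_injective
    rw [LinearMap.comp_apply, h1, toMult2_tripleR_mul', LinearMap.comp_apply,
      toMult2_rTensor_mulLeft, T₁_spec, T₂_spec, mul_assoc]
  have h2 : L (G.T₁ (G.T₁e.symm (y ⊗ₜ c))) =
      (LinearMap.mulLeft ℂ a).rTensor (Alg G.n) (G.T₁ (G.T₁e.symm (y ⊗ₜ c))) :=
    LinearMap.congr_fun hL _
  rw [T₁_T₁e_symm] at h2
  exact h2

/-- `m T₁⁻¹(b ⊗ c)` and `m T₂⁻¹(a ⊗ b)` are governed by one and the same functional of `b`. -/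
lemma tmul_mul'_T₁e_symm (a b c : Alg G.n) :
    a ⊗ₜ[ℂ] LinearMap.mul' ℂ (Alg G.n) (G.T₁e.symm (b ⊗ₜ c)) =
      LinearMap.mul' ℂ (Alg G.n) (G.T₂e.symm (a ⊗ₜ b)) ⊗ₜ[ℂ] c := by
  have key : tripleR (LinearMap.mul' ℂ (Alg G.n) ∘ₗ G.T₁e.symm.toLinearMap) c ∘ₗ G.T₂ =
      (TensorProduct.mk ℂ _ _).flip c ∘ₗ LinearMap.mul' ℂ (Alg G.n) :=
    TensorProduct.ext' fun x y => G.tripleR_T₂ x y c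
  have := LinearMap.congr_fun key (G.T₂e.symm (a ⊗ₜ b))
  rw [LinearMap.comp_apply, T₂_T₂e_symm] at this
  exact this

variable [Nonempty I]

lemma exists_isCounit : ∃ ε, G.IsCounit ε := by
  obtain ⟨α⟩ := ‹Nonempty I›
  let i : Fin (G.n α) := ⟨0, G.n_pos α⟩
  let g : Alg G.n →ₗ[ℂ] ℂ := mcoef G.n α i i
  let e := unit G.n α i i
  have hge : g e = 1 := by simp [g, e]
  let ε : Alg G.n →ₗ[ℂ] ℂ := g ∘ₗ LinearMap.mul' ℂ (Alg G.n) ∘ₗ G.T₂e.symm.toLinearMap ∘ₗ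
    TensorProduct.mk ℂ _ _ e
  have h1 : ∀ b c, LinearMap.mul' ℂ (Alg G.n) (G.T₁e.symm (b ⊗ₜ c)) = ε b • c := by
    intro b c
    have := congrArg (slice1 g) (G.tmul_mul'_T₁e_symm e b c)
    rw [slice1_tmul, slice1_tmul, hge, one_smul] at this
    exact this
  have h2 : ∀ a b, LinearMap.mul' ℂ (Alg G.n) (G.T₂e.symm (a ⊗ₜ b)) = ε b • a := by
    intro a b
    have := congrArg (slice2 g) (G.tmul_mul'_T₁e_symm a b e)
    rw [h1] at this
    simpa [hge] using this.symm
  have h3 : ∀ t, slice1 ε t = LinearMap.mul' ℂ (Alg G.n) (G.T₁e.symm t) := by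
    intro t
    induction t with
    | zero => simp
    | add t t' ht ht' => simp [ht, ht']
    | tmul a b => simp [h1]
  have h4 : ∀ t, slice2 ε t = LinearMap.mul' ℂ (Alg G.n) (G.T₂e.symm t) := by
    intro t
    induction t with
    | zero => simp
    | add t t' ht ht' => simp [ht, ht']
    | tmul a b => simp [h2]
  refine ⟨ε, fun a b => ⟨?_, ?_⟩⟩
  · exact (h3 _).trans (by simp)
  · exact (h4 _).trans (by simp)

lemma counit_spec : G.IsCounit G.counit := Classical.epsilon_spec G.exists_isCounit

lemma slice1_counit_T₁ (a b : Alg G.n) : slice1 G.counit (G.T₁ (a ⊗ₜ b)) = a * b :=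
  (G.counit_spec a b).1

lemma slice2_counit_T₂ (a b : Alg G.n) : slice2 G.counit (G.T₂ (a ⊗ₜ b)) = a * b :=
  (G.counit_spec a b).2

lemma counit_mul (b c : Alg G.n) : G.counit (b * c) = G.counit b * G.counit c := by
  have h1 : ∀ c t, slice2 G.counit (G.T₂ ((LinearMap.mulRight ℂ c).lTensor (Alg G.n)
      (G.T₂e.symm t))) = slice2 G.counit t * c := by
    intro c t
    obtain ⟨s, rfl⟩ := G.T₂_bijective.2 t
    rw [T₂e_symm_T₂]
    induction s with
    | zero => simp
    | add s s' hs hs' => simp [hs, hs', add_mul]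
    | tmul a b => simp [slice2_counit_T₂, mul_assoc]
  have h2 : ∀ a b c, G.T₂ ((LinearMap.mulRight ℂ c).lTensor (Alg G.n) (G.T₂e.symm (a ⊗ₜ b))) =
      (LinearMap.mulLeft ℂ b).lTensor (Alg G.n) (G.T₂ (a ⊗ₜ c)) := by
    intro a b c
    apply toMult2_injective
    rw [toMult2_T₂_mulRight, T₂_T₂e_symm, toMult2_lTensor_mulLeft, T₂_spec, ← leg2_mul_leg1,
      mul_assoc]
  have h3 : ∀ b s, slice2 G.counit ((LinearMap.mulLeft ℂ b).lTensor (Alg G.n) s) =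
      G.counit b • slice2 G.counit s := by
    intro b s
    obtain ⟨t, rfl⟩ := G.T₂_bijective.2 s
    induction t with
    | zero => simp
    | add t t' ht ht' => simp [ht, ht']
    | tmul a c => rw [← h2, h1, slice2_counit_T₂, slice2_tmul, smul_mul_assoc]
  obtain ⟨α⟩ := ‹Nonempty I›
  let i : Fin (G.n α) := ⟨0, G.n_pos α⟩
  have := congrArg (mcoef G.n α i i : Alg G.n →ₗ[ℂ] ℂ) (h3 b (unit G.n α i i ⊗ₜ c))
  simpa using this

lemma counit_ne_zero : G.counit ≠ 0 := by
  intro h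
  obtain ⟨α⟩ := ‹Nonempty I›
  let i : Fin (G.n α) := ⟨0, G.n_pos α⟩
  have := congrArg (mcoef G.n α i i : Alg G.n →ₗ[ℂ] ℂ)
    (G.slice2_counit_T₂ (unit G.n α i i) (unit G.n α i i))
  rw [h] at this
  simp [slice2] at this

end counit

end DiscreteQuantumGroup

lemma unit_mul_unit {I : Type u} {n : I → ℕ} {α : I} (i j k : Fin (n α)) :
    unit n α i j * unit n α j k = unit n α i k := by
  apply Subtype.ext
  funext β
  by_cases h : β = α
  · subst h; simp
  · simp [unit_of_ne h]

lemma unit_mul_mul_unit {I : Type u} {n : I → ℕ} {α : I} (i j k l : Fin (n α)) (x : Alg n) :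
    unit n α i j * x * unit n α k l = (x : Mult n) α j k • unit n α i l := by
  apply Subtype.ext
  funext β
  by_cases h : β = α
  · subst h
    ext p q
    simp [Matrix.mul_apply, Matrix.single_apply, ite_and]
    split_ifs <;> simp_all
  · simp [unit_of_ne h]

@[simp] lemma star_unit {I : Type u} {n : I → ℕ} (α : I) (i j : Fin (n α)) :
    star (unit n α i j) = unit n α j i := by
  apply Subtype.ext
  funext β
  by_cases h : β = α
  · subst h; simp [Matrix.star_eq_conjTranspose]
  · simp [unit_of_ne h]

/-- A nonzero multiplicative functional on `⨁ α, M_{n α}(ℂ)` is the projection on a block of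
size one. -/
lemma exists_block_of_character {I : Type u} {n : I → ℕ} {f : Alg n →ₗ[ℂ] ℂ} (hf : f ≠ 0)
    (hmul : ∀ a b, f (a * b) = f a * f b) :
    ∃ (α : I) (i : Fin (n α)), (∀ j, j = i) ∧ ∀ x, f x = (x : Mult n) α i i := by
  obtain ⟨α, i, j, h⟩ : ∃ α i j, f (unit n α i j) ≠ 0 := by
    by_contra! hc
    exact hf (alg_hom_ext fun γ p q => by simp [hc])
  have h1 : f (unit n α i i) = 1 := by
    have h2 := hmul (unit n α i i) (unit n α i j)
    rw [unit_mul_unit] at h2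
    exact (mul_eq_right₀ h).mp h2.symm
  have h3 : ∀ x, f x = (x : Mult n) α i i := by
    intro x
    have := congrArg f (unit_mul_mul_unit i i i i x)
    rwa [hmul, hmul, h1, map_smul, h1, one_mul, mul_one, smul_eq_mul, mul_one] at this
  refine ⟨α, i, fun j => ?_, h3⟩
  by_contra hj
  have h4 := hmul (unit n α i j) (unit n α j i)
  rw [unit_mul_unit, h1, h3, h3] at h4
  simp [hj] at h4

namespace DiscreteQuantumGroup

variable {I : Type u} (G : DiscreteQuantumGroup I) [Nonempty I]

lemma exists_cointegral : ∃ h : Alg G.n, star h = h ∧ h * h = h ∧ G.counit h = 1 ∧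
    (∀ x, x * h = G.counit x • h) ∧ (∀ x, h * x = G.counit x • h) ∧
    (∀ x, G.counit (star x) = star (G.counit x)) ∧ G.counit ∈ coefSub G.n := by
  obtain ⟨α, i, hi, hx⟩ := exists_block_of_character G.counit_ne_zero G.counit_mul
  have h1 : ∀ x, x * unit G.n α i i = G.counit x • unit G.n α i i := by
    intro x
    apply Subtype.ext
    funext β
    by_cases h : β = α
    · subst h
      ext p q
      rw [hi p, hi q]
      simp [hx]
    · simp [unit_of_ne h]
  have h2 : ∀ x, unit G.n α i i * x = G.counit x • unit G.n α i i := by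
    intro x
    apply Subtype.ext
    funext β
    by_cases h : β = α
    · subst h
      ext p q
      rw [hi p, hi q]
      simp [hx]
    · simp [unit_of_ne h]
  refine ⟨unit G.n α i i, by simp, unit_mul_unit i i i, by simp [hx], h1, h2, ?_, ?_⟩
  · intro x
    simp [hx, Matrix.star_apply]
  · have : G.counit = mcoef G.n α i i := by
      ext x
      simp [hx]
    rw [this]
    exact (mcoef G.n α i i).2

/-- The cointegral: the projection `h` with `x h = ε(x) h`. -/
def coint : Alg G.n := G.exists_cointegral.choose

lemma star_coint : star G.coint = G.coint := G.exists_cointegral.choose_spec.1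

lemma counit_coint : G.counit G.coint = 1 := G.exists_cointegral.choose_spec.2.2.1

lemma mul_coint (x : Alg G.n) : x * G.coint = G.counit x • G.coint :=
  G.exists_cointegral.choose_spec.2.2.2.1 x

lemma coint_mul (x : Alg G.n) : G.coint * x = G.counit x • G.coint :=
  G.exists_cointegral.choose_spec.2.2.2.2.1 x

lemma counit_star (x : Alg G.n) : G.counit (star x) = star (G.counit x) :=
  G.exists_cointegral.choose_spec.2.2.2.2.2.1 x

/-- The counit, as the unit of `R`. -/
def cone : coefSub G.n := ⟨G.counit, G.exists_cointegral.choose_spec.2.2.2.2.2.2⟩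

@[simp] lemma cone_apply (x : Alg G.n) : (G.cone : Alg G.n →ₗ[ℂ] ℂ) x = G.counit x := rfl

lemma coint_ne_zero : G.coint ≠ 0 := by
  intro h
  have := G.counit_coint
  rw [h, map_zero] at this
  exact zero_ne_one this

end DiscreteQuantumGroup

end QGrp

/-! ### The algebra `R` and the antipode from the cointegral -/

namespace QGrp

namespace DiscreteQuantumGroup

variable {I : Type u} (G : DiscreteQuantumGroup I)

section product

lemma exists_T₂_mul_Δ_eq_zero (s : Alg G.n ⊗[ℂ] Alg G.n) : ∃ F : Finset I, ∀ x : Alg G.n,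
    (∀ γ ∈ F, (x : Mult G.n) γ = 0) → toMult2 (G.T₂ s) * G.Δ x = 0 := by
  classical
  induction s with
  | zero => exact ⟨∅, by simp⟩
  | add s t hs ht =>
    obtain ⟨F, hF⟩ := hs
    obtain ⟨F', hF'⟩ := ht
    refine ⟨F ∪ F', fun x hx => ?_⟩
    rw [map_add, map_add, add_mul, hF x fun γ hγ => hx γ (Finset.mem_union_left _ hγ),
      hF' x fun γ hγ => hx γ (Finset.mem_union_right _ hγ), add_zero]
  | tmul a b =>
    obtain ⟨F, hF⟩ := exists_supp b
    refine ⟨F, fun x hx => ?_⟩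
    have : b * x = 0 := by
      apply Subtype.ext
      funext γ
      by_cases hγ : γ ∈ F
      · simp [hx γ hγ]
      · simp [hF γ hγ]
    rw [T₂_spec, mul_assoc, ← map_mul, this, map_zero, mul_zero]

lemma exists_pair2_Δ_eq_zero (f g : coefSub G.n) : ∃ F : Finset I, ∀ x : Alg G.n,
    (∀ γ ∈ F, (x : Mult G.n) γ = 0) → pair2 (G.Δ x) f g = 0 := by
  obtain ⟨F, hF⟩ := exists_local_unit f
  obtain ⟨F', hF'⟩ := exists_local_unit g
  obtain ⟨s, hs⟩ := G.T₂_bijective.2 (proj G.n F ⊗ₜ proj G.n F')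
  obtain ⟨F'', h⟩ := G.exists_T₂_mul_Δ_eq_zero s
  refine ⟨F'', fun x hx => ?_⟩
  have := h x hx
  rw [hs, ← leg1_mul_leg2, mul_assoc] at this
  rw [← (hF F subset_rfl).1, ← pair2_leg1_mul, ← (hF' F' subset_rfl).1, ← pair2_leg2_mul,
    ← mul_assoc, leg2_mul_leg1, ← leg1_mul_leg2, mul_assoc, this, pair2_zero]
  rfl

/-- The product of `R`: `(f g)(x) = (f ⊗ g)(Δ(x))`. -/
def cmul : coefSub G.n →ₗ[ℂ] coefSub G.n →ₗ[ℂ] coefSub G.n :=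
  LinearMap.mk₂ ℂ (fun f g => ⟨
    { toFun := fun x => pair2 (G.Δ x) f g
      map_add' := fun x y => by rw [map_add, pair2_add]; rfl
      map_smul' := fun c x => by rw [map_smul, pair2_smul]; rfl }, by
      obtain ⟨F, hF⟩ := G.exists_pair2_Δ_eq_zero f g
      refine ⟨F, fun γ hγ p q => hF _ fun β hβ => unit_of_ne ?_ _ _⟩
      rintro rfl
      exact hγ hβ⟩)
    (fun f f' g => coef_ext fun x => by
      change pair2 _ _ _ = pair2 _ _ _ + pair2 _ _ _
      simp)
    (fun c f g => coef_ext fun x => by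
      change pair2 _ _ _ = c • pair2 _ _ _
      simp)
    (fun f g g' => coef_ext fun x => by
      change pair2 _ _ _ = pair2 _ _ _ + pair2 _ _ _
      simp)
    (fun c f g => coef_ext fun x => by
      change pair2 _ _ _ = c • pair2 _ _ _
      simp)

lemma cmul_apply (f g : coefSub G.n) (x : Alg G.n) :
    (G.cmul f g : Alg G.n →ₗ[ℂ] ℂ) x = pair2 (G.Δ x) f g := rfl

lemma exists_ract : ∃ r : Alg G.n → coefSub G.n → Alg G.n, ∀ x f (g : coefSub G.n),
    (g : Alg G.n →ₗ[ℂ] ℂ) (r x f) = (G.cmul f g : Alg G.n →ₗ[ℂ] ℂ) x := by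
  suffices h : ∀ x f, ∃ y : Alg G.n, ∀ g : coefSub G.n,
      (g : Alg G.n →ₗ[ℂ] ℂ) y = (G.cmul f g : Alg G.n →ₗ[ℂ] ℂ) x by
    choose r hr using h
    exact ⟨r, hr⟩
  intro x f
  obtain ⟨F, hF⟩ := exists_local_unit f
  refine ⟨slice1 (f : Alg G.n →ₗ[ℂ] ℂ) (G.T₂ (proj G.n F ⊗ₜ x)), fun g => ?_⟩
  rw [← pair2_toMult2, T₂_spec, pair2_leg1_mul, (hF F subset_rfl).1, cmul_apply]

lemma exists_lact : ∃ r : Alg G.n → coefSub G.n → Alg G.n, ∀ x f (g : coefSub G.n),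
    (g : Alg G.n →ₗ[ℂ] ℂ) (r x f) = (G.cmul g f : Alg G.n →ₗ[ℂ] ℂ) x := by
  suffices h : ∀ x f, ∃ y : Alg G.n, ∀ g : coefSub G.n,
      (g : Alg G.n →ₗ[ℂ] ℂ) y = (G.cmul g f : Alg G.n →ₗ[ℂ] ℂ) x by
    choose r hr using h
    exact ⟨r, hr⟩
  intro x f
  obtain ⟨F, hF⟩ := exists_local_unit f
  refine ⟨slice2 (f : Alg G.n →ₗ[ℂ] ℂ) (G.T₁ (x ⊗ₜ proj G.n F)), fun g => ?_⟩
  rw [← slice1_slice2, ← pair2_toMult2, T₁_spec, pair2_mul_leg2, (hF F subset_rfl).2, cmul_apply]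

/-- The right action `x ◁ f = (f ⊗ id)(Δ(x))` of `R` on `A₀`. -/
def ract : Alg G.n →ₗ[ℂ] coefSub G.n →ₗ[ℂ] Alg G.n :=
  LinearMap.mk₂ ℂ G.exists_ract.choose
    (fun x y f => alg_ext fun g => by
      rw [map_add, G.exists_ract.choose_spec, G.exists_ract.choose_spec,
        G.exists_ract.choose_spec, map_add])
    (fun c x f => alg_ext fun g => by
      rw [map_smul, G.exists_ract.choose_spec, G.exists_ract.choose_spec, map_smul])
    (fun x f f' => alg_ext fun g => by
      rw [map_add, G.exists_ract.choose_spec, G.exists_ract.choose_spec,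
        G.exists_ract.choose_spec, map_add]; rfl)
    (fun c x f => alg_ext fun g => by
      rw [map_smul, G.exists_ract.choose_spec, G.exists_ract.choose_spec, map_smul]
      rfl)

/-- The left action `f ▷ x = (id ⊗ f)(Δ(x))` of `R` on `A₀`. -/
def lact : Alg G.n →ₗ[ℂ] coefSub G.n →ₗ[ℂ] Alg G.n :=
  LinearMap.mk₂ ℂ G.exists_lact.choose
    (fun x y f => alg_ext fun g => by
      rw [map_add, G.exists_lact.choose_spec, G.exists_lact.choose_spec,
        G.exists_lact.choose_spec, map_add])
    (fun c x f => alg_ext fun g => by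
      rw [map_smul, G.exists_lact.choose_spec, G.exists_lact.choose_spec, map_smul])
    (fun x f f' => alg_ext fun g => by
      rw [map_add, G.exists_lact.choose_spec, G.exists_lact.choose_spec,
        G.exists_lact.choose_spec, map_add]; rfl)
    (fun c x f => alg_ext fun g => by
      rw [map_smul, G.exists_lact.choose_spec, G.exists_lact.choose_spec, map_smul]
      rfl)

lemma apply_ract (x : Alg G.n) (f g : coefSub G.n) :
    (g : Alg G.n →ₗ[ℂ] ℂ) (G.ract x f) = (G.cmul f g : Alg G.n →ₗ[ℂ] ℂ) x :=
  G.exists_ract.choose_spec x f g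

lemma apply_lact (x : Alg G.n) (f g : coefSub G.n) :
    (g : Alg G.n →ₗ[ℂ] ℂ) (G.lact x f) = (G.cmul g f : Alg G.n →ₗ[ℂ] ℂ) x :=
  G.exists_lact.choose_spec x f g

lemma slice1_T₂ {p : Alg G.n} {f : coefSub G.n} (hf : compL (p : Mult G.n) f = f) (x : Alg G.n) :
    slice1 (f : Alg G.n →ₗ[ℂ] ℂ) (G.T₂ (p ⊗ₜ x)) = G.ract x f := by
  refine alg_ext fun g => ?_
  rw [← pair2_toMult2, T₂_spec, pair2_leg1_mul, hf, apply_ract, cmul_apply]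

lemma slice2_T₁ {q : Alg G.n} {f : coefSub G.n} (hf : compR (q : Mult G.n) f = f) (x : Alg G.n) :
    slice2 (f : Alg G.n →ₗ[ℂ] ℂ) (G.T₁ (x ⊗ₜ q)) = G.lact x f := by
  refine alg_ext fun g => ?_
  rw [← slice1_slice2, ← pair2_toMult2, T₁_spec, pair2_mul_leg2, hf, apply_lact, cmul_apply]

/-- Coassociativity: `A₀` is a bimodule over `R`. -/
lemma lact_ract (x : Alg G.n) (f k : coefSub G.n) :
    G.ract (G.lact x k) f = G.lact (G.ract x f) k := by
  obtain ⟨F, hF⟩ := exists_local_unit f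
  obtain ⟨F', hF'⟩ := exists_local_unit k
  have hf := (hF F subset_rfl).1
  have hk := (hF' F' subset_rfl).2
  let Φ : (Alg G.n ⊗[ℂ] Alg G.n) ⊗[ℂ] Alg G.n →ₗ[ℂ] Alg G.n :=
    (TensorProduct.rid ℂ (Alg G.n)).toLinearMap ∘ₗ
      TensorProduct.map (slice1 (f : Alg G.n →ₗ[ℂ] ℂ)) (k : Alg G.n →ₗ[ℂ] ℂ)
  have h1 : Φ ∘ₗ G.T₂.rTensor (Alg G.n) ∘ₗ (TensorProduct.assoc ℂ _ _ _).symm.toLinearMap ∘ₗ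
      TensorProduct.mk ℂ _ _ (proj G.n F) =
      slice1 (f : Alg G.n →ₗ[ℂ] ℂ) ∘ₗ G.T₂ ∘ₗ TensorProduct.mk ℂ _ _ (proj G.n F) ∘ₗ
        slice2 (k : Alg G.n →ₗ[ℂ] ℂ) := by
    refine TensorProduct.ext' fun b c => ?_
    simp [Φ]
  have h2 : Φ ∘ₗ (TensorProduct.assoc ℂ _ _ _).symm.toLinearMap ∘ₗ G.T₁.lTensor (Alg G.n) ∘ₗ
      (TensorProduct.assoc ℂ _ _ _).toLinearMap ∘ₗ
        (TensorProduct.mk ℂ _ _).flip (proj G.n F') =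
      slice2 (k : Alg G.n →ₗ[ℂ] ℂ) ∘ₗ G.T₁ ∘ₗ (TensorProduct.mk ℂ _ _).flip (proj G.n F') ∘ₗ
        slice1 (f : Alg G.n →ₗ[ℂ] ℂ) := by
    refine TensorProduct.ext' fun b c => ?_
    have h3 : Φ ∘ₗ (TensorProduct.assoc ℂ _ _ _).symm.toLinearMap ∘ₗ TensorProduct.mk ℂ _ _ b =
        (f : Alg G.n →ₗ[ℂ] ℂ) b • slice2 (k : Alg G.n →ₗ[ℂ] ℂ) := by
      refine TensorProduct.ext' fun b' c' => ?_
      simp [Φ]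
      rw [smul_comm]
    have := LinearMap.congr_fun h3 (G.T₁ (c ⊗ₜ proj G.n F'))
    simpa using this
  have h4 := congrArg Φ (G.coassoc_tmul (proj G.n F) x (proj G.n F'))
  have h5 := LinearMap.congr_fun h1 (G.T₁ (x ⊗ₜ proj G.n F'))
  have h6 := LinearMap.congr_fun h2 (G.T₂ (proj G.n F ⊗ₜ x))
  rw [← G.slice1_T₂ hf, ← G.slice2_T₁ hk, ← G.slice2_T₁ hk, ← G.slice1_T₂ hf]
  exact h5.symm.trans (h4.trans h6)

lemma cmul_assoc (f g k : coefSub G.n) : G.cmul (G.cmul f g) k = G.cmul f (G.cmul g k) := by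
  refine coef_ext fun x => ?_
  rw [← apply_lact, ← apply_ract, ← apply_ract, ← apply_lact, lact_ract]

lemma ract_ract (x : Alg G.n) (f g : coefSub G.n) :
    G.ract (G.ract x f) g = G.ract x (G.cmul f g) :=
  alg_ext fun k => by rw [apply_ract, apply_ract, apply_ract, cmul_assoc]

lemma lact_lact (x : Alg G.n) (f g : coefSub G.n) :
    G.lact (G.lact x g) f = G.lact x (G.cmul f g) :=
  alg_ext fun k => by rw [apply_lact, apply_lact, apply_lact, cmul_assoc]

lemma cmul_mcoef_mul (α β : I) (i j : Fin (G.n α)) (k l : Fin (G.n β)) (x y : Alg G.n) :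
    (G.cmul (mcoef G.n α i j) (mcoef G.n β k l) : Alg G.n →ₗ[ℂ] ℂ) (x * y) =
      ∑ p, ∑ q, (G.cmul (mcoef G.n α i p) (mcoef G.n β k q) : Alg G.n →ₗ[ℂ] ℂ) x *
        (G.cmul (mcoef G.n α p j) (mcoef G.n β q l) : Alg G.n →ₗ[ℂ] ℂ) y := by
  simp [cmul_apply, Matrix.mul_apply, Fintype.sum_prod_type]

/-- `A₀` is a right module algebra over `R`. -/
lemma ract_mul (x y : Alg G.n) (α : I) (i j : Fin (G.n α)) :
    G.ract (x * y) (mcoef G.n α i j) =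
      ∑ k, G.ract x (mcoef G.n α i k) * G.ract y (mcoef G.n α k j) := by
  apply Subtype.ext
  funext β
  ext k l
  have h1 : ∀ (z : Alg G.n) (i j : Fin (G.n α)) (k l : Fin (G.n β)),
      (G.ract z (mcoef G.n α i j) : Mult G.n) β k l =
      (G.cmul (mcoef G.n α i j) (mcoef G.n β k l) : Alg G.n →ₗ[ℂ] ℂ) z := fun z i j k l =>
    G.apply_ract z (mcoef G.n α i j) (mcoef G.n β k l)
  rw [h1, cmul_mcoef_mul]
  have h2 : ((∑ k, G.ract x (mcoef G.n α i k) * G.ract y (mcoef G.n α k j) : Alg G.n) :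
      Mult G.n) β = ∑ p, (G.ract x (mcoef G.n α i p) : Mult G.n) β *
        (G.ract y (mcoef G.n α p j) : Mult G.n) β := by
    simp
  rw [h2]
  simp only [Matrix.sum_apply, Matrix.mul_apply, h1]

section unit

variable [Nonempty I]

lemma coe_cone : (G.cone : Alg G.n →ₗ[ℂ] ℂ) = G.counit := rfl

lemma cone_cmul (g : coefSub G.n) : G.cmul G.cone g = g := by
  refine coef_ext fun x => ?_
  obtain ⟨F, hF⟩ := exists_local_unit g
  have hg := (hF F subset_rfl).2
  rw [← apply_lact, ← G.slice2_T₁ hg, ← slice1_slice2, coe_cone, slice1_counit_T₁]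
  exact congrArg (fun f : coefSub G.n => (f : Alg G.n →ₗ[ℂ] ℂ) x) hg

lemma cmul_cone (f : coefSub G.n) : G.cmul f G.cone = f := by
  refine coef_ext fun x => ?_
  obtain ⟨F, hF⟩ := exists_local_unit f
  have hf := (hF F subset_rfl).1
  rw [← apply_ract, ← G.slice1_T₂ hf, slice1_slice2, coe_cone, slice2_counit_T₂]
  exact congrArg (fun f : coefSub G.n => (f : Alg G.n →ₗ[ℂ] ℂ) x) hf

/-- A left and a right inverse of a matrix over `R` coincide. -/
lemma cmul_inv_unique {κ : Type*} [Fintype κ] [DecidableEq κ] {A B C : κ → κ → coefSub G.n}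
    (hAB : ∀ i j, ∑ k, G.cmul (A i k) (B k j) = if i = j then G.cone else 0)
    (hBC : ∀ i j, ∑ k, G.cmul (B i k) (C k j) = if i = j then G.cone else 0) : A = C := by
  funext i j
  have h1 : ∑ k, ∑ l, G.cmul (A i k) (G.cmul (B k l) (C l j)) = A i j := by
    simp_rw [← map_sum, hBC]
    rw [Finset.sum_eq_single j]
    · simp [cmul_cone]
    · intro b _ hb; simp [hb]
    · simp
  have h2 : ∑ k, ∑ l, G.cmul (A i k) (G.cmul (B k l) (C l j)) = C i j := by
    rw [Finset.sum_comm]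
    simp_rw [← cmul_assoc, ← LinearMap.sum_apply, ← map_sum, hAB]
    rw [Finset.sum_eq_single i]
    · simp [cone_cmul]
    · intro b _ hb; simp [hb.symm]
    · simp
  rw [← h1, h2]

end unit

end product

section antipode

lemma tmul_left_injective {n : I → ℕ} {h : Alg n} (hh : h ≠ 0) {a b : Alg n}
    (hab : h ⊗ₜ[ℂ] a = h ⊗ₜ[ℂ] b) : a = b := by
  obtain ⟨f, hf⟩ : ∃ f : coefSub n, (f : Alg n →ₗ[ℂ] ℂ) h ≠ 0 := by
    by_contra! hc
    exact hh (alg_ext fun f => by rw [hc f, map_zero])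
  have := congrArg (slice1 (f : Alg n →ₗ[ℂ] ℂ)) hab
  rw [slice1_tmul, slice1_tmul] at this
  exact smul_right_injective _ hf this

lemma tmul_right_injective {n : I → ℕ} {h : Alg n} (hh : h ≠ 0) {a b : Alg n}
    (hab : a ⊗ₜ[ℂ] h = b ⊗ₜ[ℂ] h) : a = b := by
  obtain ⟨f, hf⟩ : ∃ f : coefSub n, (f : Alg n →ₗ[ℂ] ℂ) h ≠ 0 := by
    by_contra! hc
    exact hh (alg_ext fun f => by rw [hc f, map_zero])
  have := congrArg (slice2 (f : Alg n →ₗ[ℂ] ℂ)) hab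
  rw [slice2_tmul, slice2_tmul] at this
  exact smul_right_injective _ hf this

lemma leg1_add {n : I → ℕ} (a b : Alg n) : leg1 (a + b) = leg1 a + leg1 b := by
  funext α β; simp [Matrix.add_kronecker]

lemma leg2_add {n : I → ℕ} (a b : Alg n) : leg2 (a + b) = leg2 a + leg2 b := by
  funext α β; simp [Matrix.kronecker_add]

lemma leg1_smul {n : I → ℕ} (c : ℂ) (a : Alg n) : leg1 (c • a) = c • leg1 a := by
  funext α β; simp [Matrix.smul_kronecker]

lemma leg2_smul {n : I → ℕ} (c : ℂ) (a : Alg n) : leg2 (c • a) = c • leg2 a := by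
  funext α β; simp [Matrix.kronecker_smul]

lemma leg1_zero {n : I → ℕ} : leg1 (0 : Alg n) = 0 := by
  funext α β; simp

lemma leg2_zero {n : I → ℕ} : leg2 (0 : Alg n) = 0 := by
  funext α β; simp

variable [Nonempty I]

lemma Δ_mul_Δ_coint (x : Alg G.n) : G.Δ x * G.Δ G.coint = G.counit x • G.Δ G.coint := by
  rw [← map_mul, mul_coint, map_smul]

lemma Δ_coint_mul_Δ (x : Alg G.n) : G.Δ G.coint * G.Δ x = G.counit x • G.Δ G.coint := by
  rw [← map_mul, coint_mul, map_smul]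

lemma star_Δ_coint : star (G.Δ G.coint) = G.Δ G.coint := by
  rw [← map_star, star_coint]

lemma rTensor_mulLeft_coint (t : Alg G.n ⊗[ℂ] Alg G.n) :
    (LinearMap.mulLeft ℂ G.coint).rTensor (Alg G.n) t = G.coint ⊗ₜ slice1 G.counit t := by
  induction t with
  | zero => simp
  | add t t' ht ht' => simp [TensorProduct.tmul_add, ht, ht']
  | tmul a b => simp [coint_mul, TensorProduct.smul_tmul]

lemma lTensor_mulRight_coint (t : Alg G.n ⊗[ℂ] Alg G.n) :
    (LinearMap.mulRight ℂ G.coint).lTensor (Alg G.n) t = slice2 G.counit t ⊗ₜ G.coint := by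
  induction t with
  | zero => simp
  | add t t' ht ht' => simp [TensorProduct.add_tmul, ht, ht']
  | tmul a b => simp [mul_coint, TensorProduct.smul_tmul]

lemma exists_leg2_eq : ∃ S : Alg G.n → Alg G.n, ∀ a,
    G.Δ G.coint * leg1 a = G.Δ G.coint * leg2 (S a) := by
  suffices h : ∀ a, ∃ b, G.Δ G.coint * leg1 a = G.Δ G.coint * leg2 b by
    choose S hS using h
    exact ⟨S, hS⟩
  intro a
  obtain ⟨t, ht⟩ := exists_star_toMult2 (G.T₂ (star a ⊗ₜ G.coint))
  rw [T₂_spec, star_mul, star_Δ_coint, star_leg1, star_star] at ht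
  have h1 := G.toMult2_T₁_mulLeft G.coint (G.T₁e.symm t)
  rw [T₁_T₁e_symm, ht, ← mul_assoc, Δ_coint_mul_Δ, counit_coint, one_smul, rTensor_mulLeft_coint,
    T₁_spec] at h1
  exact ⟨_, h1.symm⟩

lemma exists_leg1_eq : ∃ S : Alg G.n → Alg G.n, ∀ b,
    leg2 b * G.Δ G.coint = leg1 (S b) * G.Δ G.coint := by
  suffices h : ∀ b, ∃ a, leg2 b * G.Δ G.coint = leg1 a * G.Δ G.coint by
    choose S hS using h
    exact ⟨S, hS⟩
  intro b
  obtain ⟨t, ht⟩ := exists_star_toMult2 (G.T₁ (G.coint ⊗ₜ star b))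
  rw [T₁_spec, star_mul, star_Δ_coint, star_leg2, star_star] at ht
  have h1 := G.toMult2_T₂_mulRight G.coint (G.T₂e.symm t)
  rw [T₂_T₂e_symm, ht, mul_assoc, Δ_mul_Δ_coint, counit_coint, one_smul, lTensor_mulRight_coint,
    T₂_spec] at h1
  exact ⟨_, h1.symm⟩

lemma Δ_coint_leg2_injective {a b : Alg G.n}
    (h : G.Δ G.coint * leg2 a = G.Δ G.coint * leg2 b) : a = b := by
  rw [← T₁_spec, ← T₁_spec] at h
  exact tmul_left_injective G.coint_ne_zero (G.T₁_bijective.1 (toMult2_injective h))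

lemma leg1_Δ_coint_injective {a b : Alg G.n}
    (h : leg1 a * G.Δ G.coint = leg1 b * G.Δ G.coint) : a = b := by
  rw [← T₂_spec, ← T₂_spec] at h
  exact tmul_right_injective G.coint_ne_zero (G.T₂_bijective.1 (toMult2_injective h))

/-- The linear map `S` with `Δ(h)(a ⊗ 1) = Δ(h)(1 ⊗ S(a))`. -/
def antiR : Alg G.n →ₗ[ℂ] Alg G.n where
  toFun := G.exists_leg2_eq.choose
  map_add' a b := by
    apply G.Δ_coint_leg2_injective
    rw [← G.exists_leg2_eq.choose_spec, leg2_add, leg1_add, mul_add, mul_add,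
      G.exists_leg2_eq.choose_spec, G.exists_leg2_eq.choose_spec]
  map_smul' c a := by
    apply G.Δ_coint_leg2_injective
    rw [← G.exists_leg2_eq.choose_spec, RingHom.id_apply, leg2_smul, leg1_smul,
      mul_smul_comm, mul_smul_comm, G.exists_leg2_eq.choose_spec]

/-- The linear map `S'` with `(1 ⊗ a)Δ(h) = (S'(a) ⊗ 1)Δ(h)`. -/
def antiL : Alg G.n →ₗ[ℂ] Alg G.n where
  toFun := G.exists_leg1_eq.choose
  map_add' a b := by
    apply G.leg1_Δ_coint_injective
    rw [← G.exists_leg1_eq.choose_spec, leg2_add, leg1_add, add_mul, add_mul,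
      G.exists_leg1_eq.choose_spec, G.exists_leg1_eq.choose_spec]
  map_smul' c a := by
    apply G.leg1_Δ_coint_injective
    rw [← G.exists_leg1_eq.choose_spec, RingHom.id_apply, leg2_smul, leg1_smul,
      smul_mul_assoc, smul_mul_assoc, G.exists_leg1_eq.choose_spec]

lemma antiR_spec (a : Alg G.n) : G.Δ G.coint * leg1 a = G.Δ G.coint * leg2 (G.antiR a) :=
  G.exists_leg2_eq.choose_spec a

lemma antiL_spec (a : Alg G.n) : leg2 a * G.Δ G.coint = leg1 (G.antiL a) * G.Δ G.coint :=
  G.exists_leg1_eq.choose_spec a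

lemma antiL_star_antiR (a : Alg G.n) : G.antiL (star (G.antiR a)) = star a := by
  apply G.leg1_Δ_coint_injective
  rw [← antiL_spec]
  have := congrArg star (G.antiR_spec a)
  rw [star_mul, star_mul, star_Δ_coint, star_leg1, star_leg2] at this
  exact this.symm

lemma antiR_star_antiL (a : Alg G.n) : G.antiR (star (G.antiL a)) = star a := by
  apply G.Δ_coint_leg2_injective
  rw [← antiR_spec]
  have := congrArg star (G.antiL_spec a)
  rw [star_mul, star_mul, star_Δ_coint, star_leg1, star_leg2] at this
  exact this.symm

lemma antiR_mul (a b : Alg G.n) : G.antiR (a * b) = G.antiR b * G.antiR a := by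
  apply G.Δ_coint_leg2_injective
  rw [← antiR_spec, leg1_mul, ← mul_assoc, antiR_spec, mul_assoc, leg2_mul_leg1, ← leg1_mul_leg2,
    ← mul_assoc, antiR_spec, mul_assoc, leg2_mul]

lemma antiL_mul (a b : Alg G.n) : G.antiL (a * b) = G.antiL b * G.antiL a := by
  apply G.leg1_Δ_coint_injective
  rw [← antiL_spec, leg2_mul, mul_assoc, antiL_spec, ← mul_assoc, leg2_mul_leg1, ← leg1_mul_leg2,
    mul_assoc, antiL_spec, ← mul_assoc, leg1_mul]

/-- `antiR` as a linear equivalence. -/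
def antiRe : Alg G.n ≃ₗ[ℂ] Alg G.n :=
  LinearEquiv.ofBijective G.antiR ⟨by
    intro a b h
    have := congrArg (fun z => G.antiL (star z)) h
    simpa [antiL_star_antiR] using this, fun b => ⟨star (G.antiL (star b)), by
      rw [antiR_star_antiL, star_star]⟩⟩

lemma antiL_surjective : Function.Surjective G.antiL := fun b =>
  ⟨star (G.antiR (star b)), by rw [antiL_star_antiR, star_star]⟩

lemma antiR_surjective : Function.Surjective G.antiR := G.antiRe.surjective

lemma mul'_antiR_T₁ (a b : Alg G.n) :
    LinearMap.mul' ℂ (Alg G.n) (G.antiR.rTensor (Alg G.n) (G.T₁ (a ⊗ₜ b))) =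
      G.counit a • b := by
  have key : ∀ t, G.Δ G.coint * leg2 (LinearMap.mul' ℂ (Alg G.n) (G.antiR.rTensor (Alg G.n) t)) =
      G.Δ G.coint * toMult2 t := by
    intro t
    induction t with
    | zero => simp [leg2_zero]
    | add t t' ht ht' => simp only [map_add, leg2_add, mul_add, ht, ht']
    | tmul x y =>
      rw [LinearMap.rTensor_tmul, LinearMap.mul'_apply, leg2_mul, ← mul_assoc, ← antiR_spec,
        mul_assoc, leg1_mul_leg2]
  apply G.Δ_coint_leg2_injective
  rw [key, T₁_spec, ← mul_assoc, Δ_coint_mul_Δ, leg2_smul, smul_mul_assoc, mul_smul_comm]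

lemma mul'_antiL_T₂ (a b : Alg G.n) :
    LinearMap.mul' ℂ (Alg G.n) (G.antiL.lTensor (Alg G.n) (G.T₂ (a ⊗ₜ b))) =
      G.counit b • a := by
  have key : ∀ t, leg1 (LinearMap.mul' ℂ (Alg G.n) (G.antiL.lTensor (Alg G.n) t)) * G.Δ G.coint =
      toMult2 t * G.Δ G.coint := by
    intro t
    induction t with
    | zero => simp [leg1_zero]
    | add t t' ht ht' => simp only [map_add, leg1_add, add_mul, ht, ht']
    | tmul x y =>
      rw [LinearMap.lTensor_tmul, LinearMap.mul'_apply, leg1_mul, mul_assoc, ← antiL_spec,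
        ← mul_assoc, leg1_mul_leg2]
  apply G.leg1_Δ_coint_injective
  rw [key, T₂_spec, mul_assoc, Δ_mul_Δ_coint, leg1_smul, smul_mul_assoc, mul_smul_comm]

end antipode

end DiscreteQuantumGroup

end QGrp

/-! ### Properties of the antipode -/

namespace QGrp

/-- To prove a property of all elements of `R`, it is enough to check the matrix coefficients. -/
lemma coef_induction {I : Type u} {n : I → ℕ} {P : coefSub n → Prop}
    (mcoef : ∀ α i j, P (mcoef n α i j)) (zero : P 0) (add : ∀ f g, P f → P g → P (f + g))
    (smul : ∀ (c : ℂ) f, P f → P (c • f)) (f : coefSub n) : P f := by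
  obtain ⟨F, hF⟩ := f.2
  have hsum : ∀ {ι : Type u} (s : Finset ι) (g : ι → coefSub n), (∀ i ∈ s, P (g i)) →
      P (∑ i ∈ s, g i) := fun s g h => Finset.sum_induction g P add zero h
  have hsum' : ∀ {k : ℕ} (g : Fin k → coefSub n), (∀ i, P (g i)) →
      P (∑ i, g i) := fun g h => Finset.sum_induction g P add zero fun i _ => h i
  rw [coef_eq_sum f hF]
  exact hsum _ _ fun γ _ => hsum' _ fun p => hsum' _ fun q => smul _ _ (mcoef _ _ _)

/-- The functional `f^*(x) = conj f(x^*)`. -/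
def cstar {I : Type u} {n : I → ℕ} : coefSub n →ₗ⋆[ℂ] coefSub n where
  toFun f := ⟨{ toFun := fun x => star ((f : Alg n →ₗ[ℂ] ℂ) (star x))
                map_add' := fun x y => by simp
                map_smul' := fun c x => by simp }, by
    obtain ⟨F, hF⟩ := f.2
    refine ⟨F, fun γ hγ p q => ?_⟩
    change star ((f : Alg n →ₗ[ℂ] ℂ) (star (unit n γ p q))) = 0
    rw [star_unit, hF γ hγ, star_zero]⟩
  map_add' f g := coef_ext fun x => by
    change star ((f : Alg n →ₗ[ℂ] ℂ) (star x) + (g : Alg n →ₗ[ℂ] ℂ) (star x)) =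
      star ((f : Alg n →ₗ[ℂ] ℂ) (star x)) + star ((g : Alg n →ₗ[ℂ] ℂ) (star x))
    rw [star_add]
  map_smul' c f := coef_ext fun x => by
    change star (c * (f : Alg n →ₗ[ℂ] ℂ) (star x)) =
      star c * star ((f : Alg n →ₗ[ℂ] ℂ) (star x))
    rw [star_mul, mul_comm]

@[simp] lemma cstar_apply {I : Type u} {n : I → ℕ} (f : coefSub n) (x : Alg n) :
    (cstar f : Alg n →ₗ[ℂ] ℂ) x = star ((f : Alg n →ₗ[ℂ] ℂ) (star x)) := rfl

@[simp] lemma cstar_mcoef {I : Type u} {n : I → ℕ} (α : I) (i j : Fin (n α)) :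
    cstar (mcoef n α i j) = mcoef n α j i := by
  refine coef_ext fun x => ?_
  simp [Matrix.star_apply]

@[simp] lemma cstar_cstar {I : Type u} {n : I → ℕ} (f : coefSub n) : cstar (cstar f) = f :=
  coef_ext fun x => by simp

/-- The functional `f ∘ S`, for an antimultiplicative surjection `S` of `A₀`. -/
def compAnti {I : Type u} {n : I → ℕ} (S : Alg n →ₗ[ℂ] Alg n)
    (hmul : ∀ a b, S (a * b) = S b * S a) (hS : Function.Surjective S) :
    coefSub n →ₗ[ℂ] coefSub n where
  toFun f := ⟨(f : Alg n →ₗ[ℂ] ℂ) ∘ₗ S, by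
    obtain ⟨F, hF⟩ := exists_local_unit f
    obtain ⟨p, hp⟩ := hS (proj n F)
    obtain ⟨F', hF'⟩ := exists_supp p
    refine ⟨F', fun γ hγ k l => ?_⟩
    have : unit n γ k l * p = 0 := by
      apply Subtype.ext
      funext β
      by_cases h : β = γ
      · subst h; simp [hF' β hγ]
      · simp [unit_of_ne h]
    rw [LinearMap.comp_apply, ← (hF F subset_rfl).1, compL_apply, lmul_alg, ← hp, ← hmul, this,
      map_zero, map_zero]⟩
  map_add' f g := coef_ext fun x => rfl
  map_smul' c f := coef_ext fun x => rfl

namespace DiscreteQuantumGroup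

variable {I : Type u} (G : DiscreteQuantumGroup I)

lemma cstar_cmul (f g : coefSub G.n) : cstar (G.cmul f g) = G.cmul (cstar f) (cstar g) := by
  induction f using coef_induction with
  | zero => simp
  | add f f' hf hf' => simp [hf, hf']
  | smul c f hf => simp [hf]
  | mcoef α i j =>
    induction g using coef_induction with
    | zero => simp
    | add f f' hf hf' => simp [hf, hf']
    | smul c f hf => simp [hf]
    | mcoef β k l =>
      refine coef_ext fun x => ?_
      have h : G.Δ (star x) = star (G.Δ x) := map_star _ _
      rw [cstar_apply, cmul_apply, pair2_mcoef, cstar_mcoef, cstar_mcoef, cmul_apply, pair2_mcoef, h]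
      simp [Matrix.star_apply]

lemma exists_Δ_proj (α β : I) : ∃ F : Finset I, ∀ F', F ⊆ F' →
    G.Δ (proj G.n F') α β = 1 := by
  classical
  have key : ∀ s, ∃ F : Finset I, ∀ F', F ⊆ F' →
      toMult2 (G.T₂ s) * G.Δ (proj G.n F') = toMult2 (G.T₂ s) := by
    intro s
    induction s with
    | zero => exact ⟨∅, by simp⟩
    | add s t hs ht =>
      obtain ⟨F, hF⟩ := hs
      obtain ⟨F', hF'⟩ := ht
      refine ⟨F ∪ F', fun F'' h => ?_⟩
      rw [map_add, map_add, add_mul, hF F'' (Finset.union_subset_left h),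
        hF' F'' (Finset.union_subset_right h)]
    | tmul a b =>
      obtain ⟨F, hF⟩ := exists_supp b
      refine ⟨F, fun F' h => ?_⟩
      rw [T₂_spec, mul_assoc, ← map_mul, mul_proj fun γ hγ => hF γ fun hc => hγ (h hc)]
  obtain ⟨s, hs⟩ := G.T₂_bijective.2 (proj G.n {α} ⊗ₜ proj G.n {β})
  obtain ⟨F, hF⟩ := key s
  refine ⟨F, fun F' h => ?_⟩
  have := congrFun (congrFun (hF F' h) α) β
  rw [hs] at this
  simpa [proj_of_mem] using this

variable [Nonempty I]

lemma sum_cmul_antiR (α : I) (i j : Fin (G.n α)) :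
    ∑ k, G.cmul (compAnti G.antiR G.antiR_mul G.antiR_surjective (mcoef G.n α i k))
      (mcoef G.n α k j) = if i = j then G.cone else 0 := by
  refine coef_ext fun x => ?_
  have h1 : ∀ k, compR (proj G.n {α} : Mult G.n) (mcoef G.n α k j) = mcoef G.n α k j :=
    fun k => coef_ext fun x => by simp [proj_of_mem]
  have h2 : ∀ t, ∑ k, (G.antiR (slice2 (mcoef G.n α k j : Alg G.n →ₗ[ℂ] ℂ) t) : Mult G.n) α i k =
      (LinearMap.mul' ℂ (Alg G.n) (G.antiR.rTensor (Alg G.n) t) : Mult G.n) α i j := by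
    intro t
    induction t with
    | zero => simp
    | add t t' ht ht' => simp [Finset.sum_add_distrib, ht, ht']
    | tmul a b => simp [Matrix.mul_apply, mul_comm]
  have h3 : ((∑ k, G.cmul (compAnti G.antiR G.antiR_mul G.antiR_surjective (mcoef G.n α i k))
      (mcoef G.n α k j) : coefSub G.n) : Alg G.n →ₗ[ℂ] ℂ) x =
      ∑ k, (G.antiR (slice2 (mcoef G.n α k j : Alg G.n →ₗ[ℂ] ℂ)
        (G.T₁ (x ⊗ₜ proj G.n {α}))) : Mult G.n) α i k := by
    simp only [AddSubmonoidClass.coe_finsetSum, LinearMap.sum_apply]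
    refine Finset.sum_congr rfl fun k _ => ?_
    rw [← apply_lact, G.slice2_T₁ (h1 k)]
    rfl
  rw [h3, h2, mul'_antiR_T₁]
  split_ifs with h <;> simp [proj_of_mem, h]

lemma sum_cmul_antiL (α : I) (i j : Fin (G.n α)) :
    ∑ k, G.cmul (mcoef G.n α i k) (compAnti G.antiL G.antiL_mul G.antiL_surjective
      (mcoef G.n α k j)) = if i = j then G.cone else 0 := by
  refine coef_ext fun x => ?_
  have h1 : ∀ k, compL (proj G.n {α} : Mult G.n) (mcoef G.n α i k) = mcoef G.n α i k :=
    fun k => coef_ext fun x => by simp [proj_of_mem]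
  have h2 : ∀ t, ∑ k, (G.antiL (slice1 (mcoef G.n α i k : Alg G.n →ₗ[ℂ] ℂ) t) : Mult G.n) α k j =
      (LinearMap.mul' ℂ (Alg G.n) (G.antiL.lTensor (Alg G.n) t) : Mult G.n) α i j := by
    intro t
    induction t with
    | zero => simp
    | add t t' ht ht' => simp [Finset.sum_add_distrib, ht, ht']
    | tmul a b => simp [Matrix.mul_apply]
  have h3 : ((∑ k, G.cmul (mcoef G.n α i k) (compAnti G.antiL G.antiL_mul G.antiL_surjective
      (mcoef G.n α k j)) : coefSub G.n) : Alg G.n →ₗ[ℂ] ℂ) x =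
      ∑ k, (G.antiL (slice1 (mcoef G.n α i k : Alg G.n →ₗ[ℂ] ℂ)
        (G.T₂ (proj G.n {α} ⊗ₜ x))) : Mult G.n) α k j := by
    simp only [AddSubmonoidClass.coe_finsetSum, LinearMap.sum_apply]
    refine Finset.sum_congr rfl fun k _ => ?_
    rw [← apply_ract, G.slice1_T₂ (h1 k)]
    rfl
  rw [h3, h2, mul'_antiL_T₂]
  split_ifs with h <;> simp [proj_of_mem, h]

/-- The two candidates for the antipode are a left and a right convolution inverse. -/
lemma antiR_eq_antiL : G.antiR = G.antiL := by
  ext1 x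
  apply Subtype.ext
  funext α
  ext i j
  have := G.cmul_inv_unique (G.sum_cmul_antiR α) (G.sum_cmul_antiL α)
  exact congrArg (fun f : coefSub G.n => (f : Alg G.n →ₗ[ℂ] ℂ) x) (congrFun (congrFun this i) j)

lemma isAntipode_antiRe : G.IsAntipode G.antiRe := fun a b =>
  ⟨G.mul'_antiR_T₁ a b, by
    have : G.antiRe.toLinearMap = G.antiL := G.antiR_eq_antiL
    rw [this]
    exact G.mul'_antiL_T₂ a b⟩

lemma S_spec : G.IsAntipode G.S :=
  haveI : Nonempty (Alg G.n ≃ₗ[ℂ] Alg G.n) := ⟨LinearEquiv.refl ℂ _⟩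
  Classical.epsilon_spec ⟨_, G.isAntipode_antiRe⟩

lemma S_eq_antiR (x : Alg G.n) : G.S x = G.antiR x := by
  have h : LinearMap.mul' ℂ (Alg G.n) ∘ₗ G.S.toLinearMap.rTensor (Alg G.n) =
      LinearMap.mul' ℂ (Alg G.n) ∘ₗ G.antiR.rTensor (Alg G.n) := by
    have : (LinearMap.mul' ℂ (Alg G.n) ∘ₗ G.S.toLinearMap.rTensor (Alg G.n)) ∘ₗ G.T₁ =
        (LinearMap.mul' ℂ (Alg G.n) ∘ₗ G.antiR.rTensor (Alg G.n)) ∘ₗ G.T₁ :=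
      TensorProduct.ext' fun a b => (G.S_spec a b).1.trans (G.mul'_antiR_T₁ a b).symm
    refine LinearMap.ext fun t => ?_
    obtain ⟨s, rfl⟩ := G.T₁_bijective.2 t
    exact LinearMap.congr_fun this s
  apply Subtype.ext
  funext α
  have := congrArg (fun z : Alg G.n => (z : Mult G.n) α)
    (LinearMap.congr_fun h (x ⊗ₜ proj G.n {α}))
  simpa [proj_of_mem] using this

lemma S_mul (a b : Alg G.n) : G.S (a * b) = G.S b * G.S a := by
  simp only [S_eq_antiR, antiR_mul]

lemma S_symm_mul (a b : Alg G.n) : G.S.symm (a * b) = G.S.symm b * G.S.symm a := by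
  apply G.S.injective
  simp [S_mul]

lemma Δ_coint_mul_leg1 (a : Alg G.n) : G.Δ G.coint * leg1 a = G.Δ G.coint * leg2 (G.S a) := by
  rw [S_eq_antiR, antiR_spec]

lemma leg2_mul_Δ_coint (a : Alg G.n) : leg2 a * G.Δ G.coint = leg1 (G.S a) * G.Δ G.coint := by
  rw [S_eq_antiR, antiR_eq_antiL, antiL_spec]

lemma S_star_S (a : Alg G.n) : G.S (star (G.S a)) = star a := by
  have := G.antiL_star_antiR a
  rw [← antiR_eq_antiL] at this
  rw [S_eq_antiR, S_eq_antiR, this]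

/-- The antipode of `R`: `f ↦ f ∘ S`. -/
def Sd : coefSub G.n →ₗ[ℂ] coefSub G.n := compAnti G.S.toLinearMap G.S_mul G.S.surjective

/-- The inverse of the antipode of `R`: `f ↦ f ∘ S⁻¹`. -/
def SdInv : coefSub G.n →ₗ[ℂ] coefSub G.n :=
  compAnti G.S.symm.toLinearMap G.S_symm_mul G.S.symm.surjective

@[simp] lemma Sd_apply (f : coefSub G.n) (x : Alg G.n) :
    (G.Sd f : Alg G.n →ₗ[ℂ] ℂ) x = (f : Alg G.n →ₗ[ℂ] ℂ) (G.S x) := rfl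

@[simp] lemma SdInv_apply (f : coefSub G.n) (x : Alg G.n) :
    (G.SdInv f : Alg G.n →ₗ[ℂ] ℂ) x = (f : Alg G.n →ₗ[ℂ] ℂ) (G.S.symm x) := rfl

@[simp] lemma Sd_SdInv (f : coefSub G.n) : G.Sd (G.SdInv f) = f := coef_ext fun x => by simp

lemma compAnti_antiR (f : coefSub G.n) :
    compAnti G.antiR G.antiR_mul G.antiR_surjective f = G.Sd f :=
  coef_ext fun x => congrArg (f : Alg G.n →ₗ[ℂ] ℂ) (G.S_eq_antiR x).symm

lemma compAnti_antiL (f : coefSub G.n) :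
    compAnti G.antiL G.antiL_mul G.antiL_surjective f = G.Sd f :=
  coef_ext fun x => congrArg (f : Alg G.n →ₗ[ℂ] ℂ) (by
    rw [← antiR_eq_antiL]; exact (G.S_eq_antiR x).symm)

lemma sum_Sd_cmul (α : I) (i j : Fin (G.n α)) :
    ∑ k, G.cmul (G.Sd (mcoef G.n α i k)) (mcoef G.n α k j) = if i = j then G.cone else 0 := by
  simp_rw [← compAnti_antiR, sum_cmul_antiR]

lemma sum_cmul_Sd (α : I) (i j : Fin (G.n α)) :
    ∑ k, G.cmul (mcoef G.n α i k) (G.Sd (mcoef G.n α k j)) = if i = j then G.cone else 0 := by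
  simp_rw [← compAnti_antiL, sum_cmul_antiL]

omit [Nonempty I] in
lemma sum_apply_slice2 {n : I → ℕ} {κ : Type*} [Fintype κ] {f : Alg n →ₗ[ℂ] ℂ}
    {A B : κ → Alg n →ₗ[ℂ] ℂ} {S : Alg n →ₗ[ℂ] Alg n}
    (h : ∀ x y, f (x * y) = ∑ z, A z x * B z y) (t : Alg n ⊗[ℂ] Alg n) :
    ∑ z, A z (S (slice2 (B z) t)) = f (LinearMap.mul' ℂ (Alg n) (S.rTensor (Alg n) t)) := by
  induction t with
  | zero => simp
  | add t t' ht ht' => simp only [map_add, Finset.sum_add_distrib, ht, ht']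
  | tmul a b =>
    rw [LinearMap.rTensor_tmul, LinearMap.mul'_apply, h]
    refine Finset.sum_congr rfl fun z _ => ?_
    rw [slice2_tmul, map_smul, map_smul, smul_eq_mul, mul_comm]

lemma sum_Sd_cmul_prod (α β : I) (x y : Fin (G.n α) × Fin (G.n β)) :
    ∑ z : Fin (G.n α) × Fin (G.n β), G.cmul
      (G.Sd (G.cmul (mcoef G.n α x.1 z.1) (mcoef G.n β x.2 z.2)))
      (G.cmul (mcoef G.n α z.1 y.1) (mcoef G.n β z.2 y.2)) = if x = y then G.cone else 0 := by
  obtain ⟨F, hF⟩ := G.exists_Δ_proj α β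
  have hF := hF F subset_rfl
  refine coef_ext fun a => ?_
  have h1 : ∀ z : Fin (G.n α) × Fin (G.n β), compR (proj G.n F : Mult G.n)
      (G.cmul (mcoef G.n α z.1 y.1) (mcoef G.n β z.2 y.2)) =
      G.cmul (mcoef G.n α z.1 y.1) (mcoef G.n β z.2 y.2) := by
    refine fun z => coef_ext fun b => ?_
    rw [compR_apply, rmul_alg, cmul_apply, pair2_mcoef, cmul_apply, pair2_mcoef, map_mul,
      Pi.mul_apply, Pi.mul_apply, hF, mul_one]
  have h2 : ∀ t, ∑ z : Fin (G.n α) × Fin (G.n β),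
      (G.cmul (mcoef G.n α x.1 z.1) (mcoef G.n β x.2 z.2) : Alg G.n →ₗ[ℂ] ℂ)
        (G.S (slice2 (G.cmul (mcoef G.n α z.1 y.1) (mcoef G.n β z.2 y.2) : Alg G.n →ₗ[ℂ] ℂ) t)) =
      (G.cmul (mcoef G.n α x.1 y.1) (mcoef G.n β x.2 y.2) : Alg G.n →ₗ[ℂ] ℂ)
        (LinearMap.mul' ℂ (Alg G.n) (G.S.toLinearMap.rTensor (Alg G.n) t)) := by
    refine fun t => sum_apply_slice2 (S := G.S.toLinearMap) (fun x' y' => ?_) t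
    rw [cmul_mcoef_mul, Fintype.sum_prod_type]
  have h3 : ((∑ z : Fin (G.n α) × Fin (G.n β), G.cmul
      (G.Sd (G.cmul (mcoef G.n α x.1 z.1) (mcoef G.n β x.2 z.2)))
      (G.cmul (mcoef G.n α z.1 y.1) (mcoef G.n β z.2 y.2)) : coefSub G.n) : Alg G.n →ₗ[ℂ] ℂ) a =
      ∑ z : Fin (G.n α) × Fin (G.n β),
      (G.cmul (mcoef G.n α x.1 z.1) (mcoef G.n β x.2 z.2) : Alg G.n →ₗ[ℂ] ℂ)
        (G.S (slice2 (G.cmul (mcoef G.n α z.1 y.1) (mcoef G.n β z.2 y.2) : Alg G.n →ₗ[ℂ] ℂ)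
          (G.T₁ (a ⊗ₜ proj G.n F)))) := by
    simp only [AddSubmonoidClass.coe_finsetSum, LinearMap.sum_apply]
    refine Finset.sum_congr rfl fun k _ => ?_
    rw [← apply_lact, G.slice2_T₁ (h1 k)]
    rfl
  rw [h3, h2, (G.S_spec _ _).1, map_smul, cmul_apply, pair2_mcoef, hF]
  split_ifs with h
  · subst h
    rw [Matrix.one_apply_eq]
    simp
  · simp [h]

lemma Sd_cmul (f g : coefSub G.n) : G.Sd (G.cmul f g) = G.cmul (G.Sd g) (G.Sd f) := by
  have key : ∀ α i j β k l, G.Sd (G.cmul (mcoef G.n α i j) (mcoef G.n β k l)) =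
      G.cmul (G.Sd (mcoef G.n β k l)) (G.Sd (mcoef G.n α i j)) := by
    intro α i j β k l
    have h := G.cmul_inv_unique (κ := Fin (G.n α) × Fin (G.n β))
      (A := fun x y => G.Sd (G.cmul (mcoef G.n α x.1 y.1) (mcoef G.n β x.2 y.2)))
      (B := fun x y => G.cmul (mcoef G.n α x.1 y.1) (mcoef G.n β x.2 y.2))
      (C := fun x y => G.cmul (G.Sd (mcoef G.n β x.2 y.2)) (G.Sd (mcoef G.n α x.1 y.1)))
      (G.sum_Sd_cmul_prod α β) (by
        intro x y
        have h1 : ∀ p q, G.cmul (G.cmul (mcoef G.n α x.1 p) (mcoef G.n β x.2 q))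
            (G.cmul (G.Sd (mcoef G.n β q y.2)) (G.Sd (mcoef G.n α p y.1))) =
            G.cmul (mcoef G.n α x.1 p) (G.cmul (G.cmul (mcoef G.n β x.2 q)
              (G.Sd (mcoef G.n β q y.2))) (G.Sd (mcoef G.n α p y.1))) := by
          intro p q
          simp only [cmul_assoc]
        rw [Fintype.sum_prod_type]
        simp_rw [h1, ← map_sum, ← LinearMap.sum_apply, ← map_sum, sum_cmul_Sd]
        by_cases h : x.2 = y.2
        · simp only [h, if_true, cone_cmul, sum_cmul_Sd, Prod.ext_iff, and_true]
        · simp [h, Prod.ext_iff])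
    exact congrFun (congrFun h (i, k)) (j, l)
  have : G.cmul.compr₂ G.Sd = (G.cmul.flip.compl₁₂ G.Sd G.Sd) :=
    coef_hom_ext₂ fun α i j β k l => key α i j β k l
  exact LinearMap.congr_fun₂ this f g

lemma Sd_cone : G.Sd G.cone = G.cone := by
  have := G.Sd_cmul (G.SdInv G.cone) G.cone
  rw [cmul_cone, Sd_SdInv, cmul_cone] at this
  exact this.symm

lemma counit_S (x : Alg G.n) : G.counit (G.S x) = G.counit x :=
  congrArg (fun f : coefSub G.n => (f : Alg G.n →ₗ[ℂ] ℂ) x) G.Sd_cone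

lemma S_coint : G.S G.coint = G.coint := by
  have h1 : G.coint * G.S G.coint = G.coint := by
    rw [coint_mul, counit_S, counit_coint, one_smul]
  have h2 : G.S (G.coint * G.S.symm G.coint) = G.coint * G.S G.coint := by
    rw [S_mul, LinearEquiv.apply_symm_apply]
  rw [coint_mul, ← counit_S, LinearEquiv.apply_symm_apply, counit_coint, one_smul, h1] at h2
  exact h2

omit [Nonempty I] in
lemma star_ract (x : Alg G.n) (f : coefSub G.n) :
    star (G.ract x f) = G.ract (star x) (cstar f) := by
  refine alg_ext fun g => ?_
  have h : (g : Alg G.n →ₗ[ℂ] ℂ) (star (G.ract x f)) =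
      star ((cstar g : Alg G.n →ₗ[ℂ] ℂ) (G.ract x f)) := by simp
  rw [h, apply_ract, apply_ract]
  have h' := G.cstar_cmul f (cstar g)
  rw [cstar_cstar] at h'
  rw [← h', cstar_apply, star_star]

/-- `S` exchanges the two actions of `R` on `A₀`. -/
lemma S_lact (x : Alg G.n) (f : coefSub G.n) :
    G.S (G.lact x f) = G.ract (G.S x) (G.SdInv f) := by
  refine alg_ext fun g => ?_
  rw [apply_ract, ← Sd_apply, apply_lact]
  conv_rhs => rw [← Sd_apply, Sd_cmul, Sd_SdInv]

end DiscreteQuantumGroup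

end QGrp

/-! ### Invariant functionals -/

namespace QGrp

section pairing

variable {I : Type u} {n : I → ℕ}

lemma ev_mul_left (m m' : Mult n) (f : coefSub n) :
    ev (V := ℂ) (m * m' : Mult n) f = ev (V := ℂ) m' (compL m f) := by
  have : ev (V := ℂ) (m * m' : Mult n) = (ev (V := ℂ) m').comp (compL m) := by
    apply coef_hom_ext
    intro α i j
    simp [compL_mcoef, Matrix.mul_apply]
  rw [this]
  rfl

lemma ev_mul_right (m m' : Mult n) (f : coefSub n) :
    ev (V := ℂ) (m * m' : Mult n) f = ev (V := ℂ) m (compR m' f) := by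
  have : ev (V := ℂ) (m * m' : Mult n) = (ev (V := ℂ) m).comp (compR m') := by
    apply coef_hom_ext
    intro α i j
    simp [compR_mcoef, Matrix.mul_apply, mul_comm]
  rw [this]
  rfl

lemma ev_one_of_local_unit {p : Alg n} {f : coefSub n} (hf : compL (p : Mult n) f = f) :
    ev (V := ℂ) (1 : Mult n) f = (f : Alg n →ₗ[ℂ] ℂ) p := by
  rw [← ev_coe, ← mul_one (p : Mult n), ev_mul_left, hf]

@[simp] lemma ev_one_mcoef (α : I) (i j : Fin (n α)) :
    ev (V := ℂ) (1 : Mult n) (mcoef n α i j) = if i = j then 1 else 0 := by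
  rw [ev_mcoef]
  simp [Matrix.one_apply]

lemma ev_one_compL (a : Alg n) (f : coefSub n) :
    ev (V := ℂ) (1 : Mult n) (compL (a : Mult n) f) = (f : Alg n →ₗ[ℂ] ℂ) a := by
  rw [← ev_mul_left, mul_one, ev_coe]

lemma ev_one_compR (a : Alg n) (f : coefSub n) :
    ev (V := ℂ) (1 : Mult n) (compR (a : Mult n) f) = (f : Alg n →ₗ[ℂ] ℂ) a := by
  rw [← ev_mul_right, one_mul, ev_coe]

/-- The functional `x ↦ φ(a x)`, an element of `R`. -/
def phiL (φ : Alg n →ₗ[ℂ] ℂ) : Alg n →ₗ[ℂ] coefSub n where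
  toFun a := ⟨φ ∘ₗ lmul (a : Mult n), by
    obtain ⟨F, hF⟩ := exists_supp a
    refine ⟨F, fun γ hγ p q => ?_⟩
    have : lmul (a : Mult n) (unit n γ p q) = 0 := by
      apply Subtype.ext
      funext β
      by_cases h : β = γ
      · subst h; simp [hF β hγ]
      · simp [unit_of_ne h]
    rw [LinearMap.comp_apply, this, map_zero]⟩
  map_add' a b := coef_ext fun x => by
    change φ ((a + b) * x) = φ (a * x) + φ (b * x)
    rw [add_mul, map_add]
  map_smul' c a := coef_ext fun x => by
    change φ ((c • a) * x) = c * φ (a * x)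
    rw [smul_mul_assoc, map_smul, smul_eq_mul]

@[simp] lemma phiL_apply (φ : Alg n →ₗ[ℂ] ℂ) (a x : Alg n) :
    (phiL φ a : Alg n →ₗ[ℂ] ℂ) x = φ (a * x) := rfl

lemma ev_phiL (φ : Alg n →ₗ[ℂ] ℂ) (m : Mult n) (a : Alg n) :
    ev (V := ℂ) m (phiL φ a) = φ (rmul m a) := by
  obtain ⟨F, hF⟩ := exists_supp a
  have h1 : compL (proj n F : Mult n) (phiL φ a) = phiL φ a := coef_ext fun x => by
    rw [compL_apply, phiL_apply, phiL_apply, lmul_alg, ← mul_assoc, mul_proj hF]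
  have h2 : a * rmul m (proj n F) = rmul m a := by
    rw [mul_rmul, mul_proj hF]
  rw [← h1, ← ev_mul_left]
  exact (ev_coe (rmul m (proj n F)) (phiL φ a)).trans (by rw [phiL_apply, h2])

open scoped MatrixOrder in
/-- A matrix has at most one positive semidefinite square root. -/
lemma posSemidef_eq_of_mul_self_eq {m : Type*} [Fintype m] [DecidableEq m] {A B : Matrix m m ℂ}
    (hA : A.PosSemidef) (hB : B.PosSemidef) (h : A * A = B * B) : A = B :=
  (CFC.sqrt_unique h hA.nonneg).symm.trans (CFC.sqrt_unique rfl hB.nonneg)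

open scoped MatrixOrder in
lemma exists_conjTranspose_mul_self {m : Type*} [Fintype m] [DecidableEq m] {A : Matrix m m ℂ}
    (hA : A.PosSemidef) : ∃ B : Matrix m m ℂ, A = star B * B :=
  CStarAlgebra.nonneg_iff_eq_star_mul_self.mp hA.nonneg

end pairing

namespace DiscreteQuantumGroup

variable {I : Type u} {G : DiscreteQuantumGroup I} {φ : Alg G.n →ₗ[ℂ] ℂ}

lemma IsLeftHaar.nonempty (hφ : G.IsLeftHaar φ) : Nonempty I := by
  by_contra h
  rw [not_nonempty_iff] at h
  exact hφ.ne_zero (LinearMap.ext fun x => by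
    rw [Subsingleton.elim x 0, map_zero, map_zero])

/-- Left invariance, in terms of the action of `R`. -/
def LeftInv (G : DiscreteQuantumGroup I) (κ : Alg G.n →ₗ[ℂ] ℂ) : Prop :=
  ∀ x f, κ (G.ract x f) = ev (V := ℂ) (1 : Mult G.n) f * κ x

lemma IsLeftHaar.leftInv (hφ : G.IsLeftHaar φ) : G.LeftInv φ := by
  intro x f
  obtain ⟨F, hF⟩ := exists_local_unit f
  have hf := (hF F subset_rfl).1
  rw [ev_one_of_local_unit hf, ← G.slice1_T₂ hf, slice1_slice2]
  have : slice2 φ (G.T₂ (proj G.n F ⊗ₜ x)) = φ x • proj G.n F := hφ.left_inv x _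
  rw [this, map_smul, smul_eq_mul, mul_comm]

section invariant

variable [Nonempty I]

variable (G) in
lemma mul_ract_coint (a : Alg G.n) (f : coefSub G.n) :
    a * G.ract G.coint f = G.ract G.coint (compL (G.S a : Mult G.n) f) := by
  refine alg_ext fun g => ?_
  have h : (g : Alg G.n →ₗ[ℂ] ℂ) (a * G.ract G.coint f) =
    (compL (a : Mult G.n) g : Alg G.n →ₗ[ℂ] ℂ) (G.ract G.coint f) := rfl
  rw [h, apply_ract, apply_ract, cmul_apply, cmul_apply, ← pair2_leg2_mul, leg2_mul_Δ_coint,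
    pair2_leg1_mul]

variable (G) in
lemma ract_coint_mul (b : Alg G.n) (f : coefSub G.n) :
    G.ract G.coint f * G.S b = G.ract G.coint (compR (b : Mult G.n) f) := by
  refine alg_ext fun g => ?_
  have h : (g : Alg G.n →ₗ[ℂ] ℂ) (G.ract G.coint f * G.S b) =
    (compR (G.S b : Mult G.n) g : Alg G.n →ₗ[ℂ] ℂ) (G.ract G.coint f) := rfl
  rw [h, apply_ract, apply_ract, cmul_apply, cmul_apply, ← pair2_mul_leg2, ← Δ_coint_mul_leg1,
    pair2_mul_leg1]

variable (G) in
/-- The right legs of `Δ(h)` exhaust `A₀`: they form a two-sided ideal that meets every block. -/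
lemma exists_eq_ract_coint (x : Alg G.n) : ∃ f, G.ract G.coint f = x := by
  let J : Submodule ℂ (Alg G.n) := LinearMap.range (G.ract G.coint)
  have hl : ∀ a, ∀ y ∈ J, a * y ∈ J := by
    rintro a y ⟨f, rfl⟩
    exact ⟨_, (G.mul_ract_coint a f).symm⟩
  have hr : ∀ a, ∀ y ∈ J, y * a ∈ J := by
    rintro a y ⟨f, rfl⟩
    refine ⟨_, (G.ract_coint_mul (G.S.symm a) f).symm.trans ?_⟩
    rw [LinearEquiv.apply_symm_apply]
  have hu : ∀ γ p q, unit G.n γ p q ∈ J := by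
    intro γ p q
    obtain ⟨y, hy, k, l, hkl⟩ : ∃ y ∈ J, ∃ k l, (y : Mult G.n) γ k l ≠ 0 := by
      by_contra! hc
      have h1 : G.Δ G.coint * leg2 (proj G.n {γ}) = G.Δ G.coint * leg2 0 := by
        refine pair2_ext fun f g => ?_
        rw [leg2_zero, mul_zero, pair2_zero, pair2_mul_leg2, ← cmul_apply, ← apply_ract,
          compR_apply, rmul_alg]
        have : G.ract G.coint f * proj G.n {γ} = 0 := by
          apply Subtype.ext
          funext β
          by_cases h : β = γ
          · subst h
            ext k l
            simp [proj_of_mem, hc _ ⟨f, rfl⟩]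
          · simp [proj_of_notMem (n := G.n) (F := {γ}) (γ := β) (by simpa using h)]
        rw [this, map_zero]
        rfl
      have h2 := congrArg (fun z : Alg G.n => (z : Mult G.n) γ p p) (G.Δ_coint_leg2_injective h1)
      simp [proj_of_mem] at h2
    have h3 := J.smul_mem ((y : Mult G.n) γ k l)⁻¹
      (hr (unit G.n γ l q) _ (hl (unit G.n γ p k) y hy))
    rwa [unit_mul_mul_unit, smul_smul, inv_mul_cancel₀ hkl, one_smul] at h3
  obtain ⟨F, hF⟩ := exists_supp x
  rw [eq_sum_unit x hF]
  exact J.sum_mem fun γ _ => J.sum_mem fun p _ => J.sum_mem fun q _ => J.smul_mem _ (hu γ p q)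

lemma LeftInv.mul_ract {κ : Alg G.n →ₗ[ℂ] ℂ} (hκ : G.LeftInv κ) (a : Alg G.n) (f : coefSub G.n) :
    κ (a * G.ract G.coint f) = (f : Alg G.n →ₗ[ℂ] ℂ) (G.S a) * κ G.coint := by
  rw [mul_ract_coint, hκ, ev_one_compL]

lemma LeftInv.ract_mul {κ : Alg G.n →ₗ[ℂ] ℂ} (hκ : G.LeftInv κ) (b : Alg G.n) (f : coefSub G.n) :
    κ (G.ract G.coint f * G.S b) = (f : Alg G.n →ₗ[ℂ] ℂ) b * κ G.coint := by
  rw [ract_coint_mul, hκ, ev_one_compR]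

/-- The modular automorphism of a left invariant functional is `S²`. -/
lemma LeftInv.kms {κ : Alg G.n →ₗ[ℂ] ℂ} (hκ : G.LeftInv κ) (a x : Alg G.n) :
    κ (a * x) = κ (x * G.S (G.S a)) := by
  obtain ⟨f, rfl⟩ := G.exists_eq_ract_coint x
  rw [hκ.mul_ract, hκ.ract_mul]

omit [Nonempty I] in
lemma exists_mul_left_unit {n : I → ℕ} (a : Alg n) : ∃ p : Alg n, p * a = a ∧ a * p = a := by
  obtain ⟨F, hF⟩ := exists_supp a
  exact ⟨proj n F, proj_mul hF, mul_proj hF⟩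

lemma LeftInv.apply_coint_ne_zero {κ : Alg G.n →ₗ[ℂ] ℂ} (hκ : G.LeftInv κ) (h0 : κ ≠ 0) :
    κ G.coint ≠ 0 := by
  refine fun h => h0 (LinearMap.ext fun x => ?_)
  obtain ⟨p, hp, -⟩ := exists_mul_left_unit x
  obtain ⟨f, hf⟩ := G.exists_eq_ract_coint x
  rw [← hp, ← hf, hκ.mul_ract, h, mul_zero]
  rfl

lemma LeftInv.eq_zero_of_forall {κ : Alg G.n →ₗ[ℂ] ℂ} (hκ : G.LeftInv κ) (h0 : κ ≠ 0)
    {b : Alg G.n} (hb : ∀ x, κ (x * b) = 0) : b = 0 := by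
  have h1 : G.S.symm b = 0 := alg_ext fun f => by
    have := hκ.ract_mul (G.S.symm b) f
    rw [LinearEquiv.apply_symm_apply, hb, eq_comm, mul_eq_zero] at this
    rw [this.resolve_right (hκ.apply_coint_ne_zero h0), map_zero]
  simpa using h1

/-- Left invariant functionals are unique up to scalars. -/
lemma LeftInv.unique {κ κ' : Alg G.n →ₗ[ℂ] ℂ} (hκ : G.LeftInv κ) (hκ' : G.LeftInv κ')
    (x : Alg G.n) : κ' x * κ G.coint = κ x * κ' G.coint := by
  obtain ⟨p, hp, -⟩ := exists_mul_left_unit x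
  obtain ⟨f, hf⟩ := G.exists_eq_ract_coint x
  rw [← hp, ← hf, hκ.mul_ract, hκ'.mul_ract]
  ring

variable (hφ : G.IsLeftHaar φ)

include hφ

lemma IsLeftHaar.apply_coint_ne_zero : φ G.coint ≠ 0 :=
  hφ.leftInv.apply_coint_ne_zero hφ.ne_zero

lemma IsLeftHaar.kms (a x : Alg G.n) : φ (a * x) = φ (x * G.S (G.S a)) := hφ.leftInv.kms a x

lemma IsLeftHaar.eq_zero_of_forall {b : Alg G.n} (hb : ∀ x, φ (x * b) = 0) : b = 0 :=
  hφ.leftInv.eq_zero_of_forall hφ.ne_zero hb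

/-- Every functional in `R` is of the form `φ(c ·)`. -/
lemma IsLeftHaar.exists_phiL_eq (g : coefSub G.n) : ∃ c, phiL φ c = g := by
  refine ⟨(φ G.coint)⁻¹ • G.ract G.coint (G.Sd g), coef_ext fun y => ?_⟩
  have := hφ.leftInv.ract_mul (G.S.symm y) (G.Sd g)
  rw [LinearEquiv.apply_symm_apply, Sd_apply, LinearEquiv.apply_symm_apply] at this
  rw [phiL_apply, smul_mul_assoc, map_smul, this, smul_eq_mul]
  field_simp [hφ.apply_coint_ne_zero]

omit [Nonempty I] in
lemma IsLeftHaar.conj_symm (a b : Alg G.n) : star (φ (star a * b)) = φ (star b * a) := by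
  have im0 : ∀ x, (φ (star x * x)).im = 0 := fun x =>
    ((Complex.nonneg_iff.mp (hφ.nonneg x)).2).symm
  have h1 := im0 (a + b)
  have h2 := im0 (a + Complex.I • b)
  have h3 := im0 a
  have h4 := im0 b
  simp only [star_add, add_mul, mul_add, map_add, star_smul, smul_mul_assoc, mul_smul_comm,
    map_smul, smul_eq_mul, Complex.add_im, Complex.mul_im, h3, h4] at h1 h2
  simp at h1 h2
  apply Complex.ext
  · simp; linarith
  · simp; linarith

omit [Nonempty I] in
lemma IsLeftHaar.map_star (x : Alg G.n) : φ (star x) = star (φ x) := by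
  obtain ⟨F, hF⟩ := exists_supp x
  have h1 := hφ.conj_symm (proj G.n F) x
  rw [star_proj, proj_mul hF] at h1
  have hF' : ∀ γ ∉ F, ((star x : Alg G.n) : Mult G.n) γ = 0 := fun γ hγ => by simp [hF γ hγ]
  rw [h1, mul_proj hF']

end invariant

end DiscreteQuantumGroup

end QGrp

/-! ### The modular element -/

namespace QGrp

namespace DiscreteQuantumGroup

variable {I : Type u} {G : DiscreteQuantumGroup I} {φ : Alg G.n →ₗ[ℂ] ℂ}

section density

variable (φ) in
/-- The density matrices `ρ_α` of `φ`: `φ(x) = Tr(x_α ρ_α)` on the block `α`. -/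
def rho : Mult G.n := fun α => Matrix.of fun i j => φ (unit G.n α j i)

lemma apply_mul_unit (a : Alg G.n) (γ : I) (k l : Fin (G.n γ)) :
    φ (a * unit G.n γ k l) = (rho φ γ * (a : Mult G.n) γ) l k := by
  have : a * unit G.n γ k l = ∑ i, (a : Mult G.n) γ i k • unit G.n γ i l := by
    apply Subtype.ext
    funext β
    by_cases h : β = γ
    · subst h
      ext p q
      simp [Matrix.mul_apply, Matrix.single_apply, Matrix.sum_apply, ite_and, eq_comm]
    · simp [unit_of_ne h]
  rw [this]
  simp [rho, Matrix.mul_apply, mul_comm]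

lemma apply_unit_mul (b : Alg G.n) (γ : I) (k l : Fin (G.n γ)) :
    φ (unit G.n γ k l * b) = ((b : Mult G.n) γ * rho φ γ) l k := by
  have : unit G.n γ k l * b = ∑ j, (b : Mult G.n) γ l j • unit G.n γ k j := by
    apply Subtype.ext
    funext β
    by_cases h : β = γ
    · subst h
      ext p q
      simp [Matrix.mul_apply, Matrix.single_apply, Matrix.sum_apply, ite_and, eq_comm]
    · simp [unit_of_ne h]
  rw [this]
  simp [rho, Matrix.mul_apply]

variable [Nonempty I] (hφ : G.IsLeftHaar φ)

include hφ

lemma IsLeftHaar.rho_mul (a : Alg G.n) (γ : I) :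
    rho φ γ * (a : Mult G.n) γ = (G.S (G.S a) : Mult G.n) γ * rho φ γ := by
  ext l k
  rw [← apply_mul_unit, ← apply_unit_mul, hφ.kms]

omit [Nonempty I] in
lemma IsLeftHaar.rho_posSemidef (γ : I) : (rho φ γ).PosSemidef := by
  refine .of_dotProduct_mulVec_nonneg ?_ fun x => ?_
  · ext i j
    rw [Matrix.conjTranspose_apply, rho, Matrix.of_apply, Matrix.of_apply, ← hφ.map_star, star_unit]
  · let i₀ : Fin (G.n γ) := ⟨0, G.n_pos γ⟩
    have h := hφ.nonneg (∑ i, star (x i) • unit G.n γ i₀ i)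
    have h1 : star (∑ i, star (x i) • unit G.n γ i₀ i) * (∑ i, star (x i) • unit G.n γ i₀ i) =
        ∑ i, ∑ j, (x i * star (x j)) • unit G.n γ i j := by
      rw [star_sum, Finset.sum_mul]
      refine Finset.sum_congr rfl fun i _ => ?_
      rw [Finset.mul_sum]
      refine Finset.sum_congr rfl fun j _ => ?_
      rw [star_smul, star_star, star_unit, smul_mul_smul_comm, unit_mul_unit]
    rw [h1] at h
    have h2 : star x ⬝ᵥ (rho φ γ).mulVec x =
        φ (∑ i, ∑ j, (x i * star (x j)) • unit G.n γ i j) := by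
      simp only [dotProduct, Matrix.mulVec, rho, map_sum, map_smul, Finset.mul_sum]
      rw [Finset.sum_comm]
      refine Finset.sum_congr rfl fun i _ => Finset.sum_congr rfl fun j _ => ?_
      simp
      ring
    rw [h2]
    exact h

/-- Faithfulness of the Haar measure. -/
lemma IsLeftHaar.rho_posDef (γ : I) : (rho φ γ).PosDef := by
  have hps := hφ.rho_posSemidef γ
  refine .of_dotProduct_mulVec_pos hps.1 fun v hv => ?_
  refine lt_of_le_of_ne (hps.dotProduct_mulVec_nonneg v) fun h => hv ?_
  rw [eq_comm, hps.dotProduct_mulVec_zero_iff] at h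
  let i₀ : Fin (G.n γ) := ⟨0, G.n_pos γ⟩
  have hb : ∑ i, star (v i) • unit G.n γ i₀ i = 0 := by
    refine hφ.eq_zero_of_forall fun x => ?_
    have hlin : φ ∘ₗ LinearMap.mulRight ℂ (∑ i, star (v i) • unit G.n γ i₀ i) = 0 := by
      refine alg_hom_ext fun β p q => ?_
      rw [LinearMap.comp_apply, LinearMap.mulRight_apply, apply_unit_mul]
      by_cases hβ : β = γ
      · subst hβ
        have h3 : ∀ q', ((∑ i, star (v i) • unit G.n β i₀ i : Alg G.n) : Mult G.n) β q q' =
            if q = i₀ then star (v q') else 0 := by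
          intro q'
          simp [Matrix.sum_apply, Matrix.single_apply, ite_and, eq_comm]
        rw [Matrix.mul_apply]
        simp_rw [h3]
        by_cases hq : q = i₀
        · have h4 := congrArg star (congrFun h p)
          simp only [Matrix.mulVec, dotProduct, star_sum, star_mul', Pi.zero_apply, star_zero] at h4
          simp only [hq, if_true, LinearMap.zero_apply]
          rw [← h4]
          refine Finset.sum_congr rfl fun j _ => ?_
          rw [mul_comm, ← hps.1.apply j p]
        · simp [hq]
      · have h3 : ((∑ i, star (v i) • unit G.n γ i₀ i : Alg G.n) : Mult G.n) β = 0 := by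
          simp [unit_of_ne hβ]
        rw [h3]
        simp
    exact LinearMap.congr_fun hlin x
  funext i
  have := congrArg (fun z : Alg G.n => star ((z : Mult G.n) γ i₀ i)) hb
  simpa [Matrix.sum_apply, Matrix.single_apply] using this

lemma IsLeftHaar.isUnit_rho (γ : I) : IsUnit (rho φ γ).det :=
  (Matrix.isUnit_iff_isUnit_det _).mp (hφ.rho_posDef γ).isUnit

lemma IsLeftHaar.S_S_apply (a : Alg G.n) (γ : I) :
    (G.S (G.S a) : Mult G.n) γ = rho φ γ * (a : Mult G.n) γ * (rho φ γ)⁻¹ := by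
  rw [hφ.rho_mul, Matrix.mul_assoc, Matrix.mul_nonsing_inv _ (hφ.isUnit_rho γ), Matrix.mul_one]

end density

section modular

variable [Nonempty I]

variable (φ) in
/-- The modular element, as a functional on `R`: `χ(f) φ(x) = φ((id ⊗ f)(Δ(x)))`. -/
def chi : coefSub G.n →ₗ[ℂ] ℂ := (φ G.coint)⁻¹ • φ ∘ₗ G.lact G.coint

variable (φ) in
/-- The modular element `δ`. -/
def delta : Mult G.n := fun α => Matrix.of fun i j => chi φ (mcoef G.n α i j)

lemma ev_delta (f : coefSub G.n) : ev (V := ℂ) (delta φ) f = chi φ f := by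
  have : ev (V := ℂ) (delta φ) = chi φ := coef_hom_ext fun α i j => by simp [delta]
  rw [this]

variable (hφ : G.IsLeftHaar φ)

include hφ

lemma IsLeftHaar.apply_lact (x : Alg G.n) (f : coefSub G.n) :
    φ (G.lact x f) = chi φ f * φ x := by
  have h : G.LeftInv (φ ∘ₗ (G.lact.flip f)) := fun x g => by
    rw [LinearMap.comp_apply, LinearMap.flip_apply, ← lact_ract, hφ.leftInv, LinearMap.comp_apply,
      LinearMap.flip_apply]
  have h1 := hφ.leftInv.unique h x
  have h2 := hφ.apply_coint_ne_zero
  simp only [LinearMap.comp_apply, LinearMap.flip_apply] at h1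
  simp only [chi, LinearMap.smul_apply, LinearMap.comp_apply, smul_eq_mul]
  field_simp
  rw [h1]
  ring

/-- The modular element is group-like: `χ` is a character of `R`. -/
lemma IsLeftHaar.chi_cmul (f g : coefSub G.n) : chi φ (G.cmul f g) = chi φ f * chi φ g := by
  have h1 := hφ.apply_lact G.coint (G.cmul f g)
  rw [← lact_lact, hφ.apply_lact, hφ.apply_lact, ← mul_assoc] at h1
  exact (mul_right_cancel₀ hφ.apply_coint_ne_zero h1).symm

lemma IsLeftHaar.lact_phiL (a : Alg G.n) :
    G.lact G.coint (phiL φ a) = φ G.coint • G.S a := by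
  refine alg_ext fun g => ?_
  rw [DiscreteQuantumGroup.apply_lact, ← apply_ract, phiL_apply, hφ.leftInv.mul_ract, map_smul,
    smul_eq_mul, mul_comm]

lemma IsLeftHaar.apply_S (a : Alg G.n) : φ (G.S a) = φ (rmul (delta φ) a) := by
  have h1 : φ (G.lact G.coint (phiL φ a)) = φ G.coint * φ (G.S a) := by
    rw [hφ.lact_phiL, map_smul, smul_eq_mul]
  rw [hφ.apply_lact, mul_comm] at h1
  rw [← ev_phiL, ev_delta, mul_left_cancel₀ hφ.apply_coint_ne_zero h1]

lemma IsLeftHaar.eq_of_forall_rmul {m m' : Mult G.n} (h : ∀ a, φ (rmul m a) = φ (rmul m' a)) :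
    m = m' := by
  funext γ
  have h1 : rmul m (proj G.n {γ}) - rmul m' (proj G.n {γ}) = 0 := by
    refine hφ.eq_zero_of_forall fun x => ?_
    have key : ∀ m : Mult G.n, x * rmul m (proj G.n {γ}) = rmul m (x * proj G.n {γ}) := fun m =>
      mul_rmul _ _ _
    rw [mul_sub, map_sub, key, key, h, sub_self]
  have := congrArg (fun z : Alg G.n => (z : Mult G.n) γ) h1
  simpa [proj_of_mem, sub_eq_zero] using this

/-- The functional `φ ∘ S` has the modular automorphism `S⁻²`; compared with that of `φ`, this
determines the modular element on each block up to a scalar. -/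
lemma IsLeftHaar.delta_eq_smul (γ : I) :
    ∃ c : ℂ, delta φ γ = c • ((rho φ γ)⁻¹ * (rho φ γ)⁻¹) := by
  have hu := hφ.isUnit_rho γ
  have h1 : ∀ a b, φ (rmul (delta φ) (a * b)) = φ (rmul (delta φ) (G.S (G.S b) * a)) := by
    intro a b
    rw [← hφ.apply_S, ← hφ.apply_S, S_mul, S_mul, hφ.kms]
  have h2 : ∀ b : Alg G.n, rmul (delta φ) b = lmul (delta φ) (G.S (G.S (G.S (G.S b)))) := by
    intro b
    refine sub_eq_zero.mp (hφ.eq_zero_of_forall fun a => ?_)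
    rw [mul_sub, map_sub, mul_rmul, h1, ← mul_rmul, hφ.kms, mul_lmul, sub_self]
  have h3 : ∀ i j, Commute (Matrix.single i j (1 : ℂ)) (delta φ γ * (rho φ γ * rho φ γ)) := by
    intro i j
    have h4 := congrArg (fun z : Alg G.n => (z : Mult G.n) γ) (h2 (unit G.n γ i j))
    simp only [rmul_coe, lmul_coe, Pi.mul_apply, hφ.S_S_apply, unit_same] at h4
    have h5 : (rho φ γ)⁻¹ * rho φ γ = 1 := Matrix.nonsing_inv_mul _ hu
    calc Matrix.single i j (1 : ℂ) * (delta φ γ * (rho φ γ * rho φ γ))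
        = (Matrix.single i j (1 : ℂ) * delta φ γ) * (rho φ γ * rho φ γ) := by
          simp only [Matrix.mul_assoc]
      _ = delta φ γ * (rho φ γ * (rho φ γ * (Matrix.single i j (1 : ℂ) *
            ((rho φ γ)⁻¹ * (((rho φ γ)⁻¹ * rho φ γ) * rho φ γ))))) := by
          rw [h4]; simp only [Matrix.mul_assoc]
      _ = delta φ γ * (rho φ γ * rho φ γ) * Matrix.single i j (1 : ℂ) := by
          rw [h5, Matrix.one_mul, h5, Matrix.mul_one]; simp only [Matrix.mul_assoc]
  obtain ⟨c, hc⟩ := Matrix.mem_range_scalar_iff_commute_single'.mpr h3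
  refine ⟨c, ?_⟩
  have h5 : rho φ γ * (rho φ γ)⁻¹ = 1 := Matrix.mul_nonsing_inv _ hu
  calc delta φ γ = delta φ γ * (rho φ γ * (rho φ γ * (rho φ γ)⁻¹) * (rho φ γ)⁻¹) := by
        rw [h5, Matrix.mul_one, h5, Matrix.mul_one]
    _ = (delta φ γ * (rho φ γ * rho φ γ)) * ((rho φ γ)⁻¹ * (rho φ γ)⁻¹) := by
        simp only [Matrix.mul_assoc]
    _ = _ := by
        rw [← hc, Matrix.scalar_apply, ← Matrix.smul_eq_diagonal_mul]

lemma IsLeftHaar.exists_delta_eq_pos_smul (γ : I) :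
    ∃ c : ℝ, 0 < c ∧ delta φ γ = (c : ℂ) • ((rho φ γ)⁻¹ * (rho φ γ)⁻¹) := by
  obtain ⟨c, hc⟩ := hφ.delta_eq_smul γ
  have hu := hφ.isUnit_rho γ
  have hp0 : proj G.n {γ} ≠ 0 := by
    intro h
    have := congrArg (fun z : Alg G.n => (z : Mult G.n) γ ⟨0, G.n_pos γ⟩ ⟨0, G.n_pos γ⟩) h
    simp [proj_of_mem] at this
  have hpp : proj G.n {γ} * proj G.n {γ} = proj G.n {γ} :=
    mul_proj fun β hβ => proj_of_notMem hβ
  have hSSp : G.S (G.S (proj G.n {γ})) = proj G.n {γ} := by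
    apply Subtype.ext
    funext β
    rw [hφ.S_S_apply]
    by_cases hβ : β ∈ ({γ} : Finset I)
    · rw [proj_of_mem hβ, Matrix.mul_one, Matrix.mul_nonsing_inv _ (hφ.isUnit_rho β)]
    · rw [proj_of_notMem hβ, Matrix.mul_zero, Matrix.zero_mul]
  have hstar : star (G.S (proj G.n {γ})) = G.S (proj G.n {γ}) := by
    apply G.S.injective
    rw [S_star_S, star_proj, hSSp]
  have h1 : φ (G.S (proj G.n {γ})) = c * (rho φ γ)⁻¹.trace := by
    have h2 : ∀ m : Matrix (Fin (G.n γ)) (Fin (G.n γ)) ℂ, ∀ y : Alg G.n, (y : Mult G.n) γ = m →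
        (∀ β, β ≠ γ → (y : Mult G.n) β = 0) → φ y = (m * rho φ γ).trace := by
      rintro m y rfl hy
      conv_lhs => rw [eq_sum_unit y (F := {γ}) (fun β hβ => hy β (by simpa using hβ))]
      simp [Matrix.trace, Matrix.mul_apply, rho]
    rw [hφ.apply_S, h2 (delta φ γ) _ (by simp [proj_of_mem]) (fun β hβ => by
      simp [proj_of_notMem (n := G.n) (F := {γ}) (γ := β) (by simpa using hβ)]), hc,
      Matrix.smul_mul, Matrix.mul_assoc, Matrix.nonsing_inv_mul _ hu, Matrix.mul_one,
      Matrix.trace_smul, smul_eq_mul]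
  have h2 : 0 ≤ φ (G.S (proj G.n {γ})) := by
    have := hφ.nonneg (G.S (proj G.n {γ}))
    rwa [hstar, ← S_mul, hpp] at this
  have : Nonempty (Fin (G.n γ)) := ⟨⟨0, G.n_pos γ⟩⟩
  have htr : 0 < (rho φ γ)⁻¹.trace := (hφ.rho_posDef γ).inv.trace_pos
  have hc0 : c ≠ 0 := by
    rintro rfl
    rw [zero_smul] at hc
    have : G.S (proj G.n {γ}) = 0 := hφ.eq_zero_of_forall fun x => by
      have h3 : rmul (delta φ) (proj G.n {γ} * G.S.symm x) = 0 := by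
        apply Subtype.ext
        funext β
        by_cases hβ : β = γ
        · subst hβ; simp [hc]
        · simp [proj_of_notMem (n := G.n) (F := {γ}) (γ := β) (by simpa using hβ)]
      have h4 := hφ.apply_S (proj G.n {γ} * G.S.symm x)
      rw [h3, map_zero, S_mul, LinearEquiv.apply_symm_apply] at h4
      exact h4
    exact hp0 (by simpa using this)
  rw [h1] at h2
  obtain ⟨t, ht⟩ : ∃ t : ℝ, (rho φ γ)⁻¹.trace = t := ⟨_, (Complex.eq_re_of_ofReal_le htr.le)⟩
  rw [ht] at h2 htr
  have htr' : 0 < t := by exact_mod_cast htr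
  have hcr : c = (c.re : ℂ) := by
    apply Complex.ext
    · simp
    · have := (Complex.nonneg_iff.mp h2).2
      simp at this
      simpa using (this.resolve_right htr'.ne')
  refine ⟨c.re, ?_, by rw [← hcr, hc]⟩
  have h3 := (Complex.nonneg_iff.mp h2).1
  simp at h3
  refine lt_of_le_of_ne (nonneg_of_mul_nonneg_left h3 htr') fun h => hc0 ?_
  rw [hcr, ← h]
  rfl

lemma IsLeftHaar.exists_isModularRoot : ∃ θ, G.IsModularRoot φ θ ∧
    ∀ (a : Alg G.n) γ, (G.S (G.S a) : Mult G.n) γ = (θ γ)⁻¹ * (a : Mult G.n) γ * θ γ := by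
  choose c hc0 hc using hφ.exists_delta_eq_pos_smul
  have hu := hφ.isUnit_rho
  have hs : ∀ γ, ((Real.sqrt (c γ) : ℝ) : ℂ) * ((Real.sqrt (c γ) : ℝ) : ℂ) = (c γ : ℂ) := fun γ => by
    rw [← Complex.ofReal_mul, Real.mul_self_sqrt (hc0 γ).le]
  have hs0 : ∀ γ, (0 : ℂ) < ((Real.sqrt (c γ) : ℝ) : ℂ) := fun γ => by
    exact_mod_cast Real.sqrt_pos.mpr (hc0 γ)
  refine ⟨fun γ => ((Real.sqrt (c γ) : ℝ) : ℂ) • (rho φ γ)⁻¹, ⟨fun γ => ?_, fun a => ?_⟩,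
    fun a γ => ?_⟩
  · exact (hφ.rho_posDef γ).inv.smul (hs0 γ)
  · have h1 : delta φ = (fun γ => ((Real.sqrt (c γ) : ℝ) : ℂ) • (rho φ γ)⁻¹) *
        (fun γ => ((Real.sqrt (c γ) : ℝ) : ℂ) • (rho φ γ)⁻¹) := by
      funext γ
      rw [Pi.mul_apply, Matrix.smul_mul, Matrix.mul_smul, smul_smul, hs, hc]
    rw [hφ.apply_S, h1]
  · have h1 : (((Real.sqrt (c γ) : ℝ) : ℂ) • (rho φ γ)⁻¹)⁻¹ =
        ((Real.sqrt (c γ) : ℝ) : ℂ)⁻¹ • rho φ γ := by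
      refine Matrix.inv_eq_left_inv ?_
      rw [Matrix.smul_mul, Matrix.mul_smul, smul_smul, inv_mul_cancel₀ (hs0 γ).ne', one_smul,
        Matrix.mul_nonsing_inv _ (hu γ)]
    rw [h1, hφ.S_S_apply, Matrix.smul_mul, Matrix.smul_mul, Matrix.mul_smul, smul_smul,
      inv_mul_cancel₀ (hs0 γ).ne', one_smul]

end modular

end DiscreteQuantumGroup

end QGrp

/-! ### The square root of the modular element is group-like -/

namespace QGrp

/-- A functional of finite support extends to the multipliers through local units. -/
lemma exists_apply_lmul_proj {I : Type u} {n : I → ℕ} (f : coefSub n) : ∃ F : Finset I, ∀ F', F ⊆ F' →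
    ∀ m : Mult n, (f : Alg n →ₗ[ℂ] ℂ) (lmul m (proj n F')) = ev (V := ℂ) m f := by
  obtain ⟨F, hF⟩ := exists_local_unit f
  refine ⟨F, fun F' h m => ?_⟩
  rw [← ev_coe, lmul_coe, ev_mul_right, (hF F' h).2]

lemma exists_proj_mul {I : Type u} {n : I → ℕ} (x : Alg n) : ∃ F : Finset I, ∀ F', F ⊆ F' →
    proj n F' * x = x ∧ x * proj n F' = x := by
  obtain ⟨F, hF⟩ := exists_supp x
  exact ⟨F, fun F' h => ⟨proj_mul fun γ hγ => hF γ fun hc => hγ (h hc),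
    mul_proj fun γ hγ => hF γ fun hc => hγ (h hc)⟩⟩

namespace DiscreteQuantumGroup

variable {I : Type u} {G : DiscreteQuantumGroup I} {φ : Alg G.n →ₗ[ℂ] ℂ}

section root

variable [Nonempty I] (hφ : G.IsLeftHaar φ)

include hφ

lemma IsLeftHaar.isModularRoot_theta : G.IsModularRoot φ (G.theta φ) := by
  obtain ⟨θ, hθ, -⟩ := hφ.exists_isModularRoot
  exact Classical.epsilon_spec (p := fun θ => G.IsModularRoot φ θ) ⟨θ, hθ⟩

lemma IsLeftHaar.theta_posDef (γ : I) : (G.theta φ γ).PosDef := hφ.isModularRoot_theta.1 γ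

lemma IsLeftHaar.theta_mul_theta : G.theta φ * G.theta φ = delta φ :=
  hφ.eq_of_forall_rmul fun a => by rw [← hφ.isModularRoot_theta.2, hφ.apply_S]

lemma IsLeftHaar.psi_apply (a : Alg G.n) : G.psi φ a = φ (G.S a) :=
  (hφ.isModularRoot_theta.2 a).symm

lemma IsLeftHaar.isUnit_theta (γ : I) : IsUnit (G.theta φ γ).det :=
  (Matrix.isUnit_iff_isUnit_det _).mp (hφ.theta_posDef γ).isUnit

lemma IsLeftHaar.theta_mul_thetaInv : G.theta φ * G.thetaInv φ = 1 := by
  funext γ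
  exact Matrix.mul_nonsing_inv _ (hφ.isUnit_theta γ)

lemma IsLeftHaar.thetaInv_mul_theta : G.thetaInv φ * G.theta φ = 1 := by
  funext γ
  exact Matrix.nonsing_inv_mul _ (hφ.isUnit_theta γ)

lemma IsLeftHaar.star_theta : star (G.theta φ) = G.theta φ := by
  funext γ
  exact (hφ.theta_posDef γ).1

lemma IsLeftHaar.star_thetaInv : star (G.thetaInv φ) = G.thetaInv φ := by
  funext γ
  exact (hφ.theta_posDef γ).1.inv

lemma IsLeftHaar.S_S (a : Alg G.n) :
    G.S (G.S a) = lmul (G.thetaInv φ) (rmul (G.theta φ) a) := by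
  obtain ⟨θ, hθ, h⟩ := hφ.exists_isModularRoot
  have h1 : θ = G.theta φ := by
    have h2 : θ * θ = G.theta φ * G.theta φ :=
      hφ.eq_of_forall_rmul fun a => by rw [← hφ.isModularRoot_theta.2, hθ.2]
    funext γ
    exact posSemidef_eq_of_mul_self_eq (hθ.1 γ).posSemidef (hφ.theta_posDef γ).posSemidef
      (congrFun h2 γ)
  subst h1
  apply Subtype.ext
  funext γ
  rw [h, lmul_coe, rmul_coe, Matrix.mul_assoc]
  rfl

lemma IsLeftHaar.apply_S_S (a : Alg G.n) : φ (G.S (G.S a)) = φ a := by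
  classical
  obtain ⟨F₁, h₁⟩ := exists_proj_mul a
  obtain ⟨F₂, h₂⟩ := exists_proj_mul (G.S (G.S a))
  rw [← (h₂ _ (Finset.subset_union_right (s₁ := F₁))).1, ← hφ.kms,
    (h₁ _ (Finset.subset_union_left (s₂ := F₂))).2]

lemma IsLeftHaar.apply_rmul_theta (a : Alg G.n) :
    φ (rmul (G.theta φ) a) = φ (lmul (G.theta φ) a) := by
  have := hφ.apply_S_S (lmul (G.theta φ) a)
  rwa [hφ.S_S, ← lmul_rmul, lmul_lmul, hφ.thetaInv_mul_theta, lmul_one] at this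

lemma IsLeftHaar.apply_rmul_thetaInv (a : Alg G.n) :
    φ (rmul (G.thetaInv φ) a) = φ (lmul (G.thetaInv φ) a) := by
  have := hφ.apply_S_S (rmul (G.thetaInv φ) a)
  rw [hφ.S_S, rmul_rmul, hφ.thetaInv_mul_theta, rmul_one] at this
  exact this.symm

end root

section grouplike

lemma exists_forall_cmul_apply (α β : I) : ∃ F : Finset I, ∀ F', F ⊆ F' → ∀ (m : Mult G.n) i j k l,
    (G.cmul (mcoef G.n α i j) (mcoef G.n β k l) : Alg G.n →ₗ[ℂ] ℂ) (lmul m (proj G.n F')) =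
      ev (V := ℂ) m (G.cmul (mcoef G.n α i j) (mcoef G.n β k l)) := by
  classical
  choose F hF using fun i j k l =>
    exists_apply_lmul_proj (G.cmul (mcoef G.n α i j) (mcoef G.n β k l))
  refine ⟨Finset.univ.biUnion fun i => Finset.univ.biUnion fun j => Finset.univ.biUnion fun k =>
    Finset.univ.biUnion fun l => F i j k l, fun F' h m i j k l => hF i j k l F' ?_ m⟩
  refine Finset.Subset.trans (fun γ hγ => ?_) h
  simp only [Finset.mem_biUnion, Finset.mem_univ, true_and]
  exact ⟨i, j, k, l, hγ⟩

variable (G) in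
/-- The extension of `Δ` to the algebraic multipliers. -/
def Δext (m : Mult G.n) : Mult2 G.n := fun α β => Matrix.of fun x y =>
  ev (V := ℂ) m (G.cmul (mcoef G.n α x.1 y.1) (mcoef G.n β x.2 y.2))

lemma exists_Δext (α β : I) : ∃ F : Finset I, ∀ F', F ⊆ F' → ∀ m : Mult G.n,
    G.Δ (lmul m (proj G.n F')) α β = G.Δext m α β := by
  obtain ⟨F, hF⟩ := exists_forall_cmul_apply (G := G) α β
  refine ⟨F, fun F' h m => ?_⟩
  ext ⟨i, k⟩ ⟨j, l⟩
  rw [Δext, Matrix.of_apply, ← hF F' h, cmul_apply, pair2_mcoef]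

lemma Δext_mul (m m' : Mult G.n) : G.Δext (m * m') = G.Δext m * G.Δext m' := by
  funext α β
  obtain ⟨F, hF⟩ := exists_Δext (G := G) α β
  rw [Pi.mul_apply, Pi.mul_apply, ← hF F subset_rfl, ← hF F subset_rfl, ← hF F subset_rfl,
    ← Pi.mul_apply, ← Pi.mul_apply, ← map_mul]
  rw [lmul_mul]
  have : proj G.n F * lmul m' (proj G.n F) = lmul m' (proj G.n F) :=
    proj_mul fun γ hγ => by simp [proj_of_notMem hγ]
  rw [this, lmul_lmul]

lemma Δ_lmul (m : Mult G.n) (x : Alg G.n) : G.Δ (lmul m x) = G.Δext m * G.Δ x := by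
  classical
  funext α β
  obtain ⟨F, hF⟩ := exists_Δext (G := G) α β
  obtain ⟨F', hF'⟩ := exists_proj_mul x
  rw [Pi.mul_apply, Pi.mul_apply, ← hF (F ∪ F') Finset.subset_union_left, ← Pi.mul_apply,
    ← Pi.mul_apply, ← map_mul, lmul_mul, (hF' (F ∪ F') Finset.subset_union_right).1]

lemma Δext_one : G.Δext 1 = 1 := by
  funext α β
  obtain ⟨F, hF⟩ := exists_Δ_proj G α β
  obtain ⟨F', hF'⟩ := exists_Δext (G := G) α β
  classical
  rw [← hF' (F ∪ F') Finset.subset_union_right, lmul_one, hF (F ∪ F') Finset.subset_union_left]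
  rfl

lemma Δext_posSemidef {m : Mult G.n} (hm : ∀ γ, (m γ).PosSemidef) (α β : I) :
    (G.Δext m α β).PosSemidef := by
  obtain ⟨F, hF⟩ := exists_Δext (G := G) α β
  choose B hB using fun γ => exists_conjTranspose_mul_self (hm γ)
  have h1 : lmul m (proj G.n F) = star (lmul B (proj G.n F)) * lmul B (proj G.n F) := by
    apply Subtype.ext
    funext γ
    by_cases hγ : γ ∈ F
    · simp [proj_of_mem hγ, hB γ]
    · simp [proj_of_notMem hγ]
  rw [← hF F subset_rfl, h1, map_mul, map_star]
  exact Matrix.posSemidef_conjTranspose_mul_self _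

/-- A multiplier whose extended comultiplication is `m ⊗ m` acts on `R` by an automorphism. -/
lemma compL_cmul {m : Mult G.n} (hm : ∀ α β, G.Δext m α β = m α ⊗ₖ m β) (f g : coefSub G.n) :
    compL m (G.cmul f g) = G.cmul (compL m f) (compL m g) := by
  have : G.cmul.compr₂ (compL m) = G.cmul.compl₁₂ (compL m) (compL m) := by
    refine coef_hom_ext₂ fun α i j β k l => coef_ext fun x => ?_
    simp only [LinearMap.compr₂_apply, LinearMap.compl₁₂_apply, compL_apply, compL_mcoef]
    rw [cmul_apply, pair2_mcoef, Δ_lmul]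
    simp only [Pi.mul_apply, Matrix.mul_apply, hm, Fintype.sum_prod_type, map_sum, map_smul,
      LinearMap.sum_apply, LinearMap.smul_apply, Matrix.kroneckerMap_apply,
      AddSubmonoidClass.coe_finsetSum, SetLike.val_smul, cmul_apply, pair2_mcoef, smul_eq_mul,
      Finset.mul_sum]
    rw [Finset.sum_comm]
    refine Finset.sum_congr rfl fun p _ => Finset.sum_congr rfl fun q _ => ?_
    ring
  exact LinearMap.congr_fun₂ this f g

variable [Nonempty I] (hφ : G.IsLeftHaar φ)

include hφ

/-- The positive square root `θ` of the group-like element `δ` is group-like: `Δ(θ)` and `θ ⊗ θ` are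
positive with the same square. -/
lemma IsLeftHaar.Δext_theta (α β : I) :
    G.Δext (G.theta φ) α β = G.theta φ α ⊗ₖ G.theta φ β := by
  refine posSemidef_eq_of_mul_self_eq
    (Δext_posSemidef (fun γ => (hφ.theta_posDef γ).posSemidef) α β)
    ((hφ.theta_posDef α).posSemidef.kronecker (hφ.theta_posDef β).posSemidef) ?_
  have h1 : G.Δext (G.theta φ) α β * G.Δext (G.theta φ) α β =
      G.Δext (G.theta φ * G.theta φ) α β := by rw [Δext_mul]; rfl
  have h2 : ∀ γ, G.theta φ γ * G.theta φ γ = delta φ γ := congrFun hφ.theta_mul_theta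
  rw [← Matrix.mul_kronecker_mul, h1, h2, h2, hφ.theta_mul_theta]
  ext ⟨i, k⟩ ⟨j, l⟩
  rw [Δext, Matrix.of_apply, ev_delta, hφ.chi_cmul]
  rfl

lemma IsLeftHaar.Δext_thetaInv (α β : I) :
    G.Δext (G.thetaInv φ) α β = G.thetaInv φ α ⊗ₖ G.thetaInv φ β := by
  have h1 : G.Δext (G.thetaInv φ) α β * (G.theta φ α ⊗ₖ G.theta φ β) = 1 := by
    have h3 := congrFun (congrFun (Δext_mul (G.thetaInv φ) (G.theta φ)) α) β
    rw [hφ.thetaInv_mul_theta, Δext_one] at h3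
    rw [← hφ.Δext_theta]
    exact h3.symm
  have h2 : (G.theta φ α ⊗ₖ G.theta φ β) * (G.thetaInv φ α ⊗ₖ G.thetaInv φ β) = 1 := by
    have h3 : ∀ γ, G.theta φ γ * G.thetaInv φ γ = 1 := congrFun hφ.theta_mul_thetaInv
    rw [← Matrix.mul_kronecker_mul, h3, h3, Matrix.one_kronecker_one]
  exact left_inv_eq_right_inv h1 h2

lemma IsLeftHaar.compL_thetaInv_cmul (f g : coefSub G.n) : compL (G.thetaInv φ) (G.cmul f g) =
    G.cmul (compL (G.thetaInv φ) f) (compL (G.thetaInv φ) g) :=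
  compL_cmul hφ.Δext_thetaInv f g

lemma IsLeftHaar.ev_theta_cmul (f g : coefSub G.n) : ev (V := ℂ) (G.theta φ) (G.cmul f g) =
    ev (V := ℂ) (G.theta φ) f * ev (V := ℂ) (G.theta φ) g := by
  have : G.cmul.compr₂ (ev (V := ℂ) (G.theta φ)) =
      (LinearMap.mul ℂ ℂ).compl₁₂ (ev (V := ℂ) (G.theta φ)) (ev (V := ℂ) (G.theta φ)) := by
    refine coef_hom_ext₂ fun α i j β k l => ?_
    have := congrFun (congrFun (hφ.Δext_theta α β) (i, k)) (j, l)
    simpa [Δext] using this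
  exact LinearMap.congr_fun₂ this f g

lemma IsLeftHaar.ev_theta_cone : ev (V := ℂ) (G.theta φ) G.cone = 1 := by
  obtain ⟨α⟩ := ‹Nonempty I›
  have : Nonempty I := ⟨α⟩
  have i : Fin (G.n α) := ⟨0, G.n_pos α⟩
  have h0 : ∃ j, G.theta φ α i j ≠ 0 := by
    by_contra hc
    push Not at hc
    have h1 := congrFun (congrFun (congrFun hφ.theta_mul_thetaInv α) i) i
    simp [Matrix.mul_apply, hc] at h1
  obtain ⟨j, hj⟩ := h0
  have h1 := hφ.ev_theta_cmul G.cone (mcoef G.n α i j)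
  rw [cone_cmul, ev_mcoef] at h1
  exact (mul_eq_right₀ hj).mp h1.symm

lemma IsLeftHaar.ev_theta_Sd (α : I) (i j : Fin (G.n α)) :
    ev (V := ℂ) (G.theta φ) (G.Sd (mcoef G.n α i j)) = G.thetaInv φ α i j := by
  have h1 : (Matrix.of fun i j => ev (V := ℂ) (G.theta φ) (G.Sd (mcoef G.n α i j))) *
      G.theta φ α = 1 := by
    ext p q
    have := congrArg (ev (V := ℂ) (G.theta φ)) (G.sum_Sd_cmul α p q)
    rw [map_sum, apply_ite (ev (V := ℂ) (G.theta φ)), hφ.ev_theta_cone, map_zero] at this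
    rw [Matrix.one_apply, ← this, Matrix.mul_apply]
    refine Finset.sum_congr rfl fun k _ => ?_
    rw [hφ.ev_theta_cmul, ev_mcoef, Matrix.of_apply]
  have h2 : G.theta φ α * G.thetaInv φ α = 1 := congrFun hφ.theta_mul_thetaInv α
  have h3 := left_inv_eq_right_inv h1 h2
  exact congrFun (congrFun h3 i) j

lemma IsLeftHaar.S_lmul_theta (x : Alg G.n) :
    G.S (lmul (G.theta φ) x) = rmul (G.thetaInv φ) (G.S x) := by
  classical
  apply Subtype.ext
  funext α
  ext i j
  choose F hF using fun k => exists_apply_lmul_proj (G.Sd (mcoef G.n α k j))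
  obtain ⟨F', hF'⟩ := exists_proj_mul x
  have hk : ∀ k, (G.S (lmul (G.theta φ) (proj G.n (Finset.univ.biUnion F ∪ F'))) : Mult G.n) α k j =
      G.thetaInv φ α k j := fun k => by
    rw [← hφ.ev_theta_Sd, ← hF k (Finset.univ.biUnion F ∪ F')
      ((Finset.subset_biUnion_of_mem F (Finset.mem_univ k)).trans Finset.subset_union_left),
      Sd_apply, mcoef_apply]
  rw [← (hF' (Finset.univ.biUnion F ∪ F') Finset.subset_union_right).1, ← lmul_mul, S_mul,
    (hF' (Finset.univ.biUnion F ∪ F') Finset.subset_union_right).1]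
  simp [Matrix.mul_apply, hk]

lemma IsLeftHaar.S_lmul_thetaInv (x : Alg G.n) :
    G.S (lmul (G.thetaInv φ) x) = rmul (G.theta φ) (G.S x) := by
  have := hφ.S_lmul_theta (lmul (G.thetaInv φ) x)
  rw [lmul_lmul, hφ.theta_mul_thetaInv, lmul_one] at this
  rw [this, rmul_rmul, hφ.thetaInv_mul_theta, rmul_one]

end grouplike

end DiscreteQuantumGroup

end QGrp

/-! ### Fourier transform and convolution algebra -/

namespace QGrp

/-- Slicing commutes with linear maps of the first leg. -/
lemma map_ev {I : Type u} {n : I → ℕ} {V : Type v} {W : Type w} [AddCommGroup V] [Module ℂ V]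
    [AddCommGroup W] [Module ℂ W] (L : V →ₗ[ℂ] W) (X : MultV n V) (f : coefSub n) :
    L (ev X f) = ev (V := W) (fun α => (X α).map L) f := by
  have : L ∘ₗ ev X = ev (V := W) (fun α => (X α).map L) := coef_hom_ext fun α i j => by simp
  exact LinearMap.congr_fun this f

namespace DiscreteQuantumGroup

variable {I : Type u} {G : DiscreteQuantumGroup I} {φ : Alg G.n →ₗ[ℂ] ℂ}

section fourier

variable [Nonempty I]

lemma ract_cone (x : Alg G.n) : G.ract x G.cone = x :=
  alg_ext fun g => by rw [apply_ract, cone_cmul]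

variable (G φ) in
/-- The Fourier transform `a ↦ φ(· S(a))`; for the left Haar measure, this is `x ↦ φ(S⁻¹(a) x)`. -/
def four : Alg G.n →ₗ[ℂ] coefSub G.n := phiL φ ∘ₗ G.S.symm.toLinearMap

variable (hφ : G.IsLeftHaar φ)

include hφ

lemma IsLeftHaar.four_apply (a x : Alg G.n) :
    (G.four φ a : Alg G.n →ₗ[ℂ] ℂ) x = φ (x * G.S a) := by
  change φ (G.S.symm a * x) = _
  rw [hφ.kms, LinearEquiv.apply_symm_apply]

lemma IsLeftHaar.four_injective : Function.Injective (G.four φ) := by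
  rw [injective_iff_map_eq_zero]
  intro a ha
  have : G.S a = 0 := hφ.eq_zero_of_forall fun x => by
    rw [← hφ.four_apply, ha]
    rfl
  simpa using this

lemma IsLeftHaar.four_surjective : Function.Surjective (G.four φ) := fun g => by
  obtain ⟨c, hc⟩ := hφ.exists_phiL_eq g
  refine ⟨G.S c, ?_⟩
  rw [← hc]
  change phiL φ (G.S.symm (G.S c)) = _
  rw [LinearEquiv.symm_apply_apply]

/-- The left Haar measure turns the right action by a functional into the one by its antipode. -/
lemma IsLeftHaar.apply_mul_ract (a b : Alg G.n) (f : coefSub G.n) :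
    φ (a * G.ract b f) = φ (G.ract a (G.Sd f) * b) := by
  induction f using coef_induction with
  | zero => simp
  | add f g hf hg => simp [mul_add, add_mul, hf, hg]
  | smul c f hf => simp only [map_smul, mul_smul_comm, smul_mul_assoc, hf]
  | mcoef α i j =>
    have h1 : a * G.ract b (mcoef G.n α i j) =
        ∑ k, G.ract (G.ract a (G.Sd (mcoef G.n α i k)) * b) (mcoef G.n α k j) := by
      simp_rw [ract_mul, ract_ract]
      rw [Finset.sum_comm]
      simp_rw [← Finset.sum_mul, ← map_sum, sum_Sd_cmul]
      rw [Finset.sum_eq_single i]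
      · simp [ract_cone]
      · intro k _ hk; simp [hk.symm]
      · simp
    rw [h1, map_sum]
    simp_rw [hφ.leftInv _ (mcoef _ _ _ _), ev_one_mcoef]
    simp

lemma IsLeftHaar.conv_eq_lact (a c : Alg G.n) : G.conv φ a c = G.lact a (G.four φ c) := by
  have h0 : G.conv φ a c = slice2 (G.psi φ ∘ₗ G.S.symm.toLinearMap) (G.T₁ (a ⊗ₜ G.S c)) := rfl
  have h1 : G.psi φ ∘ₗ G.S.symm.toLinearMap = φ := LinearMap.ext fun x => by
    rw [LinearMap.comp_apply, hφ.psi_apply, LinearEquiv.coe_coe, LinearEquiv.apply_symm_apply]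
  obtain ⟨p, hp, -⟩ := exists_mul_left_unit (G.S c)
  have h2 : G.T₁ (a ⊗ₜ G.S c) =
      (LinearMap.mulRight ℂ (G.S c)).lTensor (Alg G.n) (G.T₁ (a ⊗ₜ p)) := by
    have key : ∀ t : Alg G.n ⊗[ℂ] Alg G.n,
        toMult2 ((LinearMap.mulRight ℂ (G.S c)).lTensor (Alg G.n) t) =
          toMult2 t * leg2 (G.S c) := fun t => by
      induction t with
      | zero => simp
      | add t t' ht ht' => simp [add_mul, ht, ht']
      | tmul x y =>
        rw [LinearMap.lTensor_tmul, LinearMap.mulRight_apply, ← leg1_mul_leg2, leg2_mul,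
          ← mul_assoc, leg1_mul_leg2]
    apply toMult2_injective
    rw [key, G.T₁_spec, G.T₁_spec, mul_assoc, ← leg2_mul, hp]
  have h3 : ∀ t : Alg G.n ⊗[ℂ] Alg G.n,
      slice2 φ ((LinearMap.mulRight ℂ (G.S c)).lTensor (Alg G.n) t) =
        slice2 (G.four φ c : Alg G.n →ₗ[ℂ] ℂ) t := fun t => by
    induction t with
    | zero => simp
    | add t t' ht ht' => simp [ht, ht']
    | tmul x y => simp [hφ.four_apply]
  rw [h0, h1, h2, h3]
  refine G.slice2_T₁ (coef_ext fun x => ?_) a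
  rw [compR_apply, hφ.four_apply, hφ.four_apply, rmul_alg, mul_assoc, hp]

/-- The Fourier transform is an anti-isomorphism onto `R`. -/
lemma IsLeftHaar.four_conv (a c : Alg G.n) :
    G.four φ (G.conv φ a c) = G.cmul (G.four φ c) (G.four φ a) := by
  refine coef_ext fun x => ?_
  rw [hφ.four_apply, hφ.conv_eq_lact, S_lact, hφ.apply_mul_ract, Sd_SdInv, ← hφ.four_apply,
    apply_ract]

lemma IsLeftHaar.four_sharp (a : Alg G.n) :
    G.four φ (G.sharp φ a) = cstar (G.Sd (G.four φ a)) := by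
  refine coef_ext fun x => ?_
  have h1 : G.S (G.sharp φ a) = rmul (G.theta φ * G.theta φ) (star a) := by
    change G.S (lmul (G.thetaInv φ * G.thetaInv φ) (G.S.symm (star a))) = _
    rw [← lmul_lmul, hφ.S_lmul_thetaInv, hφ.S_lmul_thetaInv, LinearEquiv.apply_symm_apply,
      rmul_rmul]
  rw [hφ.four_apply, h1, cstar_apply, Sd_apply, hφ.four_apply, ← S_mul, ← hφ.psi_apply]
  change _ = star (φ (rmul (G.theta φ * G.theta φ) (a * star x)))
  rw [← hφ.map_star, star_rmul, star_mul, star_mul, hφ.star_theta, star_star, ← lmul_lmul, ← hφ.apply_rmul_theta,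
    ← lmul_rmul, ← hφ.apply_rmul_theta, rmul_rmul, mul_rmul]

lemma IsLeftHaar.conv_assoc (a b c : Alg G.n) :
    G.conv φ (G.conv φ a b) c = G.conv φ a (G.conv φ b c) :=
  hφ.four_injective (by simp only [hφ.four_conv, cmul_assoc])

omit hφ in
lemma cstar_Sd_cstar_Sd (f : coefSub G.n) : cstar (G.Sd (cstar (G.Sd f))) = f :=
  coef_ext fun x => by
    rw [cstar_apply, Sd_apply, cstar_apply, Sd_apply, S_star_S, star_star, star_star]

lemma IsLeftHaar.sharp_sharp (a : Alg G.n) : G.sharp φ (G.sharp φ a) = a :=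
  hφ.four_injective (by rw [hφ.four_sharp, hφ.four_sharp, cstar_Sd_cstar_Sd])

lemma IsLeftHaar.sharp_conv (a b : Alg G.n) :
    G.sharp φ (G.conv φ a b) = G.conv φ (G.sharp φ b) (G.sharp φ a) :=
  hφ.four_injective (by
    simp only [hφ.four_sharp, hφ.four_conv, Sd_cmul, cstar_cmul])

variable (φ) in
/-- The unit of `Â₀`. -/
def convOne : Alg G.n := (φ G.coint)⁻¹ • G.coint

lemma IsLeftHaar.four_convOne : G.four φ (convOne φ) = G.cone := coef_ext fun x => by
  rw [hφ.four_apply, convOne, map_smul, S_coint, mul_smul_comm, mul_coint, map_smul, map_smul,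
    cone_apply, smul_eq_mul, smul_eq_mul, mul_comm (G.counit x), ← mul_assoc,
    inv_mul_cancel₀ hφ.apply_coint_ne_zero, one_mul]

lemma IsLeftHaar.conv_convOne (a : Alg G.n) : G.conv φ a (convOne φ) = a :=
  hφ.four_injective (by rw [hφ.four_conv, hφ.four_convOne, cone_cmul])

lemma IsLeftHaar.exists_unitary_coef : ∃ w : ∀ α, Fin (G.n α) → Fin (G.n α) → Alg G.n,
    (∀ α i j, G.four φ (w α i j) = mcoef G.n α i j) ∧
    ∀ α i j, ∑ k, G.conv φ (G.sharp φ (w α k i)) (w α k j) =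
      if i = j then convOne φ else 0 := by
  choose w hw using fun α i j => hφ.four_surjective (mcoef G.n α i j)
  refine ⟨w, hw, fun α i j => hφ.four_injective ?_⟩
  have h1 := congrArg cstar (G.sum_cmul_Sd α j i)
  rw [map_sum, apply_ite cstar, map_zero] at h1
  have h2 : cstar G.cone = G.cone := coef_ext fun x => by
    rw [cstar_apply, cone_apply, counit_star, star_star]
    rfl
  rw [h2] at h1
  rw [map_sum, apply_ite (G.four φ), hφ.four_convOne, map_zero]
  simp_rw [hφ.four_conv, hφ.four_sharp, hw]
  simp_rw [eq_comm (a := i)]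
  rw [← h1]
  refine Finset.sum_congr rfl fun k _ => ?_
  rw [cstar_cmul, cstar_mcoef]

lemma IsLeftHaar.eq_sum_unitary_coef {w : ∀ α, Fin (G.n α) → Fin (G.n α) → Alg G.n}
    (hw : ∀ α i j, G.four φ (w α i j) = mcoef G.n α i j) (a : Alg G.n) :
    ∃ (F : Finset I) (c : ∀ α, Fin (G.n α) → Fin (G.n α) → ℂ),
      a = ∑ α ∈ F, ∑ i, ∑ j, c α i j • w α i j := by
  obtain ⟨F, hF⟩ := (G.four φ a).2
  refine ⟨F, fun γ p q => (G.four φ a : Alg G.n →ₗ[ℂ] ℂ) (unit G.n γ p q),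
    hφ.four_injective ?_⟩
  simp only [map_sum, map_smul, hw]
  exact coef_eq_sum _ hF

variable (G φ) in
/-- The regular representation of `Â₀` on `A₀`. -/
def lam : Alg G.n →ₗ[ℂ] Alg G.n →ₗ[ℂ] Alg G.n := (G.ract.flip) ∘ₗ G.four φ

omit hφ [Nonempty I] in
lemma lam_apply (a b : Alg G.n) : G.lam φ a b = G.ract b (G.four φ a) := rfl

lemma IsLeftHaar.lam_conv (a c b : Alg G.n) :
    G.lam φ (G.conv φ a c) b = G.lam φ a (G.lam φ c b) := by
  simp only [lam_apply, hφ.four_conv, ract_ract]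

lemma IsLeftHaar.lam_convOne (b : Alg G.n) : G.lam φ (convOne φ) b = b := by
  rw [lam_apply, hφ.four_convOne, ract_cone]

lemma IsLeftHaar.apply_star_mul_lam (a b c : Alg G.n) :
    φ (star c * G.lam φ a b) = φ (star (G.lam φ (G.sharp φ a) c) * b) := by
  rw [lam_apply, lam_apply, hφ.apply_mul_ract, star_ract, hφ.four_sharp, cstar_cstar]

lemma IsLeftHaar.lam_injective : Function.Injective (G.lam φ) := by
  rw [injective_iff_map_eq_zero]
  intro a ha
  refine hφ.four_injective ?_
  rw [map_zero]
  refine coef_ext fun b => ?_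
  have h1 : G.cone.1 (G.lam φ a b) = 0 := by rw [ha]; simp
  rw [lam_apply, apply_ract, cmul_cone] at h1
  exact h1

/-- The concrete form of the regular representation. -/
lemma IsLeftHaar.coe_lam (a b : Alg G.n) : (G.lam φ a b : Mult G.n) =
    sliceLeft (fun z => G.psi φ (a * G.S.symm z)) (G.Δ b) := by
  have h1 : (fun z => G.psi φ (a * G.S.symm z)) = (G.four φ a : Alg G.n →ₗ[ℂ] ℂ) := by
    funext z
    rw [hφ.psi_apply, S_mul, LinearEquiv.apply_symm_apply, hφ.four_apply]
  rw [h1]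
  funext β
  ext k l
  have h2 := G.apply_ract b (G.four φ a) (mcoef G.n β k l)
  rw [mcoef_apply, cmul_apply] at h2
  rw [lam_apply, h2, sliceLeft, Matrix.of_apply, ← ev_apply, pair2]
  have h3 := map_ev (LinearMap.applyₗ (mcoef G.n β k l)) (fun α => Matrix.of fun i j =>
    ev (V := ℂ) fun β => Matrix.of fun k l => G.Δ b α β (i, k) (j, l)) (G.four φ a)
  rw [LinearMap.applyₗ_apply_apply] at h3
  rw [h3]
  congr 2
  funext α
  ext i j
  simp

end fourier

end DiscreteQuantumGroup

end QGrp

/-! ### Unitary representations -/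

namespace QGrp

section legs

variable {I : Type u} {n : I → ℕ} {V : Type v} [AddCommGroup V] [Module ℂ V]

lemma multV_ext {X Y : MultV n V} (h : ∀ f, ev X f = ev Y f) : X = Y := by
  funext α
  ext i j
  simpa using h (mcoef n α i j)

lemma ev_toMultV_tmul (x : V) (a : Alg n) (f : coefSub n) :
    ev (toMultV (x ⊗ₜ[ℂ] a)) f = (f : Alg n →ₗ[ℂ] ℂ) a • x := by
  have : ev (toMultV (x ⊗ₜ[ℂ] a)) =
      (((LinearMap.applyₗ a).comp (coefSub n).subtype : coefSub n →ₗ[ℂ] ℂ)).smulRight x :=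
    coef_hom_ext fun α i j => by simp [toMultV_tmul]
  rw [this]
  rfl

lemma ev_toMultV_lTensor (Q : Alg n →ₗ[ℂ] Alg n) {f f' : coefSub n}
    (h : ∀ x, (f' : Alg n →ₗ[ℂ] ℂ) x = (f : Alg n →ₗ[ℂ] ℂ) (Q x)) (y : V ⊗[ℂ] Alg n) :
    ev (toMultV (Q.lTensor V y)) f = ev (toMultV y) f' := by
  induction y with
  | zero => simp
  | add y z hy hz => simp [hy, hz]
  | tmul x a => rw [LinearMap.lTensor_tmul, ev_toMultV_tmul, ev_toMultV_tmul, h]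

end legs

namespace DiscreteQuantumGroup

variable {I : Type u} {G : DiscreteQuantumGroup I} {φ : Alg G.n →ₗ[ℂ] ℂ}
variable {H : Type v} [NormedAddCommGroup H] [InnerProductSpace ℂ H] [CompleteSpace H]
variable {U : MultV G.n (H →L[ℂ] H)}

section rep

variable (hU : G.IsUnitaryRep U)

include hU

/-- A representation of the quantum group is a unital representation of the algebra `R`. -/
lemma IsUnitaryRep.ev_cmul (f g : coefSub G.n) : ev U (G.cmul f g) = ev U f * ev U g := by
  have : G.cmul.compr₂ (ev U) = (LinearMap.mul ℂ (H →L[ℂ] H)).compl₁₂ (ev U) (ev U) := by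
    refine coef_hom_ext₂ fun α i j β k l => ?_
    have h1 : ⇑(G.cmul (mcoef G.n α i j) (mcoef G.n β k l) : Alg G.n →ₗ[ℂ] ℂ) =
        fun a => G.Δ a α β (i, k) (j, l) := by
      funext a
      rw [cmul_apply, pair2_mcoef]
    rw [LinearMap.compr₂_apply, ev_apply, h1, hU.comult]
    simp
  exact LinearMap.congr_fun₂ this f g

variable [Nonempty I]

lemma IsUnitaryRep.ev_Sd_mcoef (α : I) (i j : Fin (G.n α)) :
    ev U (G.Sd (mcoef G.n α i j)) = star (U α) i j := by
  rw [← hU.antipode, ev_apply]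
  congr 1

lemma IsUnitaryRep.ev_cone : ev U G.cone = 1 := by
  obtain ⟨α⟩ := ‹Nonempty I›
  have : Nonempty I := ⟨α⟩
  let i : Fin (G.n α) := ⟨0, G.n_pos α⟩
  have h1 := congrArg (ev U) (G.sum_Sd_cmul α i i)
  rw [if_pos rfl, map_sum] at h1
  rw [← h1]
  have h2 := congrFun (congrFun (hU.unitary α).1 i) i
  rw [Matrix.mul_apply, Matrix.one_apply_eq] at h2
  rw [← h2]
  refine Finset.sum_congr rfl fun k _ => ?_
  rw [hU.ev_cmul, hU.ev_Sd_mcoef, ev_mcoef]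

lemma IsUnitaryRep.star_ev (f : coefSub G.n) : star (ev U f) = ev U (G.Sd (cstar f)) := by
  induction f using coef_induction with
  | zero => simp
  | add f g hf hg => simp [hf, hg]
  | smul c f hf => simp [hf]
  | mcoef α i j => rw [cstar_mcoef, hU.ev_Sd_mcoef, ev_mcoef, Matrix.star_apply]

lemma IsUnitaryRep.inner_ev_left (f : coefSub G.n) (ξ η : H) :
    inner ℂ (ev U f ξ) η = inner ℂ ξ (ev U (G.Sd (cstar f)) η) := by
  rw [← hU.star_ev, ContinuousLinearMap.star_eq_adjoint, ContinuousLinearMap.adjoint_inner_right]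

end rep

omit [CompleteSpace H] in
variable (U) in
lemma ev_coeff (ξ η : H) (f : coefSub G.n) :
    ev (V := ℂ) (G.coeff U ξ η) f = inner ℂ ξ (ev U f η) := by
  have : ev (V := ℂ) (G.coeff U ξ η) =
      (innerSL ℂ ξ).toLinearMap ∘ₗ (LinearMap.applyₗ η) ∘ₗ
        (ContinuousLinearMap.coeLM ℂ) ∘ₗ ev U :=
    coef_hom_ext fun α i j => by simp [coeff]
  rw [this]
  rfl

omit [CompleteSpace H] in
variable (U) in
lemma ev_thetaInv_mul_coeff (ξ η : H) (f : coefSub G.n) :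
    ev (V := ℂ) (G.thetaInv φ * G.coeff U ξ η) f =
      inner ℂ ξ (ev U (compL (G.thetaInv φ) f) η) := by
  rw [ev_mul_left, ev_coeff]

omit [CompleteSpace H] in
variable (U φ) in
lemma ev_sigmaVec (T : H →L[ℂ] H) (ξ : H) (f : coefSub G.n) :
    ev (G.sigmaVec φ U T ξ) f = T (ev U (compL (G.thetaInv φ) f) ξ) := by
  have : ev (G.sigmaVec φ U T ξ) =
      T.toLinearMap ∘ₗ (LinearMap.applyₗ ξ) ∘ₗ
        (ContinuousLinearMap.coeLM ℂ) ∘ₗ ev U ∘ₗ compL (G.thetaInv φ) :=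
    coef_hom_ext fun α i j => by
      simp [sigmaVec, compL_mcoef]
  rw [this]
  rfl

section haar

variable [Nonempty I] (hφ : G.IsLeftHaar φ)

include hφ

omit [CompleteSpace H] in
lemma IsLeftHaar.actVec_eq (ξ : H) (a : Alg G.n) :
    G.actVec φ U ξ a = ev U (compL (G.thetaInv φ) (G.four φ a)) ξ := by
  rw [actVec, ev_apply]
  congr 2
  funext y
  change φ (rmul (G.theta φ * G.theta φ) _) = _
  rw [← rmul_rmul, hφ.apply_rmul_theta, lmul_rmul, hφ.apply_rmul_theta, lmul_mul, lmul_lmul _ (G.thetaInv φ),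
    hφ.theta_mul_thetaInv, lmul_one, ← lmul_mul, hφ.kms, hφ.S_S, ← lmul_rmul, lmul_lmul,
    hφ.thetaInv_mul_theta, lmul_one, rmul_rmul, mul_assoc, hφ.thetaInv_mul_theta, mul_one,
    compL_apply, hφ.four_apply, lmul_mul, ← hφ.apply_rmul_thetaInv, mul_rmul]

/-- The functionals `x ↦ k(x^♯)` and `f ↦ f^♯` are compatible with the adjoints of `U`. -/
lemma IsLeftHaar.exists_sharp_functional (k : coefSub G.n) : ∃ k' : coefSub G.n,
    (∀ x, star ((k' : Alg G.n →ₗ[ℂ] ℂ) x) = (k : Alg G.n →ₗ[ℂ] ℂ) (G.sharp φ x)) ∧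
    G.Sd (cstar (compL (G.thetaInv φ) k')) = compL (G.thetaInv φ) k := by
  refine ⟨cstar (G.SdInv (compL (G.thetaInv φ * G.thetaInv φ) k)), fun x => ?_,
    coef_ext fun x => ?_⟩
  · rw [cstar_apply, star_star, SdInv_apply, compL_apply]
    rfl
  · have h1 : star (lmul (G.thetaInv φ) (star (G.S x))) = G.S (lmul (G.theta φ) x) := by
      rw [star_lmul, star_star, hφ.star_thetaInv, hφ.S_lmul_theta]
    rw [Sd_apply, cstar_apply, compL_apply, cstar_apply, star_star, SdInv_apply, compL_apply, h1,
      LinearEquiv.symm_apply_apply, ← lmul_lmul, lmul_lmul _ (G.theta φ), hφ.thetaInv_mul_theta,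
      lmul_one, compL_apply]

lemma IsLeftHaar.apply_conv (k : coefSub G.n) (x a : Alg G.n) :
    (k : Alg G.n →ₗ[ℂ] ℂ) (G.conv φ x a) = (G.cmul k (G.four φ a) : Alg G.n →ₗ[ℂ] ℂ) x := by
  rw [hφ.conv_eq_lact, DiscreteQuantumGroup.apply_lact]

lemma IsLeftHaar.compL_four (a : Alg G.n) :
    compL (G.thetaInv φ) (G.four φ a) = G.four φ (lmul (G.theta φ) a) := by
  refine coef_ext fun x => ?_
  rw [compL_apply, hφ.four_apply, hφ.four_apply, lmul_mul, ← hφ.apply_rmul_thetaInv,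
    hφ.S_lmul_theta, mul_rmul]

end haar

end DiscreteQuantumGroup

end QGrp

/-! ### Covariant representations and the subspace `H₀` -/

namespace QGrp

namespace DiscreteQuantumGroup

variable {I : Type u} {G : DiscreteQuantumGroup I} {φ : Alg G.n →ₗ[ℂ] ℂ}
variable {C : Type w} [NonUnitalCStarAlgebra C]
variable {ΔC : C →⋆ₙₐ[ℂ] MultV G.n C} {C₀ : NonUnitalStarSubalgebra ℂ C} {h : C}
variable {H : Type v} [NormedAddCommGroup H] [InnerProductSpace ℂ H] [CompleteSpace H]
variable {U : MultV G.n (H →L[ℂ] H)} {π : C →⋆ₙₐ[ℂ] (H →L[ℂ] H)}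

lemma apply_mem_H₀ {c : C} (hc : c ∈ C₀) (η : H) : π c η ∈ H₀ C₀ π :=
  Submodule.subset_span ⟨c, hc, η, rfl⟩

lemma H₀_induction {P : H → Prop} (apply : ∀ c ∈ C₀, ∀ η, P (π c η)) (zero : P 0)
    (add : ∀ ξ η, P ξ → P η → P (ξ + η)) (smul : ∀ (c : ℂ) ξ, P ξ → P (c • ξ))
    {ξ : H} (hξ : ξ ∈ H₀ C₀ π) : P ξ := by
  induction hξ using Submodule.span_induction with
  | mem y hy =>
    obtain ⟨c, hc, η, rfl⟩ := hy
    exact apply c hc η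
  | zero => exact zero
  | add y z _ _ hy hz => exact add y z hy hz
  | smul c y _ hy => exact smul c y hy

section covariance

variable [PartialOrder C]

lemma IsProper.Δ_mem (hp : G.IsProper φ ΔC C₀ h) {c : C} (hc : c ∈ C₀) (α : I)
    (i j : Fin (G.n α)) : ΔC c α i j ∈ C₀ := by
  have := (hp.A2 c hc (proj G.n {α})).2 α i j
  simpa [proj_of_mem, Matrix.one_apply] using this

lemma IsProper.exists_Δ_mul_eq_zero (hp : G.IsProper φ ΔC C₀ h) {c c' : C} (hc : c ∈ C₀)
    (hc' : c' ∈ C₀) : ∃ F : Finset I, ∀ α ∉ F, ∀ i j, ΔC c α i j * c' = 0 := by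
  refine ⟨(hp.A1 c hc c' hc').1.toFinset, fun α hα i j => ?_⟩
  have h1 : (Matrix.of fun i j => ΔC c α i j * c') = 0 := by
    by_contra hne
    exact hα (by simpa using hne)
  exact congrFun (congrFun h1 i) j

lemma IsProper.exists_mul_Δ_eq_zero (hp : G.IsProper φ ΔC C₀ h) {c c' : C} (hc : c ∈ C₀)
    (hc' : c' ∈ C₀) : ∃ F : Finset I, ∀ α ∉ F, ∀ i j, c' * ΔC c α i j = 0 := by
  obtain ⟨F, hF⟩ := hp.exists_Δ_mul_eq_zero (star_mem hc) (star_mem hc')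
  refine ⟨F, fun α hα i j => ?_⟩
  have h1 := hF α hα j i
  rw [map_star] at h1
  have h2 := congrArg star h1
  rwa [star_mul, star_star, star_zero, Pi.star_apply, Matrix.star_apply, star_star] at h2

omit [PartialOrder C] in
lemma IsCovariant.apply_apply (hπ : G.IsCovariant ΔC U π) (hU : G.IsUnitaryRep U) (c : C) (α : I)
    (i j : Fin (G.n α)) (η : H) : U α i j (π c η) = ∑ l, π (ΔC c α i l) (U α l j η) := by
  have h1 : (ΔC c α).map π * U α = U α * Matrix.diagonal (fun _ => π c) := by
    rw [hπ.covariant, Matrix.mul_assoc, (hU.unitary α).1, Matrix.mul_one]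
  have h2 := congrArg (fun T : H →L[ℂ] H => T η) (congrFun (congrFun h1 i) j)
  simpa [Matrix.mul_apply, Matrix.diagonal_apply] using h2.symm

lemma IsCovariant.ev_mem_H₀ (hπ : G.IsCovariant ΔC U π) (hU : G.IsUnitaryRep U)
    (hp : G.IsProper φ ΔC C₀ h) (f : coefSub G.n) {ξ : H} (hξ : ξ ∈ H₀ C₀ π) :
    ev U f ξ ∈ H₀ C₀ π := by
  induction f using coef_induction with
  | zero => simp
  | add f g hf hg => simpa using add_mem hf hg
  | smul c f hf => simpa using Submodule.smul_mem _ c hf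
  | mcoef α i j =>
    rw [ev_mcoef]
    refine H₀_induction (P := fun ξ => U α i j ξ ∈ H₀ C₀ π) (fun c hc η => ?_) (by simp)
      (fun ξ η h1 h2 => by simpa using add_mem h1 h2)
      (fun c ξ h1 => by simpa using Submodule.smul_mem _ c h1) hξ
    rw [hπ.apply_apply hU]
    exact sum_mem fun l _ => apply_mem_H₀ (hp.Δ_mem hc α i l) _

lemma IsCovariant.exists_apply_eq_zero (hπ : G.IsCovariant ΔC U π) (hU : G.IsUnitaryRep U)
    (hp : G.IsProper φ ΔC C₀ h) {c' : C} (hc' : c' ∈ C₀) {ξ : H} (hξ : ξ ∈ H₀ C₀ π) :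
    ∃ F : Finset I, ∀ α ∉ F, ∀ i j, π c' (U α i j ξ) = 0 := by
  classical
  refine H₀_induction (P := fun ξ => ∃ F : Finset I, ∀ α ∉ F, ∀ i j, π c' (U α i j ξ) = 0)
    (fun c hc η => ?_) ⟨∅, by simp⟩ ?_ ?_ hξ
  · obtain ⟨F, hF⟩ := hp.exists_mul_Δ_eq_zero hc hc'
    refine ⟨F, fun α hα i j => ?_⟩
    rw [hπ.apply_apply hU, map_sum]
    refine Finset.sum_eq_zero fun l _ => ?_
    rw [← mul_apply_eq_comp, ← map_mul, hF α hα, map_zero]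
    rfl
  · rintro ξ η ⟨F, hF⟩ ⟨F', hF'⟩
    refine ⟨F ∪ F', fun α hα i j => ?_⟩
    rw [Finset.mem_union, not_or] at hα
    rw [map_add, map_add, hF α hα.1, hF' α hα.2, add_zero]
  · rintro c ξ ⟨F, hF⟩
    exact ⟨F, fun α hα i j => by rw [map_smul, map_smul, hF α hα, smul_zero]⟩

lemma IsCovariant.coeff_mem (hπ : G.IsCovariant ΔC U π) (hU : G.IsUnitaryRep U)
    (hp : G.IsProper φ ΔC C₀ h) {ξ η : H} (hξ : ξ ∈ H₀ C₀ π) (hη : η ∈ H₀ C₀ π) :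
    G.coeff U ξ η ∈ finSupp G.n := by
  classical
  obtain ⟨F, hF⟩ : ∃ F : Finset I, ∀ α ∉ F, ∀ i j, inner ℂ ξ (U α i j η) = 0 := by
    refine H₀_induction (P := fun ξ => ∃ F : Finset I, ∀ α ∉ F, ∀ i j, inner ℂ ξ (U α i j η) = 0)
      (fun c hc ζ => ?_) ⟨∅, by simp⟩ ?_ ?_ hξ
    · obtain ⟨F, hF⟩ := hπ.exists_apply_eq_zero hU hp (star_mem hc) hη
      refine ⟨F, fun α hα i j => ?_⟩
      rw [← ContinuousLinearMap.adjoint_inner_right, ← ContinuousLinearMap.star_eq_adjoint,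
        ← map_star, hF α hα, inner_zero_right]
    · rintro ξ ξ' ⟨F, hF⟩ ⟨F', hF'⟩
      refine ⟨F ∪ F', fun α hα i j => ?_⟩
      rw [Finset.mem_union, not_or] at hα
      rw [inner_add_left, hF α hα.1, hF' α hα.2, add_zero]
    · rintro c ξ ⟨F, hF⟩
      exact ⟨F, fun α hα i j => by rw [inner_smul_left, hF α hα, mul_zero]⟩
  refine F.finite_toSet.subset fun α hα => ?_
  by_contra hc
  refine hα ?_
  ext i j
  exact hF α hc i j

lemma IsCovariant.sigmaVec_finite (hπ : G.IsCovariant ΔC U π) (hU : G.IsUnitaryRep U)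
    (hp : G.IsProper φ ΔC C₀ h) {ξ : H} (hξ : ξ ∈ H₀ C₀ π) :
    {α | G.sigmaVec φ U (π h) ξ α ≠ 0}.Finite := by
  obtain ⟨F, hF⟩ := hπ.exists_apply_eq_zero hU hp hp.h_mem hξ
  refine F.finite_toSet.subset fun α hα => ?_
  by_contra hc
  refine hα ?_
  ext i j
  simp [sigmaVec, hF α hc]

end covariance

end DiscreteQuantumGroup

end QGrp

/-! ### The module structure on `H₀` and its embedding in the free module -/

namespace QGrp

namespace DiscreteQuantumGroup

variable {I : Type u} {G : DiscreteQuantumGroup I} {φ : Alg G.n →ₗ[ℂ] ℂ}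
variable {C : Type w} [NonUnitalCStarAlgebra C] [PartialOrder C]
variable {ΔC : C →⋆ₙₐ[ℂ] MultV G.n C} {C₀ : NonUnitalStarSubalgebra ℂ C} {h : C}
variable {H : Type v} [NormedAddCommGroup H] [InnerProductSpace ℂ H] [CompleteSpace H]
variable {U : MultV G.n (H →L[ℂ] H)} {π : C →⋆ₙₐ[ℂ] (H →L[ℂ] H)}

section maps

variable (φ) (hπ : G.IsCovariant ΔC U π) (hU : G.IsUnitaryRep U) (hp : G.IsProper φ ΔC C₀ h)

/-- The right action `ξ.a` on `H₀`. -/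
def modAct : H₀ C₀ π →ₗ[ℂ] Alg G.n →ₗ[ℂ] H₀ C₀ π :=
  LinearMap.mk₂ ℂ
    (fun ξ a => ⟨ev U (compL (G.thetaInv φ) (G.four φ a)) ξ, hπ.ev_mem_H₀ hU hp _ ξ.2⟩)
    (fun ξ η a => Subtype.ext (by simp)) (fun c ξ a => Subtype.ext (by simp))
    (fun ξ a b => Subtype.ext (by simp)) (fun c ξ a => Subtype.ext (by simp))

/-- The inner product `θ⁻¹ T_{ξη}(U)` on `H₀`. -/
def modInner : H₀ C₀ π →ₗ⋆[ℂ] H₀ C₀ π →ₗ[ℂ] Alg G.n :=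
  LinearMap.mk₂'ₛₗ (starRingEnd ℂ) (RingHom.id ℂ)
    (fun ξ η => lmul (G.thetaInv φ) ⟨G.coeff U ξ η, hπ.coeff_mem hU hp ξ.2 η.2⟩)
    (fun ξ ξ' η => by
      rw [← map_add]
      congr 1
      apply Subtype.ext
      funext α
      ext i j
      simp [coeff])
    (fun c ξ η => by
      rw [← map_smul]
      congr 1
      apply Subtype.ext
      funext α
      ext i j
      simp [coeff, mul_comm])
    (fun ξ η η' => by
      rw [← map_add]
      congr 1
      apply Subtype.ext
      funext α
      ext i j
      simp [coeff])
    (fun c ξ η => by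
      rw [RingHom.id_apply, ← map_smul]
      congr 1
      apply Subtype.ext
      funext α
      ext i j
      simp [coeff])

/-- The embedding `Σ` of `H₀` in the free module. -/
def modSigma : H₀ C₀ π →ₗ[ℂ] H ⊗[ℂ] Alg G.n where
  toFun ξ := (exists_toMultV_eq (hπ.sigmaVec_finite hU hp ξ.2)).choose
  map_add' ξ η := by
    apply toMultV_injective
    rw [map_add, (exists_toMultV_eq (hπ.sigmaVec_finite hU hp ξ.2)).choose_spec,
      (exists_toMultV_eq (hπ.sigmaVec_finite hU hp η.2)).choose_spec,
      (exists_toMultV_eq (hπ.sigmaVec_finite hU hp (ξ + η).2)).choose_spec]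
    funext α
    ext i j
    simp [sigmaVec, Finset.sum_add_distrib]
  map_smul' c ξ := by
    apply toMultV_injective
    rw [map_smul, (exists_toMultV_eq (hπ.sigmaVec_finite hU hp ξ.2)).choose_spec,
      (exists_toMultV_eq (hπ.sigmaVec_finite hU hp (c • ξ).2)).choose_spec]
    funext α
    ext i j
    simp [sigmaVec, Finset.smul_sum, smul_comm c]

lemma toMultV_modSigma (ξ : H₀ C₀ π) :
    toMultV (modSigma φ hπ hU hp ξ) = G.sigmaVec φ U (π h) ξ :=
  (exists_toMultV_eq (hπ.sigmaVec_finite hU hp ξ.2)).choose_spec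

lemma coe_modInner (ξ η : H₀ C₀ π) :
    (modInner φ hπ hU hp ξ η : Mult G.n) = G.thetaInv φ * G.coeff U ξ η := rfl

lemma coe_modAct (ξ : H₀ C₀ π) (a : Alg G.n) : (modAct φ hπ hU hp ξ a : H) =
    ev U (compL (G.thetaInv φ) (G.four φ a)) ξ := rfl

lemma apply_modInner (ξ η : H₀ C₀ π) (g : coefSub G.n) :
    (g : Alg G.n →ₗ[ℂ] ℂ) (modInner φ hπ hU hp ξ η) =
      inner ℂ (ξ : H) (ev U (compL (G.thetaInv φ) g) (η : H)) := by
  rw [← ev_coe, coe_modInner, ev_thetaInv_mul_coeff]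

end maps

section free

variable (φ) in
omit [CompleteSpace H] in
lemma freeInner_tmul (ξ η : H) (a b : Alg G.n) :
    G.freeInner φ (ξ ⊗ₜ a) (η ⊗ₜ b) = inner ℂ ξ η • G.conv φ (G.sharp φ a) b := by
  simp [freeInner]

variable (φ) in
omit [CompleteSpace H] in
lemma freeAct_tmul (ξ : H) (a b : Alg G.n) :
    G.freeAct φ (ξ ⊗ₜ a) b = ξ ⊗ₜ G.conv φ a b := by
  simp [freeAct]

end free

section identities

variable [Nonempty I] (hφ : G.IsLeftHaar φ)
variable (hπ : G.IsCovariant ΔC U π) (hU : G.IsUnitaryRep U) (hp : G.IsProper φ ΔC C₀ h)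

include hφ

lemma IsLeftHaar.modAct_modAct (ξ : H₀ C₀ π) (a b : Alg G.n) :
    modAct φ hπ hU hp (modAct φ hπ hU hp ξ a) b = modAct φ hπ hU hp ξ (G.conv φ a b) := by
  apply Subtype.ext
  rw [coe_modAct, coe_modAct, coe_modAct, hφ.four_conv, hφ.compL_thetaInv_cmul, hU.ev_cmul]
  rfl

lemma IsLeftHaar.modSigma_modAct (ξ : H₀ C₀ π) (a : Alg G.n) :
    modSigma φ hπ hU hp (modAct φ hπ hU hp ξ a) = G.freeAct φ (modSigma φ hπ hU hp ξ) a := by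
  apply toMultV_injective
  refine multV_ext fun f => ?_
  rw [freeAct, ev_toMultV_lTensor (f' := G.cmul f (G.four φ a)) _ (fun x => ?_), toMultV_modSigma,
    toMultV_modSigma, ev_sigmaVec, ev_sigmaVec, coe_modAct, hφ.compL_thetaInv_cmul, hU.ev_cmul]
  · rfl
  · rw [LinearMap.flip_apply, hφ.apply_conv]

lemma IsLeftHaar.modInner_modAct (ξ η : H₀ C₀ π) (a : Alg G.n) :
    modInner φ hπ hU hp ξ (modAct φ hπ hU hp η a) =
      G.conv φ (modInner φ hπ hU hp ξ η) a := by
  refine alg_ext fun g => ?_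
  rw [hφ.apply_conv, apply_modInner, apply_modInner, coe_modAct, hφ.compL_thetaInv_cmul,
    hU.ev_cmul]
  rfl

lemma IsLeftHaar.sharp_modInner (ξ η : H₀ C₀ π) :
    G.sharp φ (modInner φ hπ hU hp ξ η) = modInner φ hπ hU hp η ξ := by
  refine alg_ext fun g => ?_
  obtain ⟨k', h1, h2⟩ := hφ.exists_sharp_functional g
  rw [← h1, apply_modInner, apply_modInner]
  change starRingEnd ℂ _ = _
  rw [inner_conj_symm, hU.inner_ev_left, h2]

omit hφ [Nonempty I] in
lemma compL_compL {m m' : Mult G.n} (hm : m' * m = 1) (f : coefSub G.n) :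
    compL m (compL m' f) = f :=
  coef_ext fun x => by rw [compL_apply, compL_apply, lmul_lmul, hm, lmul_one]

lemma IsLeftHaar.eq_zero_of_modInner_self (ξ : H₀ C₀ π) (hξ : modInner φ hπ hU hp ξ ξ = 0) :
    ξ = 0 := by
  have h1 := apply_modInner φ hπ hU hp ξ ξ (compL (G.theta φ) G.cone)
  rw [hξ, map_zero, compL_compL hφ.theta_mul_thetaInv, hU.ev_cone] at h1
  exact Subtype.ext (inner_self_eq_zero.mp h1.symm)

variable (U) in
omit [Nonempty I] hφ [CompleteSpace H] in
/-- The map `w ⊗ b ↦ U(L(b)) T w`. -/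
def synth (T : H →L[ℂ] H) (L : Alg G.n →ₗ[ℂ] coefSub G.n) : H ⊗[ℂ] Alg G.n →ₗ[ℂ] H :=
  TensorProduct.lift (LinearMap.mk₂ ℂ (fun w b => ev U (L b) (T w))
    (fun w w' b => by simp) (fun c w b => by simp) (fun w b b' => by simp)
    (fun c w b => by simp))

omit [Nonempty I] hφ [CompleteSpace H] in
lemma synth_tmul (T : H →L[ℂ] H) (L : Alg G.n →ₗ[ℂ] coefSub G.n) (w : H) (b : Alg G.n) :
    synth U T L (w ⊗ₜ b) = ev U (L b) (T w) := rfl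

omit [CompleteSpace H] in
lemma IsLeftHaar.apply_freeInner_tmul (y : H ⊗[ℂ] Alg G.n) (w : H) (b : Alg G.n)
    {g k' : coefSub G.n} (hk : ∀ x, star ((k' : Alg G.n →ₗ[ℂ] ℂ) x) =
      (G.cmul g (G.four φ b) : Alg G.n →ₗ[ℂ] ℂ) (G.sharp φ x)) :
    (g : Alg G.n →ₗ[ℂ] ℂ) (G.freeInner φ y (w ⊗ₜ b)) = inner ℂ (ev (toMultV y) k') w := by
  induction y with
  | zero => simp
  | add y z hy hz =>
    simp only [map_add, LinearMap.add_apply, inner_add_left, hy, hz]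
  | tmul v a =>
    rw [freeInner_tmul, map_smul, hφ.apply_conv, ← hk, ev_toMultV_tmul, inner_smul_left,
      smul_eq_mul, mul_comm]
    rfl

/-- The inner product of the free module against the range of `Σ`. -/
lemma IsLeftHaar.apply_freeInner_modSigma (hT : star h = h) (ξ : H₀ C₀ π) (y : H ⊗[ℂ] Alg G.n)
    (g : coefSub G.n) :
    (g : Alg G.n →ₗ[ℂ] ℂ) (G.freeInner φ (modSigma φ hπ hU hp ξ) y) =
      inner ℂ (ξ : H) (ev U (compL (G.thetaInv φ) g)
        (synth U (π h) (compL (G.thetaInv φ) ∘ₗ G.four φ) y)) := by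
  induction y with
  | zero => simp
  | add y z hy hz => simp [hy, hz]
  | tmul w b =>
    obtain ⟨k', h1, h2⟩ := hφ.exists_sharp_functional (G.cmul g (G.four φ b))
    have hstar : ContinuousLinearMap.adjoint (π h) = π h :=
      (StarHomClass.map_star π h).symm.trans (congrArg π hT)
    rw [hφ.apply_freeInner_tmul _ w b h1, toMultV_modSigma, ev_sigmaVec,
      ← ContinuousLinearMap.adjoint_inner_right, hstar, hU.inner_ev_left, h2,
      hφ.compL_thetaInv_cmul, hU.ev_cmul]
    rfl

/-- The operator `synth` is a left inverse of `Σ`, by the normalization of `h`. -/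
lemma IsLeftHaar.synth_modSigma (η : H₀ C₀ π) :
    synth U (π h) (compL (G.thetaInv φ) ∘ₗ G.four φ) (modSigma φ hπ hU hp η) = η := by
  classical
  let Q : Alg G.n →ₗ[ℂ] Alg G.n := G.S.toLinearMap ∘ₗ lmul (G.theta φ)
  let L' : Alg G.n →ₗ[ℂ] coefSub G.n := G.four φ ∘ₗ G.S.symm.toLinearMap
  have hQ : ∀ y, synth U (π h) (compL (G.thetaInv φ) ∘ₗ G.four φ) y =
      synth U (π h) L' (Q.lTensor H y) := fun y => by
    induction y with
    | zero => simp
    | add y z hy hz => simp [hy, hz]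
    | tmul w b =>
      rw [LinearMap.lTensor_tmul, synth_tmul, synth_tmul, LinearMap.comp_apply, hφ.compL_four]
      simp [L', Q]
  have hy : ∀ γ s t, toMultV (Q.lTensor H (modSigma φ hπ hU hp η)) γ s t =
      π h (star (U γ) s t η) := fun γ s t => by
    rw [← ev_mcoef (toMultV _), ev_toMultV_lTensor
      (f' := compL (G.theta φ) (G.Sd (mcoef G.n γ s t))) _ (fun x => rfl), toMultV_modSigma,
      ev_sigmaVec, compL_compL hφ.theta_mul_thetaInv, hU.ev_Sd_mcoef]
  have hL : ∀ γ (s t : Fin (G.n γ)), L' (unit G.n γ s t) =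
      ∑ r, φ (unit G.n γ r t) • mcoef G.n γ r s := fun γ s t => coef_ext fun x => by
    have h1 := apply_mul_unit (φ := φ) x γ s t
    simp only [L', LinearMap.comp_apply, LinearEquiv.coe_coe, hφ.four_apply,
      LinearEquiv.apply_symm_apply, h1]
    simp [Matrix.mul_apply, rho]
  have hcov : ∀ γ (r t : Fin (G.n γ)) (ζ : H),
      ∑ s, U γ r s (π h (π h (star (U γ) s t ζ))) = π (ΔC (h * h) γ r t) ζ := fun γ r t ζ => by
    have h1 := congrArg (fun T : H →L[ℂ] H => T ζ)
      (congrFun (congrFun (hπ.covariant (h * h) γ) r) t)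
    simpa [Matrix.mul_apply, Matrix.diagonal_apply] using h1.symm
  have key : ∀ ξ (hξ : ξ ∈ H₀ C₀ π), ∃ F : Finset I, ∀ F', F ⊆ F' →
      ∑ γ ∈ F', ∑ r, ∑ t, φ (unit G.n γ r t) • π (ΔC (h * h) γ r t) ξ = ξ := fun ξ hξ => by
    refine H₀_induction (P := fun ξ => ∃ F : Finset I, ∀ F', F ⊆ F' →
      ∑ γ ∈ F', ∑ r, ∑ t, φ (unit G.n γ r t) • π (ΔC (h * h) γ r t) ξ = ξ)
      (fun c hc ζ => ?_) ⟨∅, by simp⟩ ?_ ?_ hξ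
    · obtain ⟨F, hF⟩ := hp.exists_Δ_mul_eq_zero (mul_mem hp.h_mem hp.h_mem) hc
      refine ⟨F, fun F' hF' => ?_⟩
      have h1 := hp.A3 c hc
      rw [slice_eq_sum' (F := F')] at h1
      · have h2 := congrArg (fun T => π T ζ) h1
        simp only [map_sum, map_smul, Matrix.of_apply, map_mul] at h2
        simpa using h2
      · intro γ hγ
        ext i j
        exact hF γ (fun hc => hγ (hF' hc)) i j
    · rintro ξ ξ' ⟨F, hF⟩ ⟨F₂, hF₂⟩
      refine ⟨F ∪ F₂, fun F' hF' => ?_⟩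
      simp only [map_add, smul_add, Finset.sum_add_distrib]
      rw [hF F' (Finset.union_subset_left hF'), hF₂ F' (Finset.union_subset_right hF')]
    · rintro c ξ ⟨F, hF⟩
      refine ⟨F, fun F' hF' => ?_⟩
      conv_rhs => rw [← hF F' hF']
      simp only [map_smul, Finset.smul_sum, smul_comm c]
  obtain ⟨F, hF⟩ := key η η.2
  obtain ⟨F₂, hF₂⟩ := exists_eq_sum_tmul (Q.lTensor H (modSigma φ hπ hU hp η))
  rw [hQ, hF₂ (F ∪ F₂) Finset.subset_union_right]
  conv_rhs => rw [← hF (F ∪ F₂) Finset.subset_union_left]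
  simp only [map_sum, synth_tmul, hy, hL, map_smul]
  refine Finset.sum_congr rfl fun γ _ => ?_
  simp only [← hcov, Finset.smul_sum]
  simp only [sum_apply, ev_mcoef, smul_apply]
  rw [Finset.sum_comm]
  conv_rhs => rw [Finset.sum_comm]
  exact Finset.sum_congr rfl fun t _ => Finset.sum_comm

/-- `Σ` preserves inner products. -/
lemma IsLeftHaar.freeInner_modSigma (hT : star h = h) (ξ η : H₀ C₀ π) :
    G.freeInner φ (modSigma φ hπ hU hp ξ) (modSigma φ hπ hU hp η) = modInner φ hπ hU hp ξ η :=
  alg_ext fun g => by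
    rw [hφ.apply_freeInner_modSigma hπ hU hp hT, hφ.synth_modSigma, apply_modInner]

end identities

section positivity

omit [CompleteSpace H] in
lemma exists_orthonormal_sum {A : Type*} [AddCommGroup A] [Module ℂ A] (y : H ⊗[ℂ] A) :
    ∃ (k : ℕ) (e : Fin k → H) (b : Fin k → A), Orthonormal ℂ e ∧ y = ∑ i, e i ⊗ₜ[ℂ] b i := by
  obtain ⟨W, hW, hy⟩ := TensorProduct.exists_finite_submodule_left_of_setFinite {y}
    (Set.finite_singleton y)
  obtain ⟨z, rfl⟩ := hy rfl
  let e := stdOrthonormalBasis ℂ W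
  refine ⟨_, fun i => (e i : H), ?_⟩
  have h1 : Orthonormal ℂ fun i => (e i : H) := e.orthonormal.comp_linearIsometry W.subtypeₗᵢ
  clear hy
  obtain ⟨b, rfl⟩ : ∃ b : Fin (Module.finrank ℂ W) → A, z = ∑ i, e i ⊗ₜ[ℂ] b i := by
    induction z with
    | zero => exact ⟨0, by simp⟩
    | add y z hy hz =>
      obtain ⟨b, rfl⟩ := hy
      obtain ⟨b', rfl⟩ := hz
      exact ⟨b + b', by simp [TensorProduct.tmul_add, Finset.sum_add_distrib]⟩
    | tmul v a =>
      refine ⟨fun i => inner ℂ (e i) v • a, ?_⟩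
      simp_rw [← TensorProduct.smul_tmul, ← TensorProduct.sum_tmul]
      rw [e.sum_repr' v]
  exact ⟨b, h1, by simp⟩

variable (φ) in
omit [CompleteSpace H] in
lemma exists_freeInner_self_eq_sum (y : H ⊗[ℂ] Alg G.n) : ∃ (k : ℕ) (b : Fin k → Alg G.n),
    G.freeInner φ y y = ∑ i, G.conv φ (G.sharp φ (b i)) (b i) := by
  obtain ⟨k, e, b, he, rfl⟩ := exists_orthonormal_sum y
  refine ⟨k, b, ?_⟩
  simp only [map_sum, LinearMap.sum_apply, freeInner_tmul, orthonormal_iff_ite.mp he]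
  simp

end positivity

end DiscreteQuantumGroup

end QGrp

/-! ### Completion of modules with a C*-valued inner product -/

namespace QGrp

section completion

/-- Every seminormed space has a completion. -/
lemma exists_completion {M : Type x} [AddCommGroup M] [Module ℂ M] (p : Seminorm ℂ M) :
    ∃ (E : Type x) (_ : NormedAddCommGroup E) (_ : NormedSpace ℂ E) (_ : CompleteSpace E)
      (ι : M →ₗ[ℂ] E), DenseRange ι ∧ ∀ y, ‖ι y‖ = p y := by
  let := AddGroupSeminorm.toSeminormedAddCommGroup p.toAddGroupSeminorm
  let : NormedSpace ℂ M := ⟨fun c y => (map_smul_eq_mul p c y).le⟩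
  refine ⟨UniformSpace.Completion M, inferInstance, inferInstance, inferInstance,
    (UniformSpace.Completion.toComplₗᵢ (𝕜 := ℂ) (E := M)).toLinearMap,
    UniformSpace.Completion.denseRange_coe, fun y => ?_⟩
  exact UniformSpace.Completion.norm_coe y

/-- A bounded (semi-)bilinear map extends to the completions. -/
lemma exists_bilinear_extension {σ : ℂ →+* ℂ} [RingHomIsometric σ] {M M' N N' E : Type*}
    [AddCommGroup M] [Module ℂ M] [NormedAddCommGroup M'] [NormedSpace ℂ M']
    [AddCommGroup N] [Module ℂ N] [NormedAddCommGroup N'] [NormedSpace ℂ N']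
    [NormedAddCommGroup E] [NormedSpace ℂ E] [CompleteSpace E]
    {e : M →ₗ[ℂ] M'} (he : DenseRange e) {e' : N →ₗ[ℂ] N'} (he' : DenseRange e')
    (f : M →ₛₗ[σ] N →ₗ[ℂ] E) (hf : ∀ y z, ‖f y z‖ ≤ ‖e y‖ * ‖e' z‖) :
    ∃ g : M' →SL[σ] N' →L[ℂ] E, ∀ y z, g (e y) (e' z) = f y z := by
  let T : M →ₛₗ[σ] N' →L[ℂ] E :=
    { toFun := fun y => (f y).extendOfNorm e'
      map_add' := fun y y' => by
        refine LinearMap.extendOfNorm_unique he' (‖e (y + y')‖) (hf _) _ ?_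
        ext z
        simp [LinearMap.extendOfNorm_eq he' ⟨_, hf y⟩, LinearMap.extendOfNorm_eq he' ⟨_, hf y'⟩]
      map_smul' := fun c y => by
        refine LinearMap.extendOfNorm_unique he' (‖e (c • y)‖) (hf _) _ ?_
        ext z
        simp [LinearMap.extendOfNorm_eq he' ⟨_, hf y⟩] }
  have hT : ∀ y, ‖T y‖ ≤ 1 * ‖e y‖ := fun y => by
    rw [one_mul]
    exact LinearMap.opNorm_extendOfNorm_le he' (norm_nonneg _) (hf y)
  refine ⟨T.extendOfNorm e, fun y z => ?_⟩
  rw [LinearMap.extendOfNorm_eq he ⟨1, hT⟩]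
  exact LinearMap.extendOfNorm_eq he' ⟨_, hf y⟩ z

variable {B : Type w} [NonUnitalCStarAlgebra B] {A : Type*} [AddCommGroup A] [Module ℂ A]
variable {M : Type x} [AddCommGroup M] [Module ℂ M]

/-- The Cauchy–Schwarz inequality for a `B`-valued inner product on a right module over a dense
subspace of `B`. -/
lemma norm_inner_sq_le {j : A →ₗ[ℂ] B} (hj : DenseRange j) {act : M →ₗ[ℂ] A →ₗ[ℂ] M}
    {ip : M →ₗ⋆[ℂ] M →ₗ[ℂ] B} (h_act : ∀ y z a, ip y (act z a) = ip y z * j a)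
    (h_star : ∀ y z, star (ip y z) = ip z y) (h_pos : ∀ y, ∃ b, ip y y = star b * b) (y z : M) :
    ‖ip y z‖ ^ 2 ≤ ‖ip y y‖ * ‖ip z z‖ := by
  let := CStarAlgebra.spectralOrder B
  have := CStarAlgebra.spectralOrderedRing B
  have hnn : ∀ y, 0 ≤ ip y y := fun y => by
    obtain ⟨b, hb⟩ := h_pos y
    rw [hb]
    exact star_mul_self_nonneg b
  have h_act' : ∀ y z a, ip (act y a) z = star (j a) * ip y z := fun y z a => by
    rw [← h_star, h_act, star_mul, h_star]
  have h1 : ∀ b : B, 0 ≤ star b * ip y y * b - star b * ip y z - ip z y * b + ip z z := fun b => by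
    refine hj.induction_on b ?_ fun a => ?_
    · exact CStarAlgebra.isClosed_nonneg.preimage (f := fun b : B =>
        star b * ip y y * b - star b * ip y z - ip z y * b + ip z z) (by fun_prop)
    · have := hnn (act y a - z)
      simp only [map_sub, LinearMap.sub_apply, h_act, h_act'] at this
      convert this using 1
      abel
  have h2 : ∀ N : ℝ, ‖ip y y‖ < N → ‖ip y z‖ ^ 2 ≤ N * ‖ip z z‖ := fun N hN => by
    have hN0 : 0 < N := (norm_nonneg _).trans_lt hN
    set d := ip y z with hd
    have h3 : star d * ip y y * d ≤ N • (star d * d) :=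
      (CStarAlgebra.star_left_conjugate_le_norm_smul (.of_nonneg (hnn y))).trans
        (smul_le_smul_of_nonneg_right hN.le (star_mul_self_nonneg d))
    have h4 := h1 (((N⁻¹ : ℝ) : ℂ) • d)
    have h5 : ip z y = star d := (h_star y z).symm
    simp only [star_smul, smul_mul_assoc, mul_smul_comm, h5, star_trivial,
      Complex.coe_smul] at h4
    have h6 : star d * d ≤ N • ip z z := by
      have h7 : N⁻¹ • N⁻¹ • (star d * ip y y * d) ≤ N⁻¹ • (star d * d) := by
        refine smul_le_smul_of_nonneg_left ?_ (inv_nonneg.mpr hN0.le)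
        calc N⁻¹ • (star d * ip y y * d) ≤ N⁻¹ • N • (star d * d) :=
              smul_le_smul_of_nonneg_left h3 (inv_nonneg.mpr hN0.le)
          _ = star d * d := inv_smul_smul₀ hN0.ne' _
      have h8 : 0 ≤ ip z z - N⁻¹ • (star d * d) := by
        refine h4.trans ?_
        rw [← sub_nonneg]
        refine (sub_nonneg.mpr h7).trans_eq ?_
        abel
      calc star d * d = N • N⁻¹ • (star d * d) := (smul_inv_smul₀ hN0.ne' _).symm
        _ ≤ N • ip z z := smul_le_smul_of_nonneg_left (sub_nonneg.mp h8) hN0.le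
    have h9 := CStarAlgebra.norm_le_norm_of_nonneg_of_le (star_mul_self_nonneg d) h6
    rwa [CStarRing.norm_star_mul_self, ← sq, norm_smul, Real.norm_of_nonneg hN0.le] at h9
  refine le_of_forall_gt_imp_ge_of_dense fun t ht => ?_
  rcases (norm_nonneg (ip z z)).eq_or_lt with h0 | h0
  · refine (h2 (‖ip y y‖ + 1) (lt_add_one _)).trans ?_
    rw [← h0, mul_zero] at ht ⊢
    exact ht.le
  · have := h2 (t / ‖ip z z‖) (by rwa [lt_div_iff₀ h0])
    rwa [div_mul_cancel₀ _ h0.ne'] at this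

/-- A right module over a dense subspace of a C*-algebra `B`, with a positive `B`-valued inner
product, completes to a Hilbert `B`-module. -/
theorem exists_hilbertModule_completion {j : A →ₗ[ℂ] B} (hj : DenseRange j)
    {act : M →ₗ[ℂ] A →ₗ[ℂ] M} {ip : M →ₗ⋆[ℂ] M →ₗ[ℂ] B}
    (h_act : ∀ y z a, ip y (act z a) = ip y z * j a)
    (h_star : ∀ y z, star (ip y z) = ip z y) (h_pos : ∀ y, ∃ b, ip y y = star b * b) :
    ∃ (E : Type x) (_ : NormedAddCommGroup E) (_ : NormedSpace ℂ E) (_ : CompleteSpace E)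
      (𝓔 : HilbertModule B E) (ι : M →ₗ[ℂ] E), DenseRange ι ∧
      (∀ y a, ι (act y a) = 𝓔.act (ι y) (j a)) ∧ (∀ y z, 𝓔.inner (ι y) (ι z) = ip y z) ∧
      Continuous (fun q : E × B => 𝓔.act q.1 q.2) ∧
      Continuous (fun q : E × E => 𝓔.inner q.1 q.2) := by
  have hcs := norm_inner_sq_le hj h_act h_star h_pos
  have hcs' : ∀ y z, ‖ip y z‖ ≤ √‖ip y y‖ * √‖ip z z‖ := fun y z => by
    rw [← Real.sqrt_mul (norm_nonneg _)]
    exact Real.le_sqrt_of_sq_le (hcs y z)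
  have h_act' : ∀ y z a, ip (act y a) z = star (j a) * ip y z := fun y z a => by
    rw [← h_star, h_act, star_mul, h_star]
  let p : Seminorm ℂ M := Seminorm.of (fun y => √‖ip y y‖)
    (fun y z => by
      refine Real.sqrt_le_iff.mpr ⟨by positivity, ?_⟩
      have h1 : ip (y + z) (y + z) = ip y y + ip y z + (ip z y + ip z z) := by
        simp only [map_add, LinearMap.add_apply]
        abel
      have h2 := hcs' y z
      have h3 := hcs' z y
      have h4 := norm_add_le (ip y y + ip y z) (ip z y + ip z z)
      have h5 := norm_add_le (ip y y) (ip y z)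
      have h6 := norm_add_le (ip z y) (ip z z)
      rw [h1, add_sq, Real.sq_sqrt (norm_nonneg _), Real.sq_sqrt (norm_nonneg _)]
      linarith)
    (fun c y => by
      rw [map_smul, map_smulₛₗ, LinearMap.smul_apply, smul_smul, norm_smul,
        Real.sqrt_mul (norm_nonneg _)]
      congr 1
      rw [norm_mul, RCLike.norm_conj, Real.sqrt_mul_self (norm_nonneg _)])
  have hp : ∀ y, p y = √‖ip y y‖ := fun y => rfl
  obtain ⟨E, _, _, _, ι, hι, hn⟩ := exists_completion p
  obtain ⟨inn, hinn⟩ := exists_bilinear_extension hι hι ip fun y z => by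
    rw [hn, hn]
    exact hcs' y z
  obtain ⟨ac, hac⟩ := exists_bilinear_extension hι hj (act.compr₂ ι) fun y a => by
    rw [LinearMap.compr₂_apply, hn, hn, hp, hp, h_act, h_act']
    refine Real.sqrt_le_iff.mpr ⟨by positivity, ?_⟩
    rw [mul_pow, Real.sq_sqrt (norm_nonneg _)]
    refine (norm_mul_le _ _).trans ?_
    refine (mul_le_mul_of_nonneg_right (norm_mul_le _ _) (norm_nonneg _)).trans ?_
    rw [norm_star]
    exact le_of_eq (by ring)
  have hstar : ∀ y z, star (inn y z) = inn z y := fun y z => by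
    refine hι.induction_on y (isClosed_eq (by fun_prop) (by fun_prop)) fun y => ?_
    refine hι.induction_on z (isClosed_eq (by fun_prop) (by fun_prop)) fun z => ?_
    rw [hinn, hinn, h_star]
  have hact : ∀ y z b, inn y (ac z b) = inn y z * b := fun y z b => by
    refine hι.induction_on y (isClosed_eq (by fun_prop) (by fun_prop)) fun y => ?_
    refine hι.induction_on z (isClosed_eq (by fun_prop) (by fun_prop)) fun z => ?_
    refine hj.induction_on b (isClosed_eq (by fun_prop) (by fun_prop)) fun a => ?_
    rw [hac, LinearMap.compr₂_apply, hinn, hinn, h_act]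
  have hnorm : ∀ y, ‖y‖ ^ 2 = ‖inn y y‖ := fun y => by
    refine hι.induction_on y (isClosed_eq (by fun_prop) (by fun_prop)) fun y => ?_
    rw [hinn, hn, hp, Real.sq_sqrt (norm_nonneg _)]
  have hpos : ∀ y, ∃ b, inn y y = star b * b := fun y => by
    let := CStarAlgebra.spectralOrder B
    have := CStarAlgebra.spectralOrderedRing B
    refine CStarAlgebra.nonneg_iff_eq_star_mul_self.mp ?_
    refine hι.induction_on y
      (CStarAlgebra.isClosed_nonneg.preimage (f := fun y => inn y y) (by fun_prop)) fun y => ?_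
    obtain ⟨b, hb⟩ := h_pos y
    rw [hinn, hb]
    exact star_mul_self_nonneg b
  let acl : E →ₗ[ℂ] B →ₗ[ℂ] E := LinearMap.mk₂ ℂ (fun y b => ac y b) (fun _ _ _ => by simp)
    (fun _ _ _ => by simp) (fun _ _ _ => by simp) (fun _ _ _ => by simp)
  let innl : E →ₗ⋆[ℂ] E →ₗ[ℂ] B := LinearMap.mk₂'ₛₗ (starRingEnd ℂ) (RingHom.id ℂ)
    (fun y z => inn y z) (fun _ _ _ => by simp) (fun _ _ _ => by simp) (fun _ _ _ => by simp)
    (fun _ _ _ => by simp)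
  refine ⟨E, inferInstance, inferInstance, inferInstance,
    { act := acl
      act_mul := fun y b c => ?_
      inner := innl
      inner_act := hact
      star_inner := hstar
      inner_self_nonneg := hpos
      norm_sq := hnorm }, ι, hι, fun y a => (hac y a).symm, hinn, ?_, ?_⟩
  · refine sub_eq_zero.mp (norm_eq_zero.mp (pow_eq_zero_iff two_ne_zero |>.mp ?_))
    have h1 : ∀ z, inn z (ac y (b * c) - ac (ac y b) c) = 0 := fun z => by
      rw [map_sub, hact, hact, hact, mul_assoc, sub_self]
    change ‖ac y (b * c) - ac (ac y b) c‖ ^ 2 = 0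
    rw [hnorm, h1, norm_zero]
  · change Continuous fun q : E × B => ac q.1 q.2
    fun_prop
  · change Continuous fun q : E × E => inn q.1 q.2
    fun_prop

end completion

end QGrp

/-! ### Hilbert modules over completions of `Â₀` -/

namespace QGrp

/-- A finite sum of positive elements of a C*-algebra is positive. -/
lemma exists_sum_star_mul_self {B : Type w} [NonUnitalCStarAlgebra B] {κ : Type*} [Fintype κ]
    (b : κ → B) : ∃ c, ∑ i, star (b i) * b i = star c * c := by
  let := CStarAlgebra.spectralOrder B
  have := CStarAlgebra.spectralOrderedRing B
  exact CStarAlgebra.nonneg_iff_eq_star_mul_self.mp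
    (Finset.sum_nonneg fun i _ => star_mul_self_nonneg (b i))

namespace DiscreteQuantumGroup

variable {I : Type u} {G : DiscreteQuantumGroup I} {φ : Alg G.n →ₗ[ℂ] ℂ}

section free

variable {H : Type v} [NormedAddCommGroup H] [InnerProductSpace ℂ H]

variable (G φ H) in
/-- The right action of `Â₀` on the free module, as a bilinear map. -/
def freeActₗ : H ⊗[ℂ] Alg G.n →ₗ[ℂ] Alg G.n →ₗ[ℂ] H ⊗[ℂ] Alg G.n :=
  LinearMap.mk₂ ℂ (G.freeAct φ) (fun y z a => by simp [freeAct]) (fun c y a => by simp [freeAct])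
    (fun y a b => by simp [freeAct]) (fun c y a => by simp [freeAct])

variable {B : Type w} [NonUnitalCStarAlgebra B] {j : Alg G.n →ₗ[ℂ] B}

variable [Nonempty I] (hφ : G.IsLeftHaar φ)

include hφ

lemma IsLeftHaar.freeInner_freeAct (y z : H ⊗[ℂ] Alg G.n) (a : Alg G.n) :
    G.freeInner φ y (G.freeAct φ z a) = G.conv φ (G.freeInner φ y z) a := by
  change G.freeInner φ y (freeActₗ G φ H z a) = _
  induction y with
  | zero => simp
  | add y y' hy hy' => simp only [map_add, LinearMap.add_apply, hy, hy']
  | tmul v b =>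
    induction z with
    | zero => simp
    | add z z' hz hz' => simp only [map_add, LinearMap.add_apply, hz, hz']
    | tmul w c =>
      change G.freeInner φ _ (G.freeAct φ (w ⊗ₜ c) a) = _
      rw [freeAct_tmul, freeInner_tmul, freeInner_tmul, map_smul, LinearMap.smul_apply,
        hφ.conv_assoc]

lemma IsLeftHaar.sharp_freeInner (y z : H ⊗[ℂ] Alg G.n) :
    G.sharp φ (G.freeInner φ y z) = G.freeInner φ z y := by
  induction y with
  | zero => simp
  | add y y' hy hy' => simp only [map_add, LinearMap.add_apply, hy, hy']
  | tmul v b =>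
    induction z with
    | zero => simp
    | add z z' hz hz' => simp only [map_add, LinearMap.add_apply, hz, hz']
    | tmul w c =>
      rw [freeInner_tmul, freeInner_tmul, map_smulₛₗ, hφ.sharp_conv, hφ.sharp_sharp,
        inner_conj_symm]

omit [Nonempty I] hφ in
lemma IsStarHom.exists_map_freeInner_self (hj : G.IsStarHom φ j) (y : H ⊗[ℂ] Alg G.n) :
    ∃ b, j (G.freeInner φ y y) = star b * b := by
  obtain ⟨k, b, hb⟩ := exists_freeInner_self_eq_sum φ y
  rw [hb, map_sum]
  simp_rw [hj.map_conv, hj.map_sharp]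
  exact exists_sum_star_mul_self _

end free

section completions

variable [Nonempty I] (hφ : G.IsLeftHaar φ)
variable {C : Type w} [NonUnitalCStarAlgebra C] [PartialOrder C]
variable {ΔC : C →⋆ₙₐ[ℂ] MultV G.n C} {C₀ : NonUnitalStarSubalgebra ℂ C} {h : C}
variable {H : Type v} [NormedAddCommGroup H] [InnerProductSpace ℂ H] [CompleteSpace H]
variable {U : MultV G.n (H →L[ℂ] H)} {π : C →⋆ₙₐ[ℂ] (H →L[ℂ] H)}
variable (hπ : G.IsCovariant ΔC U π) (hU : G.IsUnitaryRep U) (hp : G.IsProper φ ΔC C₀ h)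
variable {B : Type x} [NonUnitalCStarAlgebra B] {j : Alg G.n →ₗ[ℂ] B}

include hφ

theorem IsLeftHaar.hasCompletions (hT : star h = h) (hj : G.IsCStarCompletion φ j) :
    HasCompletions G φ j (fun ξ a => modAct φ hπ hU hp ξ a)
      (fun ξ η => modInner φ hπ hU hp ξ η) (modSigma φ hπ hU hp) := by
  have hj' := hj.toIsStarHom
  let ipF : H ⊗[ℂ] Alg G.n →ₗ⋆[ℂ] H ⊗[ℂ] Alg G.n →ₗ[ℂ] B :=
    LinearMap.mk₂'ₛₗ (starRingEnd ℂ) (RingHom.id ℂ) (fun y z => j (G.freeInner φ y z))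
      (fun _ _ _ => by simp) (fun _ _ _ => by simp) (fun _ _ _ => by simp) (fun _ _ _ => by simp)
  obtain ⟨F, _, _, _, 𝓕, ιF, hιF, hactF, hinnF, hcactF, hcinnF⟩ :=
    exists_hilbertModule_completion (act := freeActₗ G φ H) (ip := ipF) hj.dense
      (fun y z a => by
        change j (G.freeInner φ y (G.freeAct φ z a)) = j (G.freeInner φ y z) * j a
        rw [hφ.freeInner_freeAct, hj'.map_conv])
      (fun y z => by
        change star (j (G.freeInner φ y z)) = j (G.freeInner φ z y)
        rw [← hj'.map_sharp, hφ.sharp_freeInner])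
      (fun y => hj'.exists_map_freeInner_self y)
  -- `H₀` is lifted to the universe of the free module
  let e : ULift.{u} (H₀ C₀ π) ≃ₗ[ℂ] H₀ C₀ π := ULift.moduleEquiv
  let ipE : ULift.{u} (H₀ C₀ π) →ₗ⋆[ℂ] ULift.{u} (H₀ C₀ π) →ₗ[ℂ] B :=
    LinearMap.mk₂'ₛₗ (starRingEnd ℂ) (RingHom.id ℂ)
      (fun y z => j (modInner φ hπ hU hp (e y) (e z)))
      (fun _ _ _ => by simp) (fun _ _ _ => by simp) (fun _ _ _ => by simp) (fun _ _ _ => by simp)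
  let actE : ULift.{u} (H₀ C₀ π) →ₗ[ℂ] Alg G.n →ₗ[ℂ] ULift.{u} (H₀ C₀ π) :=
    LinearMap.mk₂ ℂ (fun y a => e.symm (modAct φ hπ hU hp (e y) a))
      (fun _ _ _ => by simp) (fun _ _ _ => by simp) (fun _ _ _ => by simp) (fun _ _ _ => by simp)
  obtain ⟨E, _, _, _, 𝓔, ι, hι, hactE, hinnE, hcactE, hcinnE⟩ :=
    exists_hilbertModule_completion (act := actE) (ip := ipE) hj.dense
      (fun y z a => by
        change j (modInner φ hπ hU hp (e y) (e (e.symm (modAct φ hπ hU hp (e z) a)))) =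
          j (modInner φ hπ hU hp (e y) (e z)) * j a
        rw [e.apply_symm_apply, hφ.modInner_modAct, hj'.map_conv])
      (fun y z => by
        change star (j (modInner φ hπ hU hp (e y) (e z))) = j (modInner φ hπ hU hp (e z) (e y))
        rw [← hj'.map_sharp, hφ.sharp_modInner])
      (fun y => by
        change ∃ b, j (modInner φ hπ hU hp (e y) (e y)) = star b * b
        rw [← hφ.freeInner_modSigma hπ hU hp hT]
        exact hj'.exists_map_freeInner_self _)
  let ιE : H₀ C₀ π →ₗ[ℂ] E := ι ∘ₗ e.symm.toLinearMap
  have hιE : DenseRange ιE := by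
    have h1 : Set.range ιE = Set.range ι := e.symm.surjective.range_comp ι
    rw [DenseRange, h1]
    exact hι
  have hinnE' : ∀ ξ η, 𝓔.inner (ιE ξ) (ιE η) = j (modInner φ hπ hU hp ξ η) := fun ξ η =>
    hinnE (e.symm ξ) (e.symm η)
  have hactE' : ∀ ξ a, ιE (modAct φ hπ hU hp ξ a) = 𝓔.act (ιE ξ) (j a) := fun ξ a =>
    hactE (e.symm ξ) a
  have hinnF' : ∀ y z, 𝓕.inner (ιF y) (ιF z) = j (G.freeInner φ y z) := hinnF
  have hactF' : ∀ y a, ιF (G.freeAct φ y a) = 𝓕.act (ιF y) (j a) := hactF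
  have hn : ∀ ξ, ‖(ιF ∘ₗ modSigma φ hπ hU hp) ξ‖ = ‖ιE ξ‖ := fun ξ => by
    have h1 : ‖(ιF ∘ₗ modSigma φ hπ hU hp) ξ‖ ^ 2 = ‖ιE ξ‖ ^ 2 := by
      rw [𝓕.norm_sq, 𝓔.norm_sq, LinearMap.comp_apply, hinnF', hinnE',
        hφ.freeInner_modSigma hπ hU hp hT]
    exact (sq_eq_sq₀ (norm_nonneg _) (norm_nonneg _)).mp h1
  let Sh : E →L[ℂ] F := (ιF ∘ₗ modSigma φ hπ hU hp).extendOfNorm ιE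
  have hSh : ∀ ξ, Sh (ιE ξ) = ιF (modSigma φ hπ hU hp ξ) :=
    LinearMap.extendOfNorm_eq hιE ⟨1, fun ξ => by rw [hn, one_mul]⟩
  have hShinn : ∀ y z, 𝓕.inner (Sh y) (Sh z) = 𝓔.inner y z := fun y z => by
    refine hιE.induction_on₂ ?_ (fun ξ η => ?_) y z
    · exact isClosed_eq (hcinnF.comp (by fun_prop : Continuous fun q : E × E => (Sh q.1, Sh q.2)))
        hcinnE
    · rw [hSh, hSh, hinnF', hinnE', hφ.freeInner_modSigma hπ hU hp hT]
  have hShact : ∀ y b, Sh (𝓔.act y b) = 𝓕.act (Sh y) b := fun y b => by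
    have hcl : IsClosed {q : E × B | Sh (𝓔.act q.1 q.2) = 𝓕.act (Sh q.1) q.2} :=
      isClosed_eq (Sh.continuous.comp hcactE)
        (hcactF.comp (by fun_prop : Continuous fun q : E × B => (Sh q.1, q.2)))
    refine isClosed_property (hιE.prodMap hj.dense) hcl (fun q => ?_) (y, b)
    change Sh (𝓔.act (ιE q.1) (j q.2)) = 𝓕.act (Sh (ιE q.1)) (j q.2)
    rw [← hactE', hSh, hSh, hφ.modSigma_modAct, hactF']
  have hiso : Isometry Sh := AddMonoidHomClass.isometry_of_norm Sh fun y => by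
    have h1 : ‖Sh y‖ ^ 2 = ‖y‖ ^ 2 := by rw [𝓕.norm_sq, 𝓔.norm_sq, hShinn]
    exact (sq_eq_sq₀ (norm_nonneg _) (norm_nonneg _)).mp h1
  exact ⟨E, F, inferInstance, inferInstance, inferInstance, inferInstance, inferInstance,
    inferInstance, 𝓔, 𝓕, ιE, ιF, Sh.toLinearMap, ⟨hιE, hactE', hinnE'⟩, ⟨hιF, hactF', hinnF'⟩,
    hSh, hShact, hShinn, hiso.isClosedEmbedding⟩

end completions

end DiscreteQuantumGroup

end QGrp

/-! ### The full and the reduced C*-algebra -/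

namespace QGrp

/-- The Hilbert space of a positive semidefinite sesquilinear form. -/
lemma exists_hilbertSpace_completion {M : Type x} [AddCommGroup M] [Module ℂ M]
    (ip : M →ₗ⋆[ℂ] M →ₗ[ℂ] ℂ) (h_symm : ∀ y z, star (ip z y) = ip y z)
    (h_nonneg : ∀ y, 0 ≤ (ip y y).re) :
    ∃ (L : Type x) (_ : NormedAddCommGroup L) (_ : InnerProductSpace ℂ L) (_ : CompleteSpace L)
      (ι : M →ₗ[ℂ] L), DenseRange ι ∧ ∀ y z, inner ℂ (ι y) (ι z) = ip y z := by
  let c : PreInnerProductSpace.Core ℂ M :=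
    { inner := fun y z => ip y z
      conj_inner_symm := h_symm
      re_inner_nonneg := h_nonneg
      add_left := fun y y' z => by simp
      smul_left := fun y z r => by simp }
  let : SeminormedAddCommGroup M := InnerProductSpace.Core.toSeminormedAddCommGroup (𝕜 := ℂ)
  let : InnerProductSpace ℂ M := InnerProductSpace.ofCore c
  exact ⟨UniformSpace.Completion M, inferInstance, inferInstance, inferInstance,
    (UniformSpace.Completion.toComplₗᵢ (𝕜 := ℂ) (E := M)).toLinearMap,
    UniformSpace.Completion.denseRange_coe, fun y z => UniformSpace.Completion.inner_coe y z⟩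

namespace DiscreteQuantumGroup

variable {I : Type u} {G : DiscreteQuantumGroup I} {φ : Alg G.n →ₗ[ℂ] ℂ}

/-- The closure of the range of a star-homomorphism is a C*-algebra. -/
lemma IsStarHom.exists_dense {D : Type w} [NonUnitalCStarAlgebra D] {f : Alg G.n →ₗ[ℂ] D}
    (hf : G.IsStarHom φ f) : ∃ (B : Type w) (_ : NonUnitalCStarAlgebra B) (j : Alg G.n →ₗ[ℂ] B),
      G.IsStarHom φ j ∧ DenseRange j ∧ ∀ a, ‖j a‖ = ‖f a‖ := by
  let S : NonUnitalStarSubalgebra ℂ D :=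
    { carrier := Set.range f
      zero_mem' := ⟨0, map_zero f⟩
      add_mem' := by
        rintro _ _ ⟨a, rfl⟩ ⟨b, rfl⟩
        exact ⟨a + b, map_add f a b⟩
      mul_mem' := by
        rintro _ _ ⟨a, rfl⟩ ⟨b, rfl⟩
        exact ⟨G.conv φ a b, hf.map_conv a b⟩
      smul_mem' := by
        rintro c _ ⟨a, rfl⟩
        exact ⟨c • a, map_smul f c a⟩
      star_mem' := by
        rintro _ ⟨a, rfl⟩
        exact ⟨G.sharp φ a, hf.map_sharp a⟩ }
  have : IsClosed (S.topologicalClosure : Set D) := S.isClosed_topologicalClosure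
  let j : Alg G.n →ₗ[ℂ] S.topologicalClosure :=
    { toFun := fun a => ⟨f a, S.le_topologicalClosure ⟨a, rfl⟩⟩
      map_add' := fun a b => Subtype.ext (map_add f a b)
      map_smul' := fun c a => Subtype.ext (map_smul f c a) }
  refine ⟨S.topologicalClosure, inferInstance, j,
    ⟨fun a b => Subtype.ext (hf.map_conv a b), fun a => Subtype.ext (hf.map_sharp a)⟩,
    fun y => ?_, fun a => rfl⟩
  rw [Topology.IsEmbedding.subtypeVal.closure_eq_preimage_closure_image, Set.mem_preimage]
  have h1 : Subtype.val '' Set.range j = Set.range f := by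
    rw [← Set.range_comp]
    rfl
  rw [h1]
  exact y.2

variable [Nonempty I] (hφ : G.IsLeftHaar φ)

include hφ

lemma IsLeftHaar.sharp_convOne_conv_convOne :
    G.conv φ (G.sharp φ (convOne φ)) (convOne φ) = convOne φ := by
  have h1 := congrArg (G.sharp φ) (hφ.conv_convOne (G.sharp φ (convOne φ)))
  rw [hφ.sharp_conv, hφ.sharp_sharp, hφ.conv_convOne] at h1
  rw [hφ.conv_convOne, h1]

/-- All star-homomorphisms of `Â₀` into C*-algebras are contractive on the coefficients of the
unitary corepresentations, hence they are uniformly bounded on every element. -/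
lemma IsLeftHaar.exists_norm_le (a : Alg G.n) : ∃ M : ℝ, ∀ (D : Type w) [NonUnitalCStarAlgebra D]
    (f : Alg G.n →ₗ[ℂ] D), G.IsStarHom φ f → ‖f a‖ ≤ M := by
  obtain ⟨w, hw, hw'⟩ := hφ.exists_unitary_coef
  obtain ⟨F, c, ha⟩ := hφ.eq_sum_unitary_coef hw a
  refine ⟨∑ α ∈ F, ∑ i, ∑ j, ‖c α i j‖, fun D _ f hf => ?_⟩
  have h1 : ‖f (convOne φ)‖ ≤ 1 := by
    have h2 : star (f (convOne φ)) * f (convOne φ) = f (convOne φ) := by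
      rw [← hf.map_sharp, ← hf.map_conv, hφ.sharp_convOne_conv_convOne]
    have h3 := CStarRing.norm_star_mul_self (x := f (convOne φ))
    rw [h2] at h3
    by_contra! h4
    nlinarith
  have h2 : ∀ α i j, ‖f (w α i j)‖ ≤ 1 := fun α i j => by
    let := CStarAlgebra.spectralOrder D
    have := CStarAlgebra.spectralOrderedRing D
    have h3 : ∑ k, star (f (w α k j)) * f (w α k j) = f (convOne φ) := by
      have h4 := congrArg f (hw' α j j)
      rw [if_pos rfl, map_sum] at h4
      rw [← h4]
      refine Finset.sum_congr rfl fun k _ => ?_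
      rw [hf.map_conv, hf.map_sharp]
    have h4 : star (f (w α i j)) * f (w α i j) ≤ f (convOne φ) := by
      rw [← h3]
      exact Finset.single_le_sum (f := fun k => star (f (w α k j)) * f (w α k j))
        (fun k _ => star_mul_self_nonneg _) (Finset.mem_univ i)
    have h5 := CStarAlgebra.norm_le_norm_of_nonneg_of_le (star_mul_self_nonneg _) h4
    rw [CStarRing.norm_star_mul_self] at h5
    by_contra! h6
    nlinarith
  conv_lhs => rw [ha]
  simp only [map_sum, map_smul]
  refine norm_sum_le_of_le _ fun α _ => norm_sum_le_of_le _ fun i _ => norm_sum_le_of_le _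
    fun j _ => ?_
  rw [norm_smul]
  exact mul_le_of_le_one_right (norm_nonneg _) (h2 α i j)

/-- The regular representation of `Â₀` by bounded operators on `L²(φ)`. -/
lemma IsLeftHaar.exists_regular : ∃ (L : Type u) (_ : NormedAddCommGroup L)
    (_ : InnerProductSpace ℂ L) (_ : CompleteSpace L) (ι : Alg G.n →ₗ[ℂ] L)
    (Λ : Alg G.n →ₗ[ℂ] L →L[ℂ] L), DenseRange ι ∧
      (∀ b c, inner ℂ (ι b) (ι c) = φ (star b * c)) ∧
      (∀ a b, Λ a (ι b) = ι (G.lam φ a b)) ∧ G.IsStarHom φ Λ := by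
  let ip : Alg G.n →ₗ⋆[ℂ] Alg G.n →ₗ[ℂ] ℂ :=
    LinearMap.mk₂'ₛₗ (starRingEnd ℂ) (RingHom.id ℂ) (fun b c => φ (star b * c))
      (fun _ _ _ => by simp [add_mul]) (fun c b d => by rw [star_smul, smul_mul_assoc, map_smul]; rfl)
      (fun _ _ _ => by simp [mul_add]) (fun c b d => by rw [mul_smul_comm, map_smul]; rfl)
  obtain ⟨L, _, _, _, ι, hι, hinn⟩ := exists_hilbertSpace_completion ip
    (fun b c => hφ.conj_symm c b) (fun b => (Complex.nonneg_iff.mp (hφ.nonneg b)).1)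
  have hinn' : ∀ b c, inner ℂ (ι b) (ι c) = φ (star b * c) := hinn
  have hsq : ∀ b, (‖ι b‖ ^ 2 : ℝ) = (φ (star b * b)).re := fun b => by
    rw [← hinn', norm_sq_eq_re_inner (𝕜 := ℂ)]
    rfl
  -- boundedness, by the unitarity of the coefficient matrices
  have hbd : ∀ a, ∃ K, ∀ b, ‖(ι ∘ₗ G.lam φ a) b‖ ≤ K * ‖ι b‖ := fun a => by
    obtain ⟨w, hw, hw'⟩ := hφ.exists_unitary_coef
    obtain ⟨F, c, ha⟩ := hφ.eq_sum_unitary_coef hw a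
    have h2 : ∀ α i j b, ‖ι (G.lam φ (w α i j) b)‖ ≤ ‖ι b‖ := fun α i j b => by
      have h3 : ∑ k, ‖ι (G.lam φ (w α k j) b)‖ ^ 2 = ‖ι b‖ ^ 2 := by
        simp_rw [hsq]
        rw [← Complex.re_sum]
        congr 1
        have h4 : ∀ k, φ (star (G.lam φ (w α k j) b) * G.lam φ (w α k j) b) =
            φ (star b * G.lam φ (G.conv φ (G.sharp φ (w α k j)) (w α k j)) b) := fun k => by
          rw [hφ.lam_conv, hφ.apply_star_mul_lam (G.sharp φ (w α k j)), hφ.sharp_sharp]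
        simp_rw [h4]
        rw [← map_sum, ← Finset.mul_sum, ← LinearMap.sum_apply, ← map_sum, hw', if_pos rfl,
          hφ.lam_convOne]
      refine (sq_le_sq₀ (norm_nonneg _) (norm_nonneg _)).mp ?_
      rw [← h3]
      exact Finset.single_le_sum (f := fun k => ‖ι (G.lam φ (w α k j) b)‖ ^ 2)
        (fun k _ => sq_nonneg _) (Finset.mem_univ i)
    refine ⟨∑ α ∈ F, ∑ i, ∑ j, ‖c α i j‖, fun b => ?_⟩
    rw [LinearMap.comp_apply]
    conv_lhs => rw [ha]
    simp only [map_sum, map_smul, LinearMap.sum_apply, LinearMap.smul_apply, Finset.sum_mul]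
    refine norm_sum_le_of_le _ fun α _ => norm_sum_le_of_le _ fun i _ => norm_sum_le_of_le _
      fun j _ => ?_
    rw [norm_smul]
    exact mul_le_mul_of_nonneg_left (h2 α i j b) (norm_nonneg _)
  have hT : ∀ a b, (ι ∘ₗ G.lam φ a).extendOfNorm ι (ι b) = ι (G.lam φ a b) := fun a b =>
    LinearMap.extendOfNorm_eq hι (hbd a) b
  have hext : ∀ S T : L →L[ℂ] L, (∀ b, S (ι b) = T (ι b)) → S = T := fun S T h =>
    ContinuousLinearMap.ext fun y => by
      refine hι.induction_on y (isClosed_eq (by fun_prop) (by fun_prop)) h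
  let Λ : Alg G.n →ₗ[ℂ] L →L[ℂ] L :=
    { toFun := fun a => (ι ∘ₗ G.lam φ a).extendOfNorm ι
      map_add' := fun a a' => hext _ _ fun b => by
        rw [hT, _root_.add_apply, hT, hT, map_add, LinearMap.add_apply, map_add]
      map_smul' := fun c a => hext _ _ fun b => by
        rw [hT, _root_.smul_apply, hT, map_smul, LinearMap.smul_apply, map_smul]
        rfl }
  have hΛ : ∀ a b, Λ a (ι b) = ι (G.lam φ a b) := hT
  refine ⟨L, inferInstance, inferInstance, inferInstance, ι, Λ, hι, hinn', hΛ, ⟨fun a a' => ?_,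
    fun a => ?_⟩⟩
  · refine hext _ _ fun b => ?_
    rw [hΛ, hφ.lam_conv, ← hΛ, ← hΛ]
    rfl
  · rw [ContinuousLinearMap.star_eq_adjoint, ContinuousLinearMap.eq_adjoint_iff]
    intro y z
    refine hι.induction_on y (isClosed_eq (by fun_prop) (by fun_prop)) fun b => ?_
    refine hι.induction_on z (isClosed_eq (by fun_prop) (by fun_prop)) fun c => ?_
    rw [hΛ, hΛ, hinn', hinn', hφ.apply_star_mul_lam]

lemma IsLeftHaar.exists_isReduced : ∃ (B : Type u) (_ : NonUnitalCStarAlgebra B)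
    (j : Alg G.n →ₗ[ℂ] B), G.IsReduced φ j := by
  obtain ⟨L, _, _, _, ι, Λ, hι, hinn, hΛ, hΛs⟩ := hφ.exists_regular
  have hsq : ∀ b, √(φ (star b * b)).re = ‖ι b‖ := fun b => by
    rw [← hinn, norm_eq_sqrt_re_inner (𝕜 := ℂ)]
    rfl
  have hinj : ∀ b, ι b = 0 → b = 0 := fun b hb => hφ.eq_zero_of_forall fun x => by
    have h1 := hinn (star x) b
    rwa [hb, inner_zero_right, star_star, eq_comm] at h1
  obtain ⟨B, _, j, hj, hdense, hnorm⟩ := hΛs.exists_dense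
  refine ⟨B, inferInstance, j, ⟨⟨hj, ?_, hdense⟩, fun a => ?_⟩⟩
  · rw [injective_iff_map_eq_zero]
    intro a ha
    have h1 : Λ a = 0 := by rw [← norm_eq_zero, ← hnorm, ha, norm_zero]
    refine hφ.lam_injective (LinearMap.ext fun b => ?_)
    rw [map_zero, LinearMap.zero_apply]
    refine hinj _ ?_
    rw [← hΛ, h1, _root_.zero_apply]
  · rw [hnorm]
    constructor
    · rintro r ⟨b, y, hy, hb, rfl⟩
      rw [← hφ.coe_lam] at hy
      rw [Subtype.ext hy, hsq, ← hΛ]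
      refine (Λ a).unit_le_opNorm _ ?_
      rw [← hsq]
      exact Real.sqrt_le_one.mpr hb
    · intro K hK
      have hK1 : ∀ b, ‖ι b‖ ≤ 1 → ‖Λ a (ι b)‖ ≤ K := fun b hb => by
        refine hK ⟨b, G.lam φ a b, hφ.coe_lam a b, ?_, by rw [hsq, hΛ]⟩
        rw [← hsq] at hb
        exact Real.sqrt_le_one.mp hb
      have hK0 : 0 ≤ K := by simpa using hK1 0 (by simp)
      have hK2 : ∀ b, ‖Λ a (ι b)‖ ≤ K * ‖ι b‖ := fun b => by
        rcases eq_or_ne (ι b) 0 with h0 | h0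
        · simp [h0]
        · have h1 := hK1 (((‖ι b‖⁻¹ : ℝ) : ℂ) • b) (by
            rw [map_smul, norm_smul, Complex.norm_real, norm_inv, norm_norm,
              inv_mul_cancel₀ (norm_ne_zero_iff.mpr h0)])
          rw [map_smul, map_smul, norm_smul, Complex.norm_real, norm_inv, norm_norm] at h1
          rwa [inv_mul_le_iff₀ (norm_pos_iff.mpr h0), mul_comm] at h1
      refine (Λ a).opNorm_le_bound hK0 fun y => ?_
      exact hι.induction_on y (isClosed_le (by fun_prop) (by fun_prop)) hK2

lemma IsLeftHaar.exists_isFull : ∃ (B : Type u) (_ : NonUnitalCStarAlgebra B)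
    (j : Alg G.n →ₗ[ℂ] B), G.IsFull φ j := by
  -- the seminorms that come from star-homomorphisms form a set, over which the product is taken
  let J : Type u := {p : Alg G.n → ℝ // ∃ (D : Type u) (_ : NonUnitalCStarAlgebra D)
    (f : Alg G.n →ₗ[ℂ] D), G.IsStarHom φ f ∧ ∀ a, p a = ‖f a‖}
  choose D instD f hf hp using fun p : J => p.2
  choose M hM using hφ.exists_norm_le
  let F : Alg G.n →ₗ[ℂ] lp D ⊤ :=
    { toFun := fun a => ⟨fun p => f p a, memℓp_infty ⟨M a, by
        rintro _ ⟨p, rfl⟩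
        exact hM a (D p) (f p) (hf p)⟩⟩
      map_add' := fun a b => Subtype.ext (funext fun p => map_add (f p) a b)
      map_smul' := fun c a => Subtype.ext (funext fun p => map_smul (f p) c a) }
  have hF : G.IsStarHom φ F :=
    ⟨fun a b => Subtype.ext (funext fun p => (hf p).map_conv a b),
      fun a => Subtype.ext (funext fun p => (hf p).map_sharp a)⟩
  obtain ⟨B, _, j, hj, hdense, hnorm⟩ := hF.exists_dense
  have huniv : ∀ (D : Type u) [NonUnitalCStarAlgebra D] (f : Alg G.n →ₗ[ℂ] D),
      G.IsStarHom φ f → ∀ a, ‖f a‖ ≤ ‖j a‖ := fun D' _ f' hf' a => by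
    let p : J := ⟨fun a => ‖f' a‖, D', inferInstance, f', hf', fun _ => rfl⟩
    have h1 : ‖f' a‖ = ‖f p a‖ := hp p a
    rw [h1, hnorm]
    exact lp.norm_apply_le_norm ENNReal.top_ne_zero (F a) p
  refine ⟨B, inferInstance, j, ⟨⟨hj, ?_, hdense⟩, huniv⟩⟩
  obtain ⟨B', _, j', hj'⟩ := hφ.exists_isReduced
  rw [injective_iff_map_eq_zero]
  intro a ha
  have h1 := huniv B' j' hj'.toIsStarHom a
  rw [ha, norm_zero, norm_le_zero_iff] at h1
  exact hj'.injective (by rw [h1, map_zero])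

end DiscreteQuantumGroup

end QGrp

end

theorem mainTheorem4 {I : Type u} (G : QGrp.DiscreteQuantumGroup I)
    (φ : QGrp.Alg G.n →ₗ[ℂ] ℂ) (hφ : G.IsLeftHaar φ)
    {C : Type w} [NonUnitalCStarAlgebra C] [PartialOrder C] [StarOrderedRing C]
    (ΔC : C →⋆ₙₐ[ℂ] QGrp.MultV G.n C) (hΔC : G.IsAction ΔC)
    (C₀ : NonUnitalStarSubalgebra ℂ C) (h : C) (hproper : G.IsProper φ ΔC C₀ h)
    {H : Type v} [NormedAddCommGroup H] [InnerProductSpace ℂ H] [CompleteSpace H]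
    (U : QGrp.MultV G.n (H →L[ℂ] H)) (hU : G.IsUnitaryRep U)
    (π : C →⋆ₙₐ[ℂ] (H →L[ℂ] H)) (hπ : G.IsCovariant ΔC U π) :
    ∃ (act : QGrp.H₀ C₀ π →ₗ[ℂ] QGrp.Alg G.n →ₗ[ℂ] QGrp.H₀ C₀ π)
      (ip : QGrp.H₀ C₀ π →ₗ⋆[ℂ] QGrp.H₀ C₀ π →ₗ[ℂ] QGrp.Alg G.n)
      (Sg : QGrp.H₀ C₀ π →ₗ[ℂ] H ⊗[ℂ] QGrp.Alg G.n),
      -- the right action, the inner product `θ⁻¹ T_{ξη}(U)` and `Σ` are well defined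
      (∀ ξ a, (act ξ a : H) = G.actVec φ U ξ a) ∧
      (∀ ξ η, (ip ξ η : QGrp.Mult G.n) = G.thetaInv φ * G.coeff U ξ η) ∧
      (∀ ξ, QGrp.toMultV (Sg ξ) = G.sigmaVec φ U (π h) ξ) ∧
      (∀ ξ a b, act (act ξ a) b = act ξ (G.conv φ a b)) ∧
      -- `Σ` is a right module map and preserves inner products
      (∀ ξ a, Sg (act ξ a) = G.freeAct φ (Sg ξ) a) ∧
      (∀ ξ η, G.freeInner φ (Sg ξ) (Sg η) = ip ξ η) ∧
      -- `ip` is a positive inner product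
      (∀ ξ η a, ip ξ (act η a) = G.conv φ (ip ξ η) a) ∧
      (∀ ξ η, G.sharp φ (ip ξ η) = ip η ξ) ∧
      (∀ ξ, ∃ (k : ℕ) (y : Fin k → QGrp.Alg G.n),
        ip ξ ξ = ∑ i, G.conv φ (G.sharp φ (y i)) (y i)) ∧
      (∀ ξ, ip ξ ξ = 0 → ξ = 0) ∧
      -- completion over any C*-algebra that contains `Â₀` as a dense star-subalgebra
      (∀ (B : Type x) [NonUnitalCStarAlgebra B] (j : QGrp.Alg G.n →ₗ[ℂ] B),
        G.IsCStarCompletion φ j →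
        QGrp.HasCompletions G φ j (fun ξ a => act ξ a) (fun ξ η => ip ξ η) Sg) ∧
      -- in particular over the full and over the reduced C*-algebra
      (∃ (B : Type u) (_ : NonUnitalCStarAlgebra B) (j : QGrp.Alg G.n →ₗ[ℂ] B),
        G.IsFull φ j ∧
        QGrp.HasCompletions G φ j (fun ξ a => act ξ a) (fun ξ η => ip ξ η) Sg) ∧
      (∃ (B : Type u) (_ : NonUnitalCStarAlgebra B) (j : QGrp.Alg G.n →ₗ[ℂ] B),
        G.IsReduced φ j ∧
        QGrp.HasCompletions G φ j (fun ξ a => act ξ a) (fun ξ η => ip ξ η) Sg) := by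
  have := hφ.nonempty
  have hT : star h = h := (IsSelfAdjoint.of_nonneg hproper.h_nonneg).star_eq
  obtain ⟨B, instB, j, hj⟩ := hφ.exists_isFull
  obtain ⟨B', instB', j', hj'⟩ := hφ.exists_isReduced
  refine ⟨QGrp.DiscreteQuantumGroup.modAct φ hπ hU hproper,
    QGrp.DiscreteQuantumGroup.modInner φ hπ hU hproper,
    QGrp.DiscreteQuantumGroup.modSigma φ hπ hU hproper,
    fun ξ a => (hφ.actVec_eq (ξ : H) a).symm,
    QGrp.DiscreteQuantumGroup.coe_modInner φ hπ hU hproper,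
    QGrp.DiscreteQuantumGroup.toMultV_modSigma φ hπ hU hproper,
    hφ.modAct_modAct hπ hU hproper, hφ.modSigma_modAct hπ hU hproper,
    hφ.freeInner_modSigma hπ hU hproper hT, hφ.modInner_modAct hπ hU hproper,
    hφ.sharp_modInner hπ hU hproper, fun ξ => ?_, hφ.eq_zero_of_modInner_self hπ hU hproper,
    fun B _ j hj => hφ.hasCompletions hπ hU hproper hT hj,
    ⟨B, instB, j, hj, hφ.hasCompletions hπ hU hproper hT hj.toIsCStarCompletion⟩,
    ⟨B', instB', j', hj', hφ.hasCompletions hπ hU hproper hT hj'.toIsCStarCompletion⟩⟩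
  rw [← hφ.freeInner_modSigma hπ hU hproper hT]
  exact QGrp.DiscreteQuantumGroup.exists_freeInner_self_eq_sum φ _
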